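/- Let $n \ge 3$ and let $M$ be a compact, connected, oriented smooth $n$-manifold without boundary. For continuous Riemannian metrics $g, g_0$ on $M$, $p>n$, $D>0$ and $x,y\in M$ set $$\mathcal H_{p,g_0}(f)=\sup_{x\ne y}\frac{|f(x)-f(y)|}{d_{g_0}(x,y)^{\frac{p-n}{p}}},$$ $$d^D_{p,g,g_0}(x,y)=\sup\Big\{|f(x)-f(y)| \;:\; \mathcal H_{p,g_0}(f)\le D,\ \int_M|\nabla^g f|_g^p\,dV_g\le 1\Big\},$$ where $f:M\to\mathbb R$ ranges over the weakly differentiable functions, $\nabla^g f$ is the weak gradient, $d_{g_0}$ is the Riemannian distance of $g_0$ (the infimum of the lengths of $C^1$ paths) and $dV_g$ is the Riemannian volume measure. If $\lambda_1^2,\dots,\lambda_n^2$ are the eigenvalues of $g$ with respect to $g_0$ at a point, write $|g|_{g_0}=\sqrt{\sum_i\lambda_i^4}$ and $|g^{-1}-g_0^{-1}|_{g_0}=\sqrt{\sum_i(\lambda_i^{-2}-1)^2}$ there. Let $g_0$ be a continuous Riemannian metric on $M$. Then there is a constant $\bar D=\bar D(g_0)>0$ such that the following holds for every real $p>3n$,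 every $D\ge\bar D$ and every sequence $(g_j)_{j\in\mathbb N}$ of continuous Riemannian metrics on $M$: if for some constant $C$ $$\int_M|g_j|_{g_0}^{\frac n2}\,dV_{g_0}\le C\quad\text{for all } j,\qquad\text{and}\qquad \int_M|g_j^{-1}-g_0^{-1}|_{g_0}^{\frac{n(p-1)}2}\,dV_{g_0}\longrightarrow 0\quad (j\to\infty),$$ then $d^D_{p,g_j,g_0}\to d^D_{p,g_0,g_0}$ uniformly on $M\times M$. -/

import Mathlib

open MeasureTheory Filter Topology Bundle
open scoped Manifold ContDiff ENNReal

namespace ModifiedDp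

noncomputable section

/-- The coordinate space `ℝⁿ`, with its Euclidean norm. -/
abbrev Coord (n : ℕ) : Type := EuclideanSpace ℝ (Fin n)

/-- A continuous Riemannian metric on the manifold `M` of dimension `n`. -/
abbrev Metric (n : ℕ) (M : Type*) [TopologicalSpace M] [ChartedSpace (Coord n) M]
    [IsManifold (𝓡 n) ∞ M] : Type _ :=
  ContinuousRiemannianMetric (Coord n) (fun x : M => TangentSpace (𝓡 n) x)

/-- Orientability: `M` is covered by a family of smooth charts whose transition maps all have
positive Jacobian determinant. -/
def IsOrientable (n : ℕ) (M : Type*) [TopologicalSpace M] [ChartedSpace (Coord n) M] : Prop :=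
  ∃ A : Set (OpenPartialHomeomorph M (Coord n)),
    A ⊆ IsManifold.maximalAtlas (𝓡 n) ∞ M ∧
    (∀ x : M, ∃ e ∈ A, x ∈ e.source) ∧
    ∀ e ∈ A, ∀ e' ∈ A, ∀ x ∈ e.source ∩ e'.source,
      0 < (fderiv ℝ (fun y => e' (e.symm y)) (e x)).det

section

variable {n : ℕ} {M : Type*} [TopologicalSpace M] [ChartedSpace (Coord n) M]

/-- The `i`-th coordinate vector `∂ᵢ` of the chart `e`, at the point `e.symm y`. -/
def coordVec (e : OpenPartialHomeomorph M (Coord n)) (i : Fin n) (y : Coord n) :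
    TangentSpace (𝓡 n) (e.symm y) :=
  mfderiv (𝓡 n) (𝓡 n) e.symm y (EuclideanSpace.single i (1 : ℝ))

variable [IsManifold (𝓡 n) ∞ M]

/-- The components `g(∂ᵢ, ∂ⱼ)` of `g` in the chart `e`, at the point `e.symm y`. -/
def chartGram (g : Metric n M) (e : OpenPartialHomeomorph M (Coord n)) (y : Coord n) :
    Matrix (Fin n) (Fin n) ℝ :=
  Matrix.of fun i j => g.inner (e.symm y) (coordVec e i y) (coordVec e j y)

/-- The Riemannian volume in the domain of the chart `e`: the measure `√(det gᵢⱼ) dy`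
on `e.target`, transported to `M`. -/
def chartVolume [MeasurableSpace M] (g : Metric n M) (e : OpenPartialHomeomorph M (Coord n)) :
    Measure M :=
  ((volume.restrict e.target).withDensity
    (fun y => ENNReal.ofReal (Real.sqrt (chartGram g e y).det))).map e.symm

/-- The Riemannian volume measure `dV_g`. The measures `chartVolume g e` agree on the overlaps
of the chart domains, so that their supremum is the measure on `M` obtained by gluing them. -/
def vol [MeasurableSpace M] (g : Metric n M) : Measure M :=
  ⨆ e ∈ atlas (Coord n) M, chartVolume g e

/-- The components of `g` at `x` in a fixed basis of the tangent space at `x`. -/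
def gram (g : Metric n M) (x : M) : Matrix (Fin n) (Fin n) ℝ :=
  let b : Fin n → TangentSpace (𝓡 n) x := fun i => EuclideanSpace.single i (1 : ℝ)
  Matrix.of fun i j => g.inner x (b i) (b j)

/-- The norm `|g|_{g₀}` at `x`: the square root of the full contraction
`g₀^{ij} g_{jk} g₀^{kl} g_{li}`, which does not depend on the basis. In a `g₀`-orthonormal basis
with `g = diag(λ₁², …, λₙ²)` it is `√(λ₁⁴ + ⋯ + λₙ⁴)`. -/
def normMetric (g₀ g : Metric n M) (x : M) : ℝ :=
  Real.sqrt (((gram g₀ x)⁻¹ * gram g x * (gram g₀ x)⁻¹ * gram g x).trace)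

/-- The norm `|g⁻¹ - g₀⁻¹|_{g₀}` at `x`: with `K^{ij} = g^{ij} - g₀^{ij}`, the square root of the
full contraction `(g₀)_{ij} K^{jk} (g₀)_{kl} K^{li}`. In a `g₀`-orthonormal basis with
`g = diag(λ₁², …, λₙ²)` it is the square root of `∑ (λᵢ⁻² - 1)²`. -/
def normInvDiff (g₀ g : Metric n M) (x : M) : ℝ :=
  Real.sqrt ((gram g₀ x * ((gram g x)⁻¹ - (gram g₀ x)⁻¹) *
    gram g₀ x * ((gram g x)⁻¹ - (gram g₀ x)⁻¹)).trace)

/-- The Riemannian distance `d_g(x, y)`: the infimum of the `g`-lengths of the `C¹` paths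
from `x` to `y`. -/
def riemDist (g : Metric n M) (x y : M) : ℝ≥0∞ :=
  letI : RiemannianBundle (fun x : M => TangentSpace (𝓡 n) x) := ⟨g.toRiemannianMetric⟩
  Manifold.riemannianEDist (𝓡 n) x y

/-- The vector field `V` is the weak gradient `∇^g f`: in every chart `e`, the function `f` and the
components `g(V, ∂ᵢ)` are locally integrable, and `g(V, ∂ᵢ)` is the distributional partial
derivative of `f` in the direction of the `i`-th coordinate. -/
def IsWeakGradient (g : Metric n M) (f : M → ℝ) (V : (x : M) → TangentSpace (𝓡 n) x) : Prop :=
  ∀ e ∈ atlas (Coord n) M,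
    LocallyIntegrableOn (fun y => f (e.symm y)) e.target ∧
    ∀ i : Fin n,
      LocallyIntegrableOn
        (fun y => g.inner (e.symm y) (V (e.symm y)) (coordVec e i y)) e.target ∧
      ∀ φ : Coord n → ℝ, ContDiff ℝ ∞ φ → HasCompactSupport φ → tsupport φ ⊆ e.target →
        ∫ y, f (e.symm y) * fderiv ℝ φ y (EuclideanSpace.single i (1 : ℝ)) =
          - ∫ y, g.inner (e.symm y) (V (e.symm y)) (coordVec e i y) * φ y

/-- The Hölder quantity `𝓗_{p,g₀}(f) = sup |f(x) - f(y)| / d_{g₀}(x,y)^{(p-n)/p}`, with values in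
`[0, ∞]`; for `p > n` the pairs with `x = y` contribute `0 / 0 = 0`. -/
def holder (p : ℝ) (g₀ : Metric n M) (f : M → ℝ) : ℝ≥0∞ :=
  ⨆ (x : M) (y : M), ENNReal.ofReal |f x - f y| / riemDist g₀ x y ^ ((p - n) / p)

/-- The functions that compete in the definition of `d^D_{p,g,g₀}`: those with
`𝓗_{p,g₀}(f) ≤ D` that are weakly differentiable with `∫ |∇^g f|_g^p dV_g ≤ 1`. -/
def Admissible [MeasurableSpace M] (p D : ℝ) (g g₀ : Metric n M) (f : M → ℝ) : Prop :=
  holder p g₀ f ≤ ENNReal.ofReal D ∧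
  ∃ V : (x : M) → TangentSpace (𝓡 n) x, IsWeakGradient g f V ∧
    ∫⁻ x, ENNReal.ofReal (Real.sqrt (g.inner x (V x) (V x)) ^ p) ∂(vol g) ≤ 1

/-- The modified distance `d^D_{p,g,g₀}(x, y)`. -/
def modDist [MeasurableSpace M] (p D : ℝ) (g g₀ : Metric n M) (x y : M) : ℝ :=
  sSup {r : ℝ | ∃ f : M → ℝ, Admissible p D g g₀ f ∧ r = |f x - f y|}

end

end

end ModifiedDp

/-!
All energies are compared through covectors, since the covector that represents a weak gradient does
not depend on the metric. At a point, diagonalize `g` with respect to `g₀`, with eigenvalues `dᵢ`. For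
a covector with components `bᵢ`, the energy density `(∑ bᵢ² / dᵢ)^(p/2) √(∏ dᵢ)` of `g` differs from
`(∑ bᵢ²)^(p/2)`, that of `g₀`, at most by a factor `A^((p-1)/2) B^((n-1)/2)`, where `A` bounds the
`dᵢ⁻¹` and `B` the `dᵢ`; exchanging the two metrics exchanges `A` and `B` (`nrm_rpow_comparison`).
Let `N = |g⁻¹ - g₀⁻¹|`. Where `N ≤ δ`, both `A` and `B` can be taken close to `1`. Elsewhere
`A = 1 + N` is at most a constant times `N`, and `B = |g|`; the exponents in the hypotheses are those
for which Hölder's inequality bounds the integral of the factor over this set by a power of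
`∫ N^(n(p-1)/2)`, which tends to `0`, times a power of `∫ |g|^(n/2)`, which is bounded
(`eventually_lintegral_weight_le`).

*Lower bound* (`eventually_exists_competitor`). A competitor `f` for `g₀` is the limit, uniformly, in
energy and in the Hölder seminorm, of `C¹` functions: use a partition of unity, mollify in charts, and
control the Hölder seminorm of the error by Morrey's inequality (`approximable_of_isWeakGradient`).
After multiplication by a number slightly less than `1`, such a function `h` satisfies the Hölder
constraint and has `g₀`-energy less than `1`. As its `g₀`-gradient is bounded, the comparison of
energies shows that the `gⱼ`-energy of `h` is at most `1` for large `j`, so `h` competes for `gⱼ`.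

*Upper bound* (`exists_limit_competitor`). Let `fⱼ` be competitors for `gⱼ`. By the Hölder constraint
they converge uniformly, up to constants, along an ultrafilter. By the comparison of energies in the
other direction, with a smaller exponent `q` in place of `p`, the covectors `dfⱼ` are bounded in
`L²(g₀)` (`eventually_lintegral_nrm_rpow_le`, `q = 2`), so they converge weakly, and the limit is the
differential of the limit function. Its `g₀`-energy is at most `1` by duality: by the same estimate
with `q = 1`, its pairing with a bounded field `Φ` is at most the `L^(p/(p-1))` norm of `Φ`
(`energy_le_one_of_dual`). The limit function therefore competes for `g₀`.

Together these give pointwise convergence of the modified distances. The Hölder constraint, which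
involves `g₀` only, makes them equicontinuous, and on the compact space `M × M` the convergence is
uniform. Only `0 < D` matters, so that `1` serves as the threshold.
-/

namespace ModifiedDp

noncomputable section

/-! ### Riemannian inner products and coordinate fields -/

section Pointwise

variable {n : ℕ} {M : Type*} [TopologicalSpace M] [ChartedSpace (Coord n) M]
  [IsManifold (𝓡 n) ∞ M]

/-- The inner product of `g` at `x`, as a bilinear form on the model space `ℝⁿ`, to which every
tangent space unfolds. -/
def ip (g : Metric n M) (x : M) : Coord n →L[ℝ] Coord n →L[ℝ] ℝ := g.inner x

/-- The norm of `g` at `x`, on the model space. -/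
def nrm (g : Metric n M) (x : M) (v : Coord n) : ℝ := Real.sqrt (ip g x v v)

lemma ip_symm (g : Metric n M) (x : M) (v w : Coord n) : ip g x v w = ip g x w v :=
  g.symm x v w

lemma ip_pos (g : Metric n M) (x : M) {v : Coord n} (hv : v ≠ 0) : 0 < ip g x v v :=
  g.pos x v hv

lemma ip_self_nonneg (g : Metric n M) (x : M) (v : Coord n) : 0 ≤ ip g x v v := by
  rcases eq_or_ne v 0 with rfl | hv
  · simp
  · exact (ip_pos g x hv).le

lemma nrm_nonneg (g : Metric n M) (x : M) (v : Coord n) : 0 ≤ nrm g x v := Real.sqrt_nonneg _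

lemma nrm_sq (g : Metric n M) (x : M) (v : Coord n) : nrm g x v ^ 2 = ip g x v v :=
  Real.sq_sqrt (ip_self_nonneg g x v)

lemma abs_ip_le (g : Metric n M) (x : M) (v w : Coord n) :
    |ip g x v w| ≤ nrm g x v * nrm g x w := by
  have h := discrim_le_zero (a := ip g x v v) (b := 2 * ip g x v w) (c := ip g x w w) (fun t => by
    have := ip_self_nonneg g x (t • v + w)
    simp only [map_add, map_smul, add_apply, smul_apply,
      smul_eq_mul, ip_symm g x w v] at this
    nlinarith)
  have h2 : ip g x v w ^ 2 ≤ (nrm g x v * nrm g x w) ^ 2 := by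
    rw [mul_pow, nrm_sq, nrm_sq]
    unfold discrim at h
    nlinarith
  exact abs_le_of_sq_le_sq h2 (mul_nonneg (nrm_nonneg ..) (nrm_nonneg ..))

lemma ip_le (g : Metric n M) (x : M) (v w : Coord n) :
    ip g x v w ≤ nrm g x v * nrm g x w := (le_abs_self _).trans (abs_ip_le g x v w)

lemma nrm_add_le (g : Metric n M) (x : M) (v w : Coord n) :
    nrm g x (v + w) ≤ nrm g x v + nrm g x w := by
  apply Real.sqrt_le_iff.mpr ⟨add_nonneg (nrm_nonneg ..) (nrm_nonneg ..), ?_⟩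
  have := ip_le g x v w
  have h1 := nrm_sq g x v
  have h2 := nrm_sq g x w
  simp only [map_add, add_apply, ip_symm g x w v]
  nlinarith

lemma nrm_smul (g : Metric n M) (x : M) (c : ℝ) (v : Coord n) :
    nrm g x (c • v) = |c| * nrm g x v := by
  simp only [nrm, map_smul, smul_apply, smul_eq_mul]
  rw [← mul_assoc, Real.sqrt_mul (mul_self_nonneg c), Real.sqrt_mul_self_eq_abs]

lemma nrm_zero (g : Metric n M) (x : M) : nrm g x 0 = 0 := by simp [nrm]

lemma nrm_sum_le {ι : Type*} (s : Finset ι) (g : Metric n M) (x : M) (v : ι → Coord n) :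
    nrm g x (∑ i ∈ s, v i) ≤ ∑ i ∈ s, nrm g x (v i) := by
  classical
  induction s using Finset.induction_on with
  | empty => simp [nrm_zero]
  | insert a s ha ih =>
    rw [Finset.sum_insert ha, Finset.sum_insert ha]
    exact (nrm_add_le ..).trans (by gcongr)

/-- Riesz representation in a tangent space. -/
lemma exists_ip_eq (g : Metric n M) (x : M) (θ : Coord n →L[ℝ] ℝ) :
    ∃ v : Coord n, ∀ w, ip g x v w = θ w := by
  let T : Coord n →ₗ[ℝ] (Coord n →L[ℝ] ℝ) := (ip g x).toLinearMap
  have hinj : Function.Injective T := by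
    rw [injective_iff_map_eq_zero]
    intro v hv
    by_contra h
    have h1 := ip_pos g x h
    have h2 : ip g x v v = 0 := by
      have : ip g x v = 0 := hv
      rw [this]; rfl
    linarith
  have hfin : Module.finrank ℝ (Coord n) = Module.finrank ℝ (Coord n →L[ℝ] ℝ) := by
    rw [← (LinearMap.toContinuousLinearMap (𝕜 := ℝ) (E := Coord n) (F' := ℝ)).finrank_eq]
    exact (Subspace.dual_finrank_eq).symm
  obtain ⟨v, hv⟩ :=
    (LinearMap.injective_iff_surjective_of_finrank_eq_finrank hfin).1 hinj θ
  exact ⟨v, fun w => congrArg (fun f : Coord n →L[ℝ] ℝ => f w) hv⟩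

/-- The vector that represents the covector `θ` at `x` with respect to `g`. -/
def sharp (g : Metric n M) (x : M) (θ : Coord n →L[ℝ] ℝ) : Coord n :=
  (exists_ip_eq g x θ).choose

@[simp] lemma ip_sharp (g : Metric n M) (x : M) (θ : Coord n →L[ℝ] ℝ) (w : Coord n) :
    ip g x (sharp g x θ) w = θ w := (exists_ip_eq g x θ).choose_spec w

lemma eq_of_ip_eq (g : Metric n M) (x : M) {v v' : Coord n} (h : ∀ w, ip g x v w = ip g x v' w) :
    v = v' := by
  by_contra hne
  have h1 := ip_pos g x (sub_ne_zero.2 hne)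
  simp only [map_sub, sub_apply, h] at h1
  simp at h1

end Pointwise

section Fields

variable {n : ℕ} {M : Type*} [TopologicalSpace M] [ChartedSpace (Coord n) M]

/-- The differential of the chart `e` at `x`, as a map of the model space, to which the tangent
spaces unfold. -/
def chartD (e : OpenPartialHomeomorph M (Coord n)) (x : M) : Coord n →L[ℝ] Coord n :=
  mfderiv (𝓡 n) (𝓡 n) e x

/-- The differential of the inverse of the chart `e` at `y`. -/
def symmD (e : OpenPartialHomeomorph M (Coord n)) (y : Coord n) : Coord n →L[ℝ] Coord n :=
  mfderiv (𝓡 n) (𝓡 n) e.symm y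

/-- The `i`-th coordinate vector field of the chart `e`, as a field on `e.source`. -/
def coordField (e : OpenPartialHomeomorph M (Coord n)) (i : Fin n) (x : M) : Coord n :=
  symmD e (e x) (EuclideanSpace.single i (1 : ℝ))

lemma coordVec_eq (e : OpenPartialHomeomorph M (Coord n)) (i : Fin n) {y : Coord n}
    (hy : y ∈ e.target) : (coordVec e i y : Coord n) = coordField e i (e.symm y) := by
  unfold coordField
  rw [e.right_inv hy]
  rfl

variable [IsManifold (𝓡 n) ∞ M]

lemma chartD_symmD {e : OpenPartialHomeomorph M (Coord n)} (he : e ∈ atlas (Coord n) M) {y : Coord n}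
    (hy : y ∈ e.target) (v : Coord n) : chartD e (e.symm y) (symmD e y v) = v := by
  have : IsManifold (𝓡 n) 1 M := .of_le (n := ∞) (by simp)
  have h := (mdifferentiable_of_mem_atlas (I := 𝓡 n) he).comp_symm_deriv hy
  exact congrArg (fun f : Coord n →L[ℝ] Coord n => f v) h

lemma symmD_chartD {e : OpenPartialHomeomorph M (Coord n)} (he : e ∈ atlas (Coord n) M) {x : M}
    (hx : x ∈ e.source) (v : Coord n) : symmD e (e x) (chartD e x v) = v := by
  have : IsManifold (𝓡 n) 1 M := .of_le (n := ∞) (by simp)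
  have h := (mdifferentiable_of_mem_atlas (I := 𝓡 n) he).symm_comp_deriv hx
  exact congrArg (fun f : Coord n →L[ℝ] Coord n => f v) h

lemma eq_sum_coordField {e : OpenPartialHomeomorph M (Coord n)} (he : e ∈ atlas (Coord n) M) {x : M}
    (hx : x ∈ e.source) (v : Coord n) : v = ∑ i, (chartD e x v) i • coordField e i x := by
  conv_lhs => rw [← symmD_chartD he hx v]
  have h : chartD e x v = ∑ i, (chartD e x v) i • EuclideanSpace.single i (1 : ℝ) := by
    ext j
    simp [Finset.sum_apply, Pi.single_apply]
  conv_lhs => rw [h]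
  simp [map_sum, coordField]

lemma continuousOn_coordField {e : OpenPartialHomeomorph M (Coord n)} (he : e ∈ atlas (Coord n) M)
    (i : Fin n) :
    ContinuousOn (fun x => (⟨x, coordField e i x⟩ : TotalSpace (Coord n) (fun x : M => TangentSpace (𝓡 n) x)))
      e.source := by
  have : IsManifold (𝓡 n) 1 M := .of_le (n := ∞) (by simp)
  have h1 : ContMDiffOn (𝓡 n) (𝓡 n) 1 e.symm e.target :=
    contMDiffOn_symm_of_mem_maximalAtlas (IsManifold.subset_maximalAtlas he)
  have h2 := h1.continuousOn_tangentMapWithin le_rfl e.open_target.uniqueMDiffOn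
  have h3 : Continuous (fun y : Coord n => (⟨y, (EuclideanSpace.single i (1 : ℝ) : Coord n)⟩ :
      TangentBundle (𝓡 n) (Coord n))) :=
    (tangentBundleModelSpaceHomeomorph (𝓡 n)).symm.continuous.comp
      (continuous_id.prodMk continuous_const)
  have h4 : ContinuousOn (fun x : M => tangentMapWithin (𝓡 n) (𝓡 n) e.symm e.target
      ⟨e x, (EuclideanSpace.single i (1 : ℝ) : Coord n)⟩) e.source := by
    refine h2.comp (h3.comp_continuousOn e.continuousOn) ?_
    intro x hx
    exact e.map_source hx
  refine h4.congr ?_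
  intro x hx
  have hy := e.map_source hx
  simp only [tangentMapWithin, mfderivWithin_of_isOpen e.open_target hy]
  unfold coordField symmD
  congr 1
  · exact (e.left_inv hx).symm

lemma continuousOn_ip (g : Metric n M) {X Y : M → Coord n} {s : Set M}
    (hX : ContinuousOn (fun x => (⟨x, X x⟩ : TotalSpace (Coord n) (fun x : M => TangentSpace (𝓡 n) x))) s)
    (hY : ContinuousOn (fun x => (⟨x, Y x⟩ : TotalSpace (Coord n) (fun x : M => TangentSpace (𝓡 n) x))) s) :
    ContinuousOn (fun x => ip g x (X x) (Y x)) s := by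
  intro x hx
  let _ : RiemannianBundle (fun x : M => TangentSpace (𝓡 n) x) := ⟨g.toRiemannianMetric⟩
  exact ContinuousWithinAt.inner_bundle (F := Coord n) (E := fun x : M => TangentSpace (𝓡 n) x)
    (b := fun x => x) (v := X) (w := Y) (hX x hx) (hY x hx)

lemma continuousOn_ip_coordField (g : Metric n M) {e e' : OpenPartialHomeomorph M (Coord n)}
    (he : e ∈ atlas (Coord n) M) (he' : e' ∈ atlas (Coord n) M) (i j : Fin n) :
    ContinuousOn (fun x => ip g x (coordField e i x) (coordField e' j x)) (e.source ∩ e'.source) :=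
  continuousOn_ip g ((continuousOn_coordField he i).mono Set.inter_subset_left)
    ((continuousOn_coordField he' j).mono Set.inter_subset_right)

/-- The Gram matrix of `g` in the coordinate fields of the chart `e`, as a function on `M`. -/
def gmat (g : Metric n M) (e : OpenPartialHomeomorph M (Coord n)) (x : M) :
    Matrix (Fin n) (Fin n) ℝ :=
  Matrix.of fun i j => ip g x (coordField e i x) (coordField e j x)

lemma chartGram_eq (g : Metric n M) (e : OpenPartialHomeomorph M (Coord n)) {y : Coord n}
    (hy : y ∈ e.target) : chartGram g e y = gmat g e (e.symm y) := by
  ext i j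
  change ip g (e.symm y) (coordVec e i y) (coordVec e j y) = ip g _ _ _
  rw [← coordVec_eq e i hy, ← coordVec_eq e j hy]

lemma continuousOn_gmat (g : Metric n M) {e : OpenPartialHomeomorph M (Coord n)}
    (he : e ∈ atlas (Coord n) M) : ContinuousOn (gmat g e) e.source := by
  refine continuousOn_pi.2 fun i => continuousOn_pi.2 fun j => ?_
  have := continuousOn_ip_coordField g he he i j
  rwa [Set.inter_self] at this

lemma gram_congr (g : Metric n M) (x : M) (J : Fin n → Coord n) :
    Matrix.of (fun i j => ip g x (J i) (J j)) =
      (Matrix.of fun k i => J i k).transpose * gram g x * (Matrix.of fun k i => J i k) := by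
  have hJ : ∀ i, J i = ∑ k, (J i) k • (EuclideanSpace.single k (1 : ℝ) : Coord n) := by
    intro i; ext j; simp [Finset.sum_apply, Pi.single_apply]
  ext i j
  simp only [Matrix.of_apply, Matrix.mul_apply, Matrix.transpose_apply]
  conv_lhs => rw [hJ i, hJ j]
  simp only [map_sum, map_smul, sum_apply, smul_apply,
    smul_eq_mul, Finset.mul_sum, Finset.sum_mul]
  refine Finset.sum_congr rfl fun k _ => ?_
  refine Finset.sum_congr rfl fun l _ => ?_
  change _ = J i l * ip g x _ _ * J j k
  dsimp only
  ring

end Fields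

/-! ### The Riemannian volume in charts -/

section Volume

variable {n : ℕ} {M : Type*} [TopologicalSpace M] [ChartedSpace (Coord n) M]
  [IsManifold (𝓡 n) ∞ M]

lemma gram_posDef (g : Metric n M) (x : M) : (gram g x).PosDef := by
  refine Matrix.PosDef.of_dotProduct_mulVec_pos ?_ ?_
  · ext i j
    exact ip_symm g x _ _
  · intro v hv
    have h : ip g x (WithLp.toLp 2 v) (WithLp.toLp 2 v) = star v ⬝ᵥ (gram g x).mulVec v := by
      have hJ : (WithLp.toLp 2 v : Coord n) =
          ∑ k, v k • (EuclideanSpace.single k (1 : ℝ) : Coord n) := by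
        ext j; simp [Finset.sum_apply, Pi.single_apply]
      rw [hJ]
      simp only [map_sum, map_smul, sum_apply, smul_apply, smul_eq_mul, dotProduct,
        Matrix.mulVec, Finset.mul_sum]
      rw [Finset.sum_comm]
      refine Finset.sum_congr rfl fun k _ => Finset.sum_congr rfl fun l _ => ?_
      change _ = v k * (ip g x _ _ * v l)
      ring
    rw [← h]
    apply ip_pos
    intro h0
    apply hv
    ext i
    exact congrArg (fun w : Coord n => w i) h0

lemma det_gram_pos (g : Metric n M) (x : M) : 0 < (gram g x).det := (gram_posDef g x).det_pos

lemma det_of_apply_single (A : Coord n →L[ℝ] Coord n) :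
    (Matrix.of fun k i => A (EuclideanSpace.single i (1 : ℝ)) k).det = A.det := by
  rw [ContinuousLinearMap.det,
    ← LinearMap.det_toMatrix (EuclideanSpace.basisFun (Fin n) ℝ).toBasis]
  congr 1

lemma det_gram_congr (g : Metric n M) (x : M) (A : Coord n →L[ℝ] Coord n) :
    (Matrix.of (fun i j => ip g x (A (EuclideanSpace.single i (1 : ℝ)))
      (A (EuclideanSpace.single j (1 : ℝ))))).det = A.det ^ 2 * (gram g x).det := by
  rw [gram_congr g x (fun i => A (EuclideanSpace.single i (1 : ℝ))), Matrix.det_mul,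
    Matrix.det_mul, Matrix.det_transpose, det_of_apply_single]
  ring

lemma det_chartGram (g : Metric n M) (e : OpenPartialHomeomorph M (Coord n)) (y : Coord n) :
    (chartGram g e y).det = (symmD e y).det ^ 2 * (gram g (e.symm y)).det :=
  det_gram_congr g (e.symm y) (symmD e y)

/-- The density of the Riemannian volume in the chart `e`. -/
def dens (g : Metric n M) (e : OpenPartialHomeomorph M (Coord n)) (y : Coord n) : ℝ :=
  Real.sqrt (chartGram g e y).det

lemma dens_eq (g : Metric n M) (e : OpenPartialHomeomorph M (Coord n)) (y : Coord n) :
    dens g e y = |(symmD e y).det| * Real.sqrt (gram g (e.symm y)).det := by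
  rw [dens, det_chartGram, Real.sqrt_mul (sq_nonneg _), Real.sqrt_sq_eq_abs]

lemma symmD_det_ne_zero {e : OpenPartialHomeomorph M (Coord n)} (he : e ∈ atlas (Coord n) M)
    {y : Coord n} (hy : y ∈ e.target) : (symmD e y).det ≠ 0 := by
  have h : (chartD e (e.symm y)).comp (symmD e y) = ContinuousLinearMap.id ℝ _ := by
    ext v : 1
    exact chartD_symmD he hy v
  intro h0
  have h1 := congrArg ContinuousLinearMap.det h
  have h2 : ((chartD e (e.symm y)).comp (symmD e y)).det =
      (chartD e (e.symm y)).det * (symmD e y).det := LinearMap.det_comp _ _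
  rw [h2, h0, mul_zero] at h1
  have : (ContinuousLinearMap.id ℝ (Coord n)).det = 1 := LinearMap.det_id
  rw [this] at h1
  exact zero_ne_one h1

lemma dens_pos (g : Metric n M) {e : OpenPartialHomeomorph M (Coord n)} (he : e ∈ atlas (Coord n) M)
    {y : Coord n} (hy : y ∈ e.target) : 0 < dens g e y := by
  rw [dens_eq]
  exact mul_pos (abs_pos.2 (symmD_det_ne_zero he hy)) (Real.sqrt_pos.2 (det_gram_pos _ _))

lemma continuousOn_chartGram (g : Metric n M) {e : OpenPartialHomeomorph M (Coord n)}
    (he : e ∈ atlas (Coord n) M) : ContinuousOn (chartGram g e) e.target :=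
  ((continuousOn_gmat g he).comp e.continuousOn_symm (fun _ hy => e.map_target hy)).congr
    fun _ hy => chartGram_eq g e hy

lemma continuousOn_dens (g : Metric n M) {e : OpenPartialHomeomorph M (Coord n)}
    (he : e ∈ atlas (Coord n) M) : ContinuousOn (dens g e) e.target :=
  Real.continuous_sqrt.comp_continuousOn
    ((continuous_id.matrix_det).comp_continuousOn (continuousOn_chartGram g he))

variable [MeasurableSpace M] [BorelSpace M]

lemma chartVolume_def (g : Metric n M) (e : OpenPartialHomeomorph M (Coord n)) :
    chartVolume g e = ((volume.restrict e.target).withDensity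
      (fun y => ENNReal.ofReal (dens g e y))).map e.symm := rfl

lemma aemeasurable_dens (g : Metric n M) {e : OpenPartialHomeomorph M (Coord n)}
    (he : e ∈ atlas (Coord n) M) :
    AEMeasurable (fun y => ENNReal.ofReal (dens g e y)) (volume.restrict e.target) :=
  ((continuousOn_dens g he).aemeasurable e.open_target.measurableSet).ennreal_ofReal

lemma aemeasurable_symm (e : OpenPartialHomeomorph M (Coord n)) :
    AEMeasurable e.symm (volume.restrict e.target) :=
  e.continuousOn_symm.aemeasurable e.open_target.measurableSet

lemma aemeasurable_symm' (g : Metric n M) (e : OpenPartialHomeomorph M (Coord n)) :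
    AEMeasurable e.symm ((volume.restrict e.target).withDensity
      (fun y => ENNReal.ofReal (dens g e y))) :=
  (aemeasurable_symm e).mono_ac (withDensity_absolutelyContinuous _ _)

lemma lintegral_chartVolume (g : Metric n M) {e : OpenPartialHomeomorph M (Coord n)}
    (he : e ∈ atlas (Coord n) M) {F : M → ℝ≥0∞} (hF : AEMeasurable F (chartVolume g e)) :
    ∫⁻ x, F x ∂(chartVolume g e) =
      ∫⁻ y in e.target, ENNReal.ofReal (dens g e y) * F (e.symm y) := by
  rw [chartVolume_def] at hF ⊢
  rw [lintegral_map' hF (aemeasurable_symm' g e)]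
  exact lintegral_withDensity_eq_lintegral_mul₀' (aemeasurable_dens g he)
      (hF.comp_aemeasurable (aemeasurable_symm' g e))

lemma measurableSet_image_chart (e : OpenPartialHomeomorph M (Coord n)) {A : Set M}
    (hA : MeasurableSet A) : MeasurableSet (e.target ∩ e.symm ⁻¹' A) := by
  have h : Measurable (e.target.restrict e.symm) :=
    (continuousOn_iff_continuous_restrict.1 e.continuousOn_symm).measurable
  have h2 := MeasurableSet.subtype_image e.open_target.measurableSet (h hA)
  convert h2 using 1
  ext y
  simp [Set.restrict, and_comm]

lemma chartVolume_apply (g : Metric n M) {e : OpenPartialHomeomorph M (Coord n)} {A : Set M}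
    (hA : MeasurableSet A) :
    chartVolume g e A = ∫⁻ y in e.target ∩ e.symm ⁻¹' A, ENNReal.ofReal (dens g e y) := by
  rw [chartVolume_def, Measure.map_apply_of_aemeasurable (aemeasurable_symm' g e) hA]
  rw [withDensity_apply']
  have : (volume.restrict e.target).restrict (e.symm ⁻¹' A) =
      (volume : Measure (Coord n)).restrict (e.target ∩ e.symm ⁻¹' A) := by
    rw [Measure.restrict_restrict' e.open_target.measurableSet, Set.inter_comm]
  rw [this]

lemma chartVolume_inter_source (g : Metric n M) {e : OpenPartialHomeomorph M (Coord n)} {A : Set M}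
    (hA : MeasurableSet A) : chartVolume g e (A ∩ e.source) = chartVolume g e A := by
  rw [chartVolume_apply g hA, chartVolume_apply g (hA.inter e.open_source.measurableSet)]
  congr 2
  ext y
  simp only [Set.mem_inter_iff, Set.mem_preimage]
  exact ⟨fun h => ⟨h.1, h.2.1⟩, fun h => ⟨h.1, h.2, e.map_target h.1⟩⟩

lemma hasFDerivAt_transition {e e' : OpenPartialHomeomorph M (Coord n)}
    (he : e ∈ atlas (Coord n) M) (he' : e' ∈ atlas (Coord n) M) {y : Coord n}
    (hy : y ∈ e.target) (hy' : e.symm y ∈ e'.source) :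
    HasFDerivAt (fun z => e' (e.symm z)) ((chartD e' (e.symm y)).comp (symmD e y)) y := by
  have : IsManifold (𝓡 n) 1 M := .of_le (n := ∞) (by simp)
  have h1 := ((mdifferentiable_of_mem_atlas (I := 𝓡 n) he).mdifferentiableAt_symm hy).hasMFDerivAt
  have h2 := ((mdifferentiable_of_mem_atlas (I := 𝓡 n) he').mdifferentiableAt hy').hasMFDerivAt
  exact (h2.comp y h1).hasFDerivAt

/-- The densities in two charts differ by the Jacobian of the transition map. -/
lemma dens_transition (g : Metric n M) {e e' : OpenPartialHomeomorph M (Coord n)}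
    (he' : e' ∈ atlas (Coord n) M) {y : Coord n}
    (hy' : e.symm y ∈ e'.source) :
    dens g e y = |((chartD e' (e.symm y)).comp (symmD e y)).det| * dens g e' (e' (e.symm y)) := by
  rw [dens_eq, dens_eq, e'.left_inv hy', ← mul_assoc, ← abs_mul]
  congr 2
  have h : (symmD e' (e' (e.symm y))).comp ((chartD e' (e.symm y)).comp (symmD e y)) =
      symmD e y := by
    ext v : 1
    exact symmD_chartD he' hy' _
  conv_lhs => rw [← h]
  rw [mul_comm]
  exact LinearMap.det_comp _ _

/-- The chart volumes agree on overlaps: this is the change of variables formula. -/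
lemma chartVolume_congr (g : Metric n M) {e e' : OpenPartialHomeomorph M (Coord n)}
    (he : e ∈ atlas (Coord n) M) (he' : e' ∈ atlas (Coord n) M) {A : Set M}
    (hA : MeasurableSet A) (hAe : A ⊆ e.source) (hAe' : A ⊆ e'.source) :
    chartVolume g e A = chartVolume g e' A := by
  rw [chartVolume_apply g hA, chartVolume_apply g hA]
  have himg : e'.target ∩ e'.symm ⁻¹' A = (fun z => e' (e.symm z)) '' (e.target ∩ e.symm ⁻¹' A) := by
    ext z
    constructor
    · rintro ⟨hz, hzA⟩
      refine ⟨e (e'.symm z), ⟨e.map_source (hAe hzA), ?_⟩, ?_⟩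
      · simpa [e.left_inv (hAe hzA)] using hzA
      · simp [e.left_inv (hAe hzA), e'.right_inv hz]
    · rintro ⟨y, ⟨hy, hyA⟩, rfl⟩
      refine ⟨e'.map_source (hAe' hyA), ?_⟩
      simpa [e'.left_inv (hAe' hyA)] using hyA
  rw [himg, lintegral_image_eq_lintegral_abs_det_fderiv_mul volume
    (measurableSet_image_chart e hA)
    (fun y hy => (hasFDerivAt_transition he he' hy.1 (hAe' hy.2)).hasFDerivWithinAt)]
  · refine setLIntegral_congr_fun (measurableSet_image_chart e hA) fun y hy => ?_
    rw [dens_transition g he' (hAe' hy.2), ENNReal.ofReal_mul (abs_nonneg _)]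
  · intro y hy z hz hyz
    have h := e'.injOn (hAe' hy.2) (hAe' hz.2) hyz
    exact e.symm.injOn hy.1 hz.1 h

section Cover

variable [CompactSpace M]

variable (n M) in
/-- Countably many chart domains cover `M`. -/
lemma exists_seq_cover [Nonempty M] : ∃ c : ℕ → M, ⋃ k, (chartAt (Coord n) (c k)).source = Set.univ := by
  obtain ⟨s, hs, hsU⟩ := countable_cover_nhds_of_sigmaCompact
    fun x : M => chart_source_mem_nhds (Coord n) x
  have hne : s.Nonempty := by
    by_contra h
    rw [Set.not_nonempty_iff_eq_empty] at h
    subst h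
    simp only [Set.mem_empty_iff_false, Set.iUnion_of_empty, Set.iUnion_empty] at hsU
    exact Set.empty_ne_univ hsU
  obtain ⟨c, rfl⟩ := hs.exists_eq_range hne
  exact ⟨c, by simpa using hsU⟩

variable [Nonempty M]

/-- The volume measure, restricted to a chart domain, is the chart volume. -/
lemma vol_apply (g : Metric n M) {e : OpenPartialHomeomorph M (Coord n)}
    (he : e ∈ atlas (Coord n) M) {A : Set M} (hA : MeasurableSet A) (hAe : A ⊆ e.source) :
    vol g A = chartVolume g e A := by
  obtain ⟨c, hc⟩ := exists_seq_cover n M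
  set U : ℕ → Set M := fun k => (chartAt (Coord n) (c k)).source
  have hUm : ∀ k, MeasurableSet (disjointed U k) := fun k =>
    .disjointed (fun k => (chartAt (Coord n) (c k)).open_source.measurableSet) k
  have hsub : ∀ k, disjointed U k ⊆ (chartAt (Coord n) (c k)).source := disjointed_subset U
  let ν : Measure M := Measure.sum fun k =>
    (chartVolume g (chartAt (Coord n) (c k))).restrict (disjointed U k)
  -- every chart volume agrees with `ν` on the domain of the chart
  have key : ∀ e' ∈ atlas (Coord n) M, ∀ B, MeasurableSet B → B ⊆ e'.source →
      chartVolume g e' B = ν B := by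
    intro e' he' B hB hBe'
    have h1 : B = ⋃ k, B ∩ disjointed U k := by
      rw [← Set.inter_iUnion, iUnion_disjointed, hc, Set.inter_univ]
    conv_lhs => rw [h1]
    rw [measure_iUnion, Measure.sum_apply _ hB]
    · refine tsum_congr fun k => ?_
      rw [Measure.restrict_apply hB]
      exact chartVolume_congr g he' (chart_mem_atlas _ _) (hB.inter (hUm k))
        (Set.inter_subset_left.trans hBe') (Set.inter_subset_right.trans (hsub k))
    · intro i j hij
      exact (disjoint_disjointed U hij).mono Set.inter_subset_right Set.inter_subset_right
    · exact fun k => hB.inter (hUm k)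
  apply le_antisymm
  · have hle : vol g ≤ ν := by
      refine iSup₂_le fun e' he' => Measure.le_iff.2 fun B hB => ?_
      rw [← chartVolume_inter_source g hB, key e' he' _ (hB.inter e'.open_source.measurableSet)
        Set.inter_subset_right]
      exact measure_mono Set.inter_subset_left
    rw [key e he A hA hAe]
    exact hle A
  · exact (le_iSup₂ (f := fun e' (_ : e' ∈ atlas (Coord n) M) => chartVolume g e') e he) A

lemma vol_restrict (g : Metric n M) {e : OpenPartialHomeomorph M (Coord n)}
    (he : e ∈ atlas (Coord n) M) : (vol g).restrict e.source = chartVolume g e := by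
  ext A hA
  rw [Measure.restrict_apply hA, vol_apply g he (hA.inter e.open_source.measurableSet)
    Set.inter_subset_right, chartVolume_inter_source g hA]

lemma setLIntegral_vol (g : Metric n M) {e : OpenPartialHomeomorph M (Coord n)}
    (he : e ∈ atlas (Coord n) M) {F : M → ℝ≥0∞} (hF : AEMeasurable F (vol g)) :
    ∫⁻ x in e.source, F x ∂(vol g) =
      ∫⁻ y in e.target, ENNReal.ofReal (dens g e y) * F (e.symm y) := by
  rw [vol_restrict g he]
  exact lintegral_chartVolume g he (vol_restrict g he ▸ hF.restrict)

lemma setIntegral_vol (g : Metric n M) {e : OpenPartialHomeomorph M (Coord n)}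
    (he : e ∈ atlas (Coord n) M) {F : M → ℝ} (hF : AEStronglyMeasurable F (vol g)) :
    ∫ x in e.source, F x ∂(vol g) = ∫ y in e.target, dens g e y * F (e.symm y) := by
  have hF' : AEStronglyMeasurable F (chartVolume g e) := vol_restrict g he ▸ hF.restrict
  rw [vol_restrict g he]
  rw [chartVolume_def] at hF' ⊢
  rw [integral_map (aemeasurable_symm' g e) hF']
  have h0 : AEMeasurable (fun y => (dens g e y).toNNReal) (volume.restrict e.target) :=
    ((continuousOn_dens g he).aemeasurable e.open_target.measurableSet).real_toNNReal
  change ∫ y, F (e.symm y) ∂((volume.restrict e.target).withDensity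
    (fun y => ((dens g e y).toNNReal : ℝ≥0∞))) = _
  rw [integral_withDensity_eq_integral_smul₀ h0]
  refine integral_congr_ae (Eventually.of_forall fun y => ?_)
  simp only [NNReal.smul_def, smul_eq_mul]
  rw [Real.coe_toNNReal (dens g e y) (Real.sqrt_nonneg _)]

lemma ac_chart (g : Metric n M) {e : OpenPartialHomeomorph M (Coord n)}
    (he : e ∈ atlas (Coord n) M) :
    (volume.restrict e.target : Measure (Coord n)) ≪ (volume.restrict e.target).withDensity
      (fun y => ENNReal.ofReal (dens g e y)) := by
  refine withDensity_absolutelyContinuous' (aemeasurable_dens g he) ?_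
  filter_upwards [ae_restrict_mem e.open_target.measurableSet] with y hy
  exact (ENNReal.ofReal_pos.2 (dens_pos g he hy)).ne'

lemma aestronglyMeasurable_comp_symm (g : Metric n M) {e : OpenPartialHomeomorph M (Coord n)}
    (he : e ∈ atlas (Coord n) M) {F : M → ℝ} (hF : AEStronglyMeasurable F (vol g)) :
    AEStronglyMeasurable (fun y => F (e.symm y)) (volume.restrict e.target) := by
  have hF' : AEStronglyMeasurable F (chartVolume g e) := vol_restrict g he ▸ hF.restrict
  exact (hF'.comp_aemeasurable (aemeasurable_symm' g e)).mono_ac (ac_chart g he)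

lemma aemeasurable_of_comp_symm_restrict (g : Metric n M) {e : OpenPartialHomeomorph M (Coord n)}
    (he : e ∈ atlas (Coord n) M) {F : M → ℝ}
    (hF : AEMeasurable (fun y => F (e.symm y)) (volume.restrict e.target)) :
    AEMeasurable F ((vol g).restrict e.source) := by
  have hem : AEMeasurable e ((vol g).restrict e.source) :=
    e.continuousOn.aemeasurable e.open_source.measurableSet
  have hac : ((vol g).restrict e.source).map e ≪ volume.restrict e.target := by
    refine Measure.AbsolutelyContinuous.mk fun s hs h0 => ?_
    rw [Measure.map_apply_of_aemeasurable hem hs, vol_restrict g he, chartVolume_def]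
    have h1 : ((volume.restrict e.target).withDensity
        (fun y => ENNReal.ofReal (dens g e y))) s = 0 := withDensity_absolutelyContinuous _ _ h0
    have h2 : AEMeasurable e (((volume.restrict e.target).withDensity
        (fun y => ENNReal.ofReal (dens g e y))).map e.symm) := by
      rw [← chartVolume_def, ← vol_restrict g he]; exact hem
    rw [← Measure.map_apply_of_aemeasurable h2 hs,
      AEMeasurable.map_map_of_aemeasurable h2 (aemeasurable_symm' g e)]
    rw [Measure.map_congr (g := id), Measure.map_id, h1]
    refine (withDensity_absolutelyContinuous _ _ : _ ≪ volume.restrict e.target) ?_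
    filter_upwards [ae_restrict_mem e.open_target.measurableSet] with y hy
    exact e.right_inv hy
  have h := (hF.mono_ac hac).comp_aemeasurable hem
  refine h.congr ?_
  filter_upwards [ae_restrict_mem e.open_source.measurableSet] with x hx
  simp [e.left_inv hx]

lemma aemeasurable_of_charts (g : Metric n M) {F : M → ℝ}
    (hF : ∀ e ∈ atlas (Coord n) M, AEMeasurable F ((vol g).restrict e.source)) :
    AEMeasurable F (vol g) := by
  obtain ⟨c, hc⟩ := exists_seq_cover n M
  rw [← Measure.restrict_univ (μ := vol g), ← hc]
  exact (aemeasurable_iUnion_iff).2 fun k => hF _ (chart_mem_atlas _ _)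

lemma isFiniteMeasure_vol (g : Metric n M) : IsFiniteMeasure (vol g) := by
  refine ⟨isCompact_univ.measure_lt_top_of_nhdsWithin fun x _ => ?_⟩
  rw [nhdsWithin_univ]
  set e := chartAt (Coord n) x
  have he : e ∈ atlas (Coord n) M := chart_mem_atlas _ _
  have hx : x ∈ e.source := mem_chart_source _ x
  obtain ⟨K, hK, hKx, hKt⟩ := exists_compact_subset e.open_target (e.map_source hx)
  have hKm : MeasurableSet K := hK.isClosed.measurableSet
  have hset : (e.source ∩ e ⁻¹' interior K) ∈ 𝓝 x :=
    (e.isOpen_inter_preimage isOpen_interior).mem_nhds ⟨hx, hKx⟩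
  refine ⟨_, hset, ?_⟩
  rw [vol_apply g he (e.isOpen_inter_preimage isOpen_interior).measurableSet
    Set.inter_subset_left, chartVolume_apply g
    (e.isOpen_inter_preimage isOpen_interior).measurableSet]
  have hsub : e.target ∩ e.symm ⁻¹' (e.source ∩ e ⁻¹' interior K) ⊆ K := by
    rintro y ⟨hy, -, hy2⟩
    simp only [Set.mem_preimage, e.right_inv hy] at hy2
    exact interior_subset hy2
  refine (lintegral_mono_set hsub).trans_lt ?_
  have hcont := (continuousOn_dens g he).mono hKt
  exact (hcont.integrableOn_compact hK).lintegral_lt_top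

end Cover

end Volume

/-! ### Eigenvalues of one metric with respect to another -/

section Diagonalization

open Matrix

lemma posDef_exists_diag {n : ℕ} {A : Matrix (Fin n) (Fin n) ℝ} (hA : A.PosDef) :
    ∃ (U : Matrix (Fin n) (Fin n) ℝ) (d : Fin n → ℝ), Uᵀ * U = 1 ∧ Uᵀ * A * U = diagonal d ∧
      ∀ i, 0 < d i := by
  refine ⟨hA.isHermitian.eigenvectorUnitary, hA.isHermitian.eigenvalues, ?_, ?_,
    hA.eigenvalues_pos⟩
  · exact Unitary.coe_star_mul_self hA.isHermitian.eigenvectorUnitary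
  · have h := hA.isHermitian.conjStarAlgAut_star_eigenvectorUnitary
    rw [Unitary.conjStarAlgAut_apply] at h
    simp only [Unitary.coe_star, star_star] at h
    exact h

/-- Simultaneous diagonalization of two positive definite symmetric matrices. -/
lemma exists_simultaneous_diag {n : ℕ} {A B : Matrix (Fin n) (Fin n) ℝ} (hA : A.PosDef)
    (hB : B.PosDef) :
    ∃ (Q : Matrix (Fin n) (Fin n) ℝ) (d : Fin n → ℝ), Qᵀ * A * Q = 1 ∧ Qᵀ * B * Q = diagonal d ∧
      ∀ i, 0 < d i := by
  obtain ⟨U, d, hU, hUA, hd⟩ := posDef_exists_diag hA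
  set T : Matrix (Fin n) (Fin n) ℝ := diagonal fun i => (Real.sqrt (d i))⁻¹ with hT
  have hTt : Tᵀ = T := diagonal_transpose _
  have hP : (U * T)ᵀ * A * (U * T) = 1 := by
    rw [transpose_mul, hTt]
    calc T * Uᵀ * A * (U * T) = T * (Uᵀ * A * U) * T := by simp only [Matrix.mul_assoc]
      _ = 1 := by
        rw [hUA, hT, diagonal_mul_diagonal, diagonal_mul_diagonal, ← diagonal_one]
        congr 1
        ext i
        have h1 := Real.sqrt_pos.2 (hd i)
        have h2 := Real.mul_self_sqrt (hd i).le
        field_simp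
        nlinarith
  have hinj : Function.Injective (U * T).mulVec := by
    rw [Matrix.mulVec_injective_iff_isUnit]
    rw [Matrix.isUnit_iff_isUnit_det]
    have h := congrArg Matrix.det hP
    rw [det_mul, det_one] at h
    exact IsUnit.of_mul_eq_one_right _ h
  have hPB := hB.conjTranspose_mul_mul_same hinj
  rw [conjTranspose_eq_transpose_of_trivial] at hPB
  obtain ⟨V, m, hV, hVm, hm⟩ := posDef_exists_diag hPB
  refine ⟨U * T * V, m, ?_, ?_, hm⟩
  · have : (U * T * V)ᵀ * A * (U * T * V) = Vᵀ * ((U * T)ᵀ * A * (U * T)) * V := by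
      simp only [transpose_mul, Matrix.mul_assoc]
    rw [this, hP, Matrix.mul_one, hV]
  · rw [← hVm]
    simp only [transpose_mul, Matrix.mul_assoc]

section Traces

variable {n : ℕ} {A B Q : Matrix (Fin n) (Fin n) ℝ} {d : Fin n → ℝ}

lemma isUnit_det_of_diag (hA : Qᵀ * A * Q = 1) : IsUnit Q.det := by
  have h := congrArg Matrix.det hA
  rw [det_mul, det_one] at h
  exact IsUnit.of_mul_eq_one_right _ h

lemma inv_eq_of_diag (hQ : IsUnit Q.det) (hd : ∀ i, 0 < d i) (hB : Qᵀ * B * Q = diagonal d) :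
    B⁻¹ = Q * (diagonal fun i => (d i)⁻¹) * Qᵀ := by
  have hQt : IsUnit Qᵀ.det := by rwa [det_transpose]
  apply Matrix.inv_eq_left_inv
  have hB' : B = Qᵀ⁻¹ * diagonal d * Q⁻¹ := by
    rw [← hB]
    calc B = (Qᵀ⁻¹ * Qᵀ) * B * (Q * Q⁻¹) := by
          rw [Matrix.nonsing_inv_mul _ hQt, Matrix.mul_nonsing_inv _ hQ]; simp
      _ = _ := by simp only [Matrix.mul_assoc]
  rw [hB']
  calc Q * (diagonal fun i => (d i)⁻¹) * Qᵀ * (Qᵀ⁻¹ * diagonal d * Q⁻¹)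
      = Q * (diagonal fun i => (d i)⁻¹) * (Qᵀ * Qᵀ⁻¹) * diagonal d * Q⁻¹ := by
        simp only [Matrix.mul_assoc]
    _ = Q * ((diagonal fun i => (d i)⁻¹) * diagonal d) * Q⁻¹ := by
        rw [Matrix.mul_nonsing_inv _ hQt]; simp only [Matrix.mul_assoc, Matrix.one_mul]
    _ = 1 := by
        rw [diagonal_mul_diagonal]
        have : (fun i => (d i)⁻¹ * d i) = fun _ => (1 : ℝ) := by
          ext i; exact inv_mul_cancel₀ (hd i).ne'
        rw [this, diagonal_one, Matrix.mul_one, Matrix.mul_nonsing_inv _ hQ]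

lemma trace_normMetric (hA : Qᵀ * A * Q = 1) (hd : ∀ i, 0 < d i) (hB : Qᵀ * B * Q = diagonal d) :
    (A⁻¹ * B * A⁻¹ * B).trace = ∑ i, d i ^ 2 := by
  have hQ := isUnit_det_of_diag hA
  have hQt : IsUnit Qᵀ.det := by rwa [det_transpose]
  have hA' : A⁻¹ = Q * Qᵀ := by
    have := inv_eq_of_diag (d := fun _ => 1) hQ (by simp) (by rw [hA, diagonal_one])
    simpa using this
  have h1 : A⁻¹ * B = Q * diagonal d * Q⁻¹ := by
    rw [hA', ← hB]
    calc Q * Qᵀ * B = Q * Qᵀ * B * (Q * Q⁻¹) := by rw [Matrix.mul_nonsing_inv _ hQ]; simp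
      _ = _ := by simp only [Matrix.mul_assoc]
  calc (A⁻¹ * B * A⁻¹ * B).trace = ((Q * diagonal d * Q⁻¹) * (Q * diagonal d * Q⁻¹)).trace := by
        rw [← h1]; simp only [Matrix.mul_assoc]
    _ = (Q * (diagonal d * (Q⁻¹ * Q) * diagonal d) * Q⁻¹).trace := by simp only [Matrix.mul_assoc]
    _ = ∑ i, d i ^ 2 := by
        rw [Matrix.nonsing_inv_mul _ hQ, Matrix.mul_one, trace_mul_comm, ← Matrix.mul_assoc,
          Matrix.nonsing_inv_mul _ hQ, Matrix.one_mul, diagonal_mul_diagonal, trace_diagonal]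
        exact Finset.sum_congr rfl fun i _ => (sq _).symm

lemma trace_normInvDiff (hA : Qᵀ * A * Q = 1) (hd : ∀ i, 0 < d i)
    (hB : Qᵀ * B * Q = diagonal d) :
    (A * (B⁻¹ - A⁻¹) * A * (B⁻¹ - A⁻¹)).trace = ∑ i, ((d i)⁻¹ - 1) ^ 2 := by
  have hQ := isUnit_det_of_diag hA
  have hQt : IsUnit Qᵀ.det := by rwa [det_transpose]
  have hA' : A⁻¹ = Q * Qᵀ := by
    have := inv_eq_of_diag (d := fun _ => 1) hQ (by simp) (by rw [hA, diagonal_one])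
    simpa using this
  have hAA : Qᵀ * A = Q⁻¹ := by
    symm
    exact Matrix.inv_eq_left_inv hA
  set D : Matrix (Fin n) (Fin n) ℝ := diagonal fun i => (d i)⁻¹ - 1 with hD
  have h0 : B⁻¹ - A⁻¹ = Q * D * Qᵀ := by
    rw [inv_eq_of_diag hQ hd hB, hA', hD]
    have : (diagonal fun i => (d i)⁻¹ - 1) = (diagonal fun i => (d i)⁻¹) - (1 : Matrix (Fin n) (Fin n) ℝ) := by
      rw [← diagonal_one, diagonal_sub]
    rw [this, Matrix.mul_sub, Matrix.sub_mul, Matrix.mul_one]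
  calc (A * (B⁻¹ - A⁻¹) * A * (B⁻¹ - A⁻¹)).trace
      = (((A * (Q * D)) * (Qᵀ * A)) * (Q * D * Qᵀ)).trace := by
        rw [h0]; simp only [Matrix.mul_assoc]
    _ = ((A * (Q * D)) * ((Q⁻¹ * Q) * D * Qᵀ)).trace := by
        rw [hAA]; simp only [Matrix.mul_assoc]
    _ = ((D * Qᵀ) * (A * (Q * D))).trace := by
        rw [Matrix.nonsing_inv_mul _ hQ, Matrix.one_mul, trace_mul_comm]
    _ = (D * (Qᵀ * A * Q) * D).trace := by simp only [Matrix.mul_assoc]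
    _ = ∑ i, ((d i)⁻¹ - 1) ^ 2 := by
        rw [hA, Matrix.mul_one, hD, diagonal_mul_diagonal, trace_diagonal]
        exact Finset.sum_congr rfl fun i _ => (sq _).symm

lemma det_of_diag (hA : Qᵀ * A * Q = 1) (hB : Qᵀ * B * Q = diagonal d) :
    B.det / A.det = ∏ i, d i := by
  have hQ := (isUnit_det_of_diag hA).ne_zero
  have h1 := congrArg Matrix.det hA
  have h2 := congrArg Matrix.det hB
  rw [det_mul, det_mul, det_transpose, det_one] at h1
  rw [det_mul, det_mul, det_transpose, det_diagonal] at h2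
  have hA0 : A.det ≠ 0 := by
    intro h; rw [h] at h1; simp at h1
  rw [← h2, div_eq_iff hA0]
  linear_combination (-B.det) * h1

end Traces

/-- The traces that define the norms do not depend on the basis. -/
lemma trace_normMetric_congr {n : ℕ} {A B J : Matrix (Fin n) (Fin n) ℝ} (hJ : IsUnit J.det) :
    ((Jᵀ * A * J)⁻¹ * (Jᵀ * B * J) * (Jᵀ * A * J)⁻¹ * (Jᵀ * B * J)).trace =
      (A⁻¹ * B * A⁻¹ * B).trace := by
  have hJt : IsUnit Jᵀ.det := by rwa [det_transpose]
  have h1 : (Jᵀ * A * J)⁻¹ * (Jᵀ * B * J) = J⁻¹ * (A⁻¹ * B) * J := by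
    rw [Matrix.mul_inv_rev, Matrix.mul_inv_rev]
    calc J⁻¹ * (A⁻¹ * Jᵀ⁻¹) * (Jᵀ * B * J) = J⁻¹ * A⁻¹ * (Jᵀ⁻¹ * Jᵀ) * B * J := by
          simp only [Matrix.mul_assoc]
      _ = _ := by rw [Matrix.nonsing_inv_mul _ hJt]; simp only [Matrix.mul_assoc, Matrix.one_mul]
  calc _ = ((J⁻¹ * (A⁻¹ * B) * J) * (J⁻¹ * (A⁻¹ * B) * J)).trace := by
        rw [← h1]; simp only [Matrix.mul_assoc]
    _ = ((J⁻¹ * (A⁻¹ * B)) * (J * J⁻¹) * (A⁻¹ * B) * J).trace := by simp only [Matrix.mul_assoc]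
    _ = _ := by
        rw [Matrix.mul_nonsing_inv _ hJ, Matrix.mul_one, trace_mul_comm]
        simp only [← Matrix.mul_assoc]
        rw [Matrix.mul_nonsing_inv _ hJ, Matrix.one_mul]

lemma trace_normInvDiff_congr {n : ℕ} {A B J : Matrix (Fin n) (Fin n) ℝ} (hJ : IsUnit J.det) :
    ((Jᵀ * A * J) * ((Jᵀ * B * J)⁻¹ - (Jᵀ * A * J)⁻¹) * (Jᵀ * A * J) *
      ((Jᵀ * B * J)⁻¹ - (Jᵀ * A * J)⁻¹)).trace =
      (A * (B⁻¹ - A⁻¹) * A * (B⁻¹ - A⁻¹)).trace := by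
  have hJt : IsUnit Jᵀ.det := by rwa [det_transpose]
  have h1 : (Jᵀ * A * J) * ((Jᵀ * B * J)⁻¹ - (Jᵀ * A * J)⁻¹) =
      Jᵀ * (A * (B⁻¹ - A⁻¹)) * Jᵀ⁻¹ := by
    simp only [Matrix.mul_inv_rev]
    have : J⁻¹ * (B⁻¹ * Jᵀ⁻¹) - J⁻¹ * (A⁻¹ * Jᵀ⁻¹) = J⁻¹ * (B⁻¹ - A⁻¹) * Jᵀ⁻¹ := by
      simp only [Matrix.mul_sub, Matrix.sub_mul, Matrix.mul_assoc]
    rw [this]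
    calc Jᵀ * A * J * (J⁻¹ * (B⁻¹ - A⁻¹) * Jᵀ⁻¹)
        = Jᵀ * A * (J * J⁻¹) * (B⁻¹ - A⁻¹) * Jᵀ⁻¹ := by simp only [Matrix.mul_assoc]
      _ = _ := by rw [Matrix.mul_nonsing_inv _ hJ]; simp only [Matrix.mul_assoc, Matrix.one_mul]
  set X := A * (B⁻¹ - A⁻¹) with hX
  calc _ = ((Jᵀ * X * Jᵀ⁻¹) * (Jᵀ * X * Jᵀ⁻¹)).trace := by
        rw [← h1]; simp only [Matrix.mul_assoc]
    _ = (Jᵀ * X * (Jᵀ⁻¹ * Jᵀ) * X * Jᵀ⁻¹).trace := by simp only [Matrix.mul_assoc]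
    _ = (X * X).trace := by
        rw [Matrix.nonsing_inv_mul _ hJt, Matrix.mul_one, trace_mul_comm]
        simp only [← Matrix.mul_assoc]
        rw [Matrix.nonsing_inv_mul _ hJt, Matrix.one_mul]
    _ = _ := by rw [hX]; simp only [Matrix.mul_assoc]

end Diagonalization

section Eigenvalues

variable {n : ℕ} {M : Type*} [TopologicalSpace M] [ChartedSpace (Coord n) M]
  [IsManifold (𝓡 n) ∞ M]

lemma ip_sum_smul (g : Metric n M) (x : M) (q : Fin n → Coord n) (a b : Fin n → ℝ) :
    ip g x (∑ i, a i • q i) (∑ j, b j • q j) = ∑ i, ∑ j, a i * b j * ip g x (q i) (q j) := by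
  simp only [map_sum, map_smul, sum_apply, smul_apply, smul_eq_mul, Finset.mul_sum]
  rw [Finset.sum_comm]
  refine Finset.sum_congr rfl fun k _ => Finset.sum_congr rfl fun l _ => ?_
  ring

/-- The eigenvalues `d i` of `g` with respect to `g₀` at a point, with an eigenbasis that is
orthonormal for `g₀`. -/
lemma exists_eigenbasis (g₀ g : Metric n M) (x : M) :
    ∃ (q : Fin n → Coord n) (d : Fin n → ℝ), (∀ i, 0 < d i) ∧
      (∀ v : Coord n, ∃ a : Fin n → ℝ, v = ∑ i, a i • q i) ∧
      (∀ i j, ip g₀ x (q i) (q j) = if i = j then 1 else 0) ∧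
      (∀ i j, ip g x (q i) (q j) = if i = j then d i else 0) ∧
      normMetric g₀ g x ^ 2 = ∑ i, d i ^ 2 ∧
      normInvDiff g₀ g x ^ 2 = ∑ i, ((d i)⁻¹ - 1) ^ 2 ∧
      (gram g x).det / (gram g₀ x).det = ∏ i, d i := by
  obtain ⟨Q, d, hQ0, hQ, hd⟩ := exists_simultaneous_diag (gram_posDef g₀ x) (gram_posDef g x)
  have hu := isUnit_det_of_diag hQ0
  let q : Fin n → Coord n := fun i => WithLp.toLp 2 fun k => Q k i
  have hgr : ∀ g' : Metric n M, Matrix.of (fun i j => ip g' x (q i) (q j)) =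
      Q.transpose * gram g' x * Q := fun g' => gram_congr g' x q
  refine ⟨q, d, hd, ?_, ?_, ?_, ?_, ?_, det_of_diag hQ0 hQ⟩
  · intro v
    refine ⟨Q⁻¹.mulVec v, ?_⟩
    have h : v.ofLp = Q.mulVec (Q⁻¹.mulVec v) := by
      rw [Matrix.mulVec_mulVec, Matrix.mul_nonsing_inv _ hu, Matrix.one_mulVec]
    ext k
    conv_lhs => rw [h]
    simp [Matrix.mulVec, dotProduct, q, Finset.sum_apply, mul_comm]
  · intro i j
    have := congrFun (congrFun (hgr g₀) i) j
    rw [hQ0, Matrix.one_apply] at this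
    exact this
  · intro i j
    have := congrFun (congrFun (hgr g) i) j
    rw [hQ, Matrix.diagonal_apply] at this
    exact this
  · rw [normMetric, trace_normMetric hQ0 hd hQ, Real.sq_sqrt]
    exact Finset.sum_nonneg fun i _ => sq_nonneg _
  · rw [normInvDiff, trace_normInvDiff hQ0 hd hQ, Real.sq_sqrt]
    exact Finset.sum_nonneg fun i _ => sq_nonneg _

lemma normMetric_nonneg (g₀ g : Metric n M) (x : M) : 0 ≤ normMetric g₀ g x := Real.sqrt_nonneg _

lemma normInvDiff_nonneg (g₀ g : Metric n M) (x : M) : 0 ≤ normInvDiff g₀ g x := Real.sqrt_nonneg _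

/-- The comparison of energy densities in terms of eigenvalues. The smallest `d i` pays
for the ratio of the norms, and the other factors of `∏ d i` are bounded by `B`. -/
lemma sum_div_rpow_mul_sqrt_prod_le {n : ℕ} {p A B : ℝ} (hp : 1 ≤ p) {d b : Fin n → ℝ}
    (hd : ∀ i, 0 < d i) (hA : ∀ i, (d i)⁻¹ ≤ A) (hB : ∀ i, d i ≤ B) (hn : 0 < n) :
    (∑ i, b i ^ 2 / d i) ^ (p / 2) * Real.sqrt (∏ i, d i) ≤
      A ^ ((p - 1) / 2) * B ^ (((n : ℝ) - 1) / 2) * (∑ i, b i ^ 2) ^ (p / 2) := by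
  have : Nonempty (Fin n) := ⟨⟨0, hn⟩⟩
  obtain ⟨i₀, hi₀⟩ := Finite.exists_min d
  have hA0 : 0 ≤ A := (inv_pos.2 (hd i₀)).le.trans (hA i₀)
  have hB0 : 0 < B := (hd i₀).trans_le (hB i₀)
  have hs : 0 ≤ ∑ i, b i ^ 2 := Finset.sum_nonneg fun i _ => sq_nonneg _
  have h1 : ∑ i, b i ^ 2 / d i ≤ (d i₀)⁻¹ * ∑ i, b i ^ 2 := by
    rw [Finset.mul_sum]
    refine Finset.sum_le_sum fun i _ => ?_
    rw [div_eq_inv_mul]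
    gcongr
    · exact hd i₀
    · exact hi₀ i
  have h2 : ∏ i, d i ≤ d i₀ * B ^ (n - 1) := by
    rw [← Finset.mul_prod_erase _ _ (Finset.mem_univ i₀)]
    gcongr
    · exact (hd i₀).le
    · calc ∏ i ∈ Finset.univ.erase i₀, d i ≤ ∏ i ∈ Finset.univ.erase i₀, B :=
          Finset.prod_le_prod (fun i _ => (hd i).le) fun i _ => hB i
        _ = B ^ (n - 1) := by simp
  have h3 : Real.sqrt (∏ i, d i) ≤ (d i₀) ^ (1 / 2 : ℝ) * B ^ (((n : ℝ) - 1) / 2) := by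
    refine (Real.sqrt_le_sqrt h2).trans_eq ?_
    rw [Real.sqrt_eq_rpow, Real.mul_rpow (hd i₀).le (by positivity), ← Real.rpow_natCast,
      ← Real.rpow_mul hB0.le]
    congr 2
    rw [Nat.cast_sub hn]
    push_cast
    ring
  have h0 : 0 ≤ ∑ i, b i ^ 2 / d i :=
    Finset.sum_nonneg fun i _ => div_nonneg (sq_nonneg _) (hd i).le
  calc (∑ i, b i ^ 2 / d i) ^ (p / 2) * Real.sqrt (∏ i, d i)
      ≤ ((d i₀)⁻¹ * ∑ i, b i ^ 2) ^ (p / 2) * ((d i₀) ^ (1 / 2 : ℝ) * B ^ (((n : ℝ) - 1) / 2)) := by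
        have := (inv_pos.2 (hd i₀)).le
        gcongr
    _ = ((d i₀)⁻¹ ^ (p / 2) * (d i₀) ^ (1 / 2 : ℝ)) * B ^ (((n : ℝ) - 1) / 2) *
          (∑ i, b i ^ 2) ^ (p / 2) := by
        rw [Real.mul_rpow (inv_pos.2 (hd i₀)).le hs]; ring
    _ = (d i₀)⁻¹ ^ ((p - 1) / 2) * B ^ (((n : ℝ) - 1) / 2) * (∑ i, b i ^ 2) ^ (p / 2) := by
        congr 2
        rw [← inv_inv (d i₀ ^ (1 / 2 : ℝ)), ← Real.inv_rpow (hd i₀).le,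
          ← Real.rpow_neg (inv_pos.2 (hd i₀)).le, ← Real.rpow_add (inv_pos.2 (hd i₀))]
        congr 1
        ring
    _ ≤ _ := by
        have : (d i₀)⁻¹ ^ ((p - 1) / 2) ≤ A ^ ((p - 1) / 2) :=
          Real.rpow_le_rpow (inv_pos.2 (hd i₀)).le (hA i₀) (by linarith)
        gcongr

/-- The ratio `√(det g / det g₀)` of the volume densities. -/
def volRatio (g₀ g : Metric n M) (x : M) : ℝ := Real.sqrt ((gram g x).det / (gram g₀ x).det)

/-- An upper bound for the eigenvalues of `g` with respect to `g₀`: the number `(1 - δ)⁻¹` where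
`|g⁻¹ - g₀⁻¹| ≤ δ`, and `|g|` elsewhere. -/
def upperEig (δ : ℝ) (g₀ g : Metric n M) (x : M) : ℝ :=
  if normInvDiff g₀ g x ≤ δ then (1 - δ)⁻¹ else normMetric g₀ g x

lemma eig_bounds {δ : ℝ} (hδ : δ < 1) (g₀ g : Metric n M) (x : M) {d : Fin n → ℝ}
    (hd : ∀ i, 0 < d i)
    (h1 : normMetric g₀ g x ^ 2 = ∑ i, d i ^ 2)
    (h2 : normInvDiff g₀ g x ^ 2 = ∑ i, ((d i)⁻¹ - 1) ^ 2) (i : Fin n) :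
    (d i)⁻¹ ≤ 1 + normInvDiff g₀ g x ∧ d i ≤ upperEig δ g₀ g x := by
  have h3 : ((d i)⁻¹ - 1) ^ 2 ≤ normInvDiff g₀ g x ^ 2 := by
    rw [h2]
    exact Finset.single_le_sum (f := fun i => ((d i)⁻¹ - 1) ^ 2) (fun i _ => sq_nonneg _)
      (Finset.mem_univ i)
  have h4 := abs_le_of_sq_le_sq' h3 (normInvDiff_nonneg ..)
  have h5 : d i ^ 2 ≤ normMetric g₀ g x ^ 2 := by
    rw [h1]
    exact Finset.single_le_sum (f := fun i => d i ^ 2) (fun i _ => sq_nonneg _)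
      (Finset.mem_univ i)
  refine ⟨by linarith [h4.2], ?_⟩
  unfold upperEig
  split_ifs with h
  · rw [le_inv_comm₀ (hd i) (by linarith)]
    linarith [h4.1]
  · exact (abs_le_of_sq_le_sq' h5 (normMetric_nonneg ..)).2

/-- Comparison of the `p`-energy densities of the same covector for the metrics `g` and `g₀`. -/
lemma nrm_rpow_comparison {p δ : ℝ} (hn : 0 < n) (hp : 1 ≤ p) (hδ : δ < 1) (g₀ g : Metric n M)
    (x : M) {v w : Coord n} (hvw : ∀ u, ip g₀ x w u = ip g x v u) :
    nrm g x v ^ p * volRatio g₀ g x ≤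
      (1 + normInvDiff g₀ g x) ^ ((p - 1) / 2) * upperEig δ g₀ g x ^ (((n : ℝ) - 1) / 2) *
        nrm g₀ x w ^ p ∧
    nrm g₀ x w ^ p ≤
      (upperEig δ g₀ g x ^ ((p - 1) / 2) * (1 + normInvDiff g₀ g x) ^ (((n : ℝ) - 1) / 2)) *
        (nrm g x v ^ p * volRatio g₀ g x) := by
  obtain ⟨q, d, hd, hspan, hq0, hq, hS, hN, hdet⟩ := exists_eigenbasis g₀ g x
  obtain ⟨a, rfl⟩ := hspan v
  obtain ⟨b, rfl⟩ := hspan w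
  have hab : ∀ i, b i = d i * a i := by
    intro i
    have h := hvw (q i)
    simp only [map_sum, map_smul, sum_apply, smul_apply, smul_eq_mul, hq0, hq] at h
    simp at h
    linarith
  have hW : ip g₀ x (∑ i, b i • q i) (∑ i, b i • q i) = ∑ i, b i ^ 2 := by
    rw [ip_sum_smul]
    simp [hq0, sq]
  have hV : ip g x (∑ i, a i • q i) (∑ i, a i • q i) = ∑ i, b i ^ 2 / d i := by
    rw [ip_sum_smul]
    simp only [hq, mul_ite, mul_zero, Finset.sum_ite_eq, Finset.mem_univ, if_true]
    refine Finset.sum_congr rfl fun i _ => ?_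
    rw [hab i]
    have := (hd i).ne'
    field_simp
  have hbd := fun i => eig_bounds hδ g₀ g x hd hS hN i
  have hrp : ∀ s : ℝ, 0 ≤ s → Real.sqrt s ^ p = s ^ (p / 2) := by
    intro s hs
    rw [Real.sqrt_eq_rpow, ← Real.rpow_mul hs]
    congr 1; ring
  have hV0 : 0 ≤ ∑ i, b i ^ 2 / d i :=
    Finset.sum_nonneg fun i _ => div_nonneg (sq_nonneg _) (hd i).le
  have hW0 : 0 ≤ ∑ i, b i ^ 2 := Finset.sum_nonneg fun i _ => sq_nonneg _
  simp only [nrm, volRatio, hW, hV, hdet, hrp _ hV0, hrp _ hW0]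
  refine ⟨sum_div_rpow_mul_sqrt_prod_le hp hd (fun i => (hbd i).1) (fun i => (hbd i).2) hn, ?_⟩
  -- the second inequality is the first one with the roles of the two metrics exchanged
  have h := sum_div_rpow_mul_sqrt_prod_le (d := fun i => (d i)⁻¹)
    (b := fun i => b i / Real.sqrt (d i)) hp (fun i => inv_pos.2 (hd i))
    (fun i => by rw [inv_inv]; exact (hbd i).2) (fun i => (hbd i).1) hn
  have e1 : ∀ i, (b i / Real.sqrt (d i)) ^ 2 = b i ^ 2 / d i := fun i => by
    rw [div_pow, Real.sq_sqrt (hd i).le]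
  have e2 : ∀ i, b i ^ 2 / d i / (d i)⁻¹ = b i ^ 2 := fun i => by
    have := (hd i).ne'
    field_simp
  simp only [e1, e2, Finset.prod_inv_distrib, Real.sqrt_inv] at h
  have hr : 0 < Real.sqrt (∏ i, d i) := Real.sqrt_pos.2 (Finset.prod_pos fun i _ => hd i)
  rw [← div_eq_mul_inv, div_le_iff₀ hr] at h
  linarith

end Eigenvalues

/-! ### Comparison of volumes, and integrals of the comparison factors -/

section Continuity

open Matrix

variable {n : ℕ} {M : Type*} [TopologicalSpace M] [ChartedSpace (Coord n) M]
  [IsManifold (𝓡 n) ∞ M]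

lemma exists_gmat_eq {e : OpenPartialHomeomorph M (Coord n)}
    (he : e ∈ atlas (Coord n) M) {x : M} (hx : x ∈ e.source) :
    ∃ J : Matrix (Fin n) (Fin n) ℝ, IsUnit J.det ∧ ∀ g : Metric n M, gmat g e x = Jᵀ * gram g x * J := by
  refine ⟨Matrix.of fun k i => coordField e i x k, ?_, fun g => gram_congr g x _⟩
  have := det_of_apply_single (symmD e (e x))
  rw [isUnit_iff_ne_zero]
  intro h
  exact symmD_det_ne_zero he (e.map_source hx) (this.symm.trans h)

lemma gmat_det_ne_zero (g : Metric n M) {e : OpenPartialHomeomorph M (Coord n)}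
    (he : e ∈ atlas (Coord n) M) {x : M} (hx : x ∈ e.source) : (gmat g e x).det ≠ 0 := by
  obtain ⟨J, hJ, h⟩ := exists_gmat_eq he hx
  rw [h, det_mul, det_mul, det_transpose]
  exact mul_ne_zero (mul_ne_zero hJ.ne_zero (det_gram_pos g x).ne') hJ.ne_zero

lemma continuousOn_gmat_inv (g : Metric n M) {e : OpenPartialHomeomorph M (Coord n)}
    (he : e ∈ atlas (Coord n) M) : ContinuousOn (fun x => (gmat g e x)⁻¹) e.source := by
  have h1 := continuousOn_gmat g he
  simp only [Matrix.inv_def, Ring.inverse_eq_inv']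
  have h2 : ContinuousOn (fun x => (gmat g e x).det⁻¹) e.source :=
    ContinuousOn.inv₀ (continuous_id.matrix_det.comp_continuousOn h1)
      fun x hx => gmat_det_ne_zero g he hx
  have h3 : ContinuousOn (fun x => (gmat g e x).adjugate) e.source :=
    continuous_id.matrix_adjugate.comp_continuousOn h1
  exact h2.smul h3

lemma continuous_of_charts {F : M → ℝ}
    (h : ∀ e ∈ atlas (Coord n) M, ContinuousOn F e.source) : Continuous F :=
  continuous_iff_continuousAt.2 fun x => (h _ (chart_mem_atlas (Coord n) x)).continuousAt
    (chart_source_mem_nhds (Coord n) x)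

lemma continuousOn_matrix_mul {X : Type*} [TopologicalSpace X] {s : Set X}
    {A B : X → Matrix (Fin n) (Fin n) ℝ} (hA : ContinuousOn A s) (hB : ContinuousOn B s) :
    ContinuousOn (fun x => A x * B x) s :=
  (continuous_fst.matrix_mul continuous_snd).comp_continuousOn (hA.prodMk hB)

lemma continuous_normMetric (g₀ g : Metric n M) : Continuous (normMetric g₀ g) := by
  refine continuous_of_charts (n := n) fun e he => ?_
  have h0 := continuousOn_gmat_inv g₀ he
  have h1 := continuousOn_gmat g he
  have h := Real.continuous_sqrt.comp_continuousOn (continuous_id.matrix_trace.comp_continuousOn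
    (continuousOn_matrix_mul (continuousOn_matrix_mul (continuousOn_matrix_mul h0 h1) h0) h1))
  refine h.congr fun x hx => ?_
  obtain ⟨J, hJ, hg⟩ := exists_gmat_eq he hx
  simp only [normMetric, Function.comp_apply, hg, id]
  rw [trace_normMetric_congr hJ]

lemma continuous_normInvDiff (g₀ g : Metric n M) : Continuous (normInvDiff g₀ g) := by
  refine continuous_of_charts (n := n) fun e he => ?_
  have h0 := continuousOn_gmat g₀ he
  have h1 : ContinuousOn (fun x => (gmat g e x)⁻¹ - (gmat g₀ e x)⁻¹) e.source :=
    (continuousOn_gmat_inv g he).sub (continuousOn_gmat_inv g₀ he)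
  have h2 := continuousOn_matrix_mul (continuousOn_matrix_mul (continuousOn_matrix_mul h0 h1) h0) h1
  have h : ContinuousOn (fun x => Real.sqrt ((gmat g₀ e x * ((gmat g e x)⁻¹ - (gmat g₀ e x)⁻¹) *
      gmat g₀ e x * ((gmat g e x)⁻¹ - (gmat g₀ e x)⁻¹)).trace)) e.source :=
    Real.continuous_sqrt.comp_continuousOn (continuous_id.matrix_trace.comp_continuousOn h2)
  refine h.congr fun x hx => ?_
  obtain ⟨J, hJ, hg⟩ := exists_gmat_eq he hx
  beta_reduce
  rw [hg g, hg g₀, trace_normInvDiff_congr hJ, normInvDiff]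

lemma continuous_volRatio (g₀ g : Metric n M) : Continuous (volRatio g₀ g) := by
  refine continuous_of_charts (n := n) fun e he => ?_
  have hd : ∀ g' : Metric n M, ContinuousOn (fun x => (gmat g' e x).det) e.source := fun g' =>
    continuous_id.matrix_det.comp_continuousOn (continuousOn_gmat g' he)
  have h := Real.continuous_sqrt.comp_continuousOn
    ((hd g).div (hd g₀) fun x hx => gmat_det_ne_zero g₀ he hx)
  refine h.congr fun x hx => ?_
  obtain ⟨J, hJ, hg⟩ := exists_gmat_eq he hx
  have h1 := hJ.ne_zero
  have h2 := (det_gram_pos g₀ x).ne'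
  simp only [volRatio, Function.comp_apply, Pi.div_apply, hg, det_mul, det_transpose]
  congr 1
  field_simp

lemma volRatio_pos (g₀ g : Metric n M) (x : M) : 0 < volRatio g₀ g x :=
  Real.sqrt_pos.2 (div_pos (det_gram_pos g x) (det_gram_pos g₀ x))

variable [MeasurableSpace M] [BorelSpace M] [CompactSpace M] [Nonempty M]

lemma vol_eq_withDensity (g₀ g : Metric n M) :
    vol g = (vol g₀).withDensity fun x => ENNReal.ofReal (volRatio g₀ g x) := by
  have hr : Measurable fun x => ENNReal.ofReal (volRatio g₀ g x) :=
    (continuous_volRatio g₀ g).measurable.ennreal_ofReal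
  obtain ⟨c, hc⟩ := exists_seq_cover n M
  refine Measure.ext_of_iUnion_eq_univ hc fun k => ?_
  set e := chartAt (Coord n) (c k)
  have he : e ∈ atlas (Coord n) M := chart_mem_atlas _ _
  rw [restrict_withDensity e.open_source.measurableSet, vol_restrict g he, vol_restrict g₀ he]
  ext A hA
  rw [withDensity_apply _ hA, ← lintegral_indicator hA, ← lintegral_indicator_one hA,
    lintegral_chartVolume g he (measurable_one.indicator hA).aemeasurable,
    lintegral_chartVolume g₀ he (hr.indicator hA).aemeasurable]
  refine setLIntegral_congr_fun e.open_target.measurableSet fun y hy => ?_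
  by_cases hyA : e.symm y ∈ A
  · simp only [Set.indicator_of_mem hyA, Pi.one_apply, mul_one]
    have hd : 0 ≤ dens g₀ e y := Real.sqrt_nonneg _
    rw [← ENNReal.ofReal_mul hd, dens_eq, dens_eq, volRatio, mul_assoc,
      ← Real.sqrt_mul (det_gram_pos g₀ _).le]
    congr 3
    rw [mul_div_cancel₀ _ (det_gram_pos g₀ _).ne']
  · simp [Set.indicator_of_notMem hyA]

end Continuity

section Integrals

variable {Ω : Type*} [MeasurableSpace Ω] {μ : Measure Ω}

/-- Where `N > δ`, the factor `1 + N` is at most `(1 + δ) δ⁻¹ N`, and `δ⁻¹ N ≥ 1` lets the exponent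
grow from `α` to `α'`. -/
lemma rpow_mul_rpow_le {δ α α' β N S : ℝ} (hδ0 : 0 < δ) (hδ1 : δ < 1) (hα : 0 ≤ α)
    (hαα' : α ≤ α') (hβ : 0 ≤ β) (hN : 0 ≤ N) (hS : 0 ≤ S) :
    (1 + N) ^ α * (if N ≤ δ then (1 - δ)⁻¹ else S) ^ β ≤
      (1 + δ) ^ α * (1 - δ)⁻¹ ^ β + ((1 + δ) ^ α * δ⁻¹ ^ α') * (N ^ α' * S ^ β) := by
  have h1 : 0 < 1 - δ := by linarith
  split_ifs with h
  · have : (1 + N) ^ α ≤ (1 + δ) ^ α := by gcongr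
    have h2 : (1 + N) ^ α * (1 - δ)⁻¹ ^ β ≤ (1 + δ) ^ α * (1 - δ)⁻¹ ^ β := by gcongr
    have h3 : 0 ≤ ((1 + δ) ^ α * δ⁻¹ ^ α') * (N ^ α' * S ^ β) := by positivity
    linarith
  · push Not at h
    have h2 : (1 + N) ^ α ≤ (1 + δ) ^ α * δ⁻¹ ^ α' * N ^ α' := by
      have h3 : 1 ≤ δ⁻¹ * N := by
        rw [← div_eq_inv_mul, one_le_div hδ0]; exact h.le
      calc (1 + N) ^ α ≤ ((1 + δ) * (δ⁻¹ * N)) ^ α := by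
            have : N = δ * (δ⁻¹ * N) := by field_simp
            gcongr
            linarith
        _ = (1 + δ) ^ α * (δ⁻¹ * N) ^ α := Real.mul_rpow (by positivity) (by positivity)
        _ ≤ (1 + δ) ^ α * (δ⁻¹ * N) ^ α' := by
            gcongr
        _ = _ := by rw [Real.mul_rpow (by positivity) hN, mul_assoc]
    have h4 : (1 + N) ^ α * S ^ β ≤ (1 + δ) ^ α * δ⁻¹ ^ α' * N ^ α' * S ^ β := by gcongr
    have h5 : 0 ≤ (1 + δ) ^ α * (1 - δ)⁻¹ ^ β := by positivity
    linarith

/-- If `N j → 0` in `L^t` and `S j` is bounded in `L^s`, then the weights built from `1 + N j` and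
from an upper bound that is close to `1` where `N j` is small and equal to `S j` elsewhere, have
mass asymptotically concentrated where they are close to `1`. -/
lemma eventually_lintegral_weight_le {s t θ α δ : ℝ} (hδ0 : 0 < δ) (hδ1 : δ < 1) (hα : 0 ≤ α)
    (hs : 0 ≤ s) (ht : 0 ≤ t) (hθ0 : 0 ≤ θ) (hθ1 : θ < 1) (hα' : α ≤ (1 - θ) * t)
    {N S : ℕ → Ω → ℝ} (hN : ∀ j, Measurable (N j)) (hS : ∀ j, Measurable (S j))
    (hN0 : ∀ j x, 0 ≤ N j x) (hS0 : ∀ j x, 0 ≤ S j x) {C : ℝ≥0∞} (hC : C ≠ ⊤)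
    (hSC : ∀ j, ∫⁻ x, ENNReal.ofReal (S j x ^ s) ∂μ ≤ C)
    (hNt : Tendsto (fun j => ∫⁻ x, ENNReal.ofReal (N j x ^ t) ∂μ) atTop (𝓝 0))
    {F : Ω → ℝ≥0∞} (hF : AEMeasurable F μ) {L : ℝ≥0∞} (hL : L ≠ ⊤) (hFL : ∀ x, F x ≤ L)
    {ε : ℝ≥0∞} (hε : 0 < ε) :
    ∀ᶠ j in atTop, ∫⁻ x, ENNReal.ofReal ((1 + N j x) ^ α *
        (if N j x ≤ δ then (1 - δ)⁻¹ else S j x) ^ (θ * s)) * F x ∂μ ≤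
      ENNReal.ofReal ((1 + δ) ^ α * (1 - δ)⁻¹ ^ (θ * s)) * ∫⁻ x, F x ∂μ + ε := by
  set c := (1 + δ) ^ α * (1 - δ)⁻¹ ^ (θ * s)
  set c' := (1 + δ) ^ α * δ⁻¹ ^ ((1 - θ) * t)
  have hc' : 0 ≤ c' := by positivity
  have hc : 0 ≤ c := by have : 0 < 1 - δ := by linarith
                        positivity
  have hlim : Tendsto (fun j => ENNReal.ofReal c' * ((∫⁻ x, ENNReal.ofReal (N j x ^ t) ∂μ) ^ (1 - θ) *
      C ^ θ) * L) atTop (𝓝 0) := by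
    have h1 : Tendsto (fun j => (∫⁻ x, ENNReal.ofReal (N j x ^ t) ∂μ) ^ (1 - θ)) atTop (𝓝 0) := by
      have := (ENNReal.continuous_rpow_const (y := 1 - θ)).tendsto 0
      rw [ENNReal.zero_rpow_of_pos (by linarith)] at this
      exact this.comp hNt
    have h2 := ENNReal.Tendsto.mul_const (b := L) (ENNReal.Tendsto.const_mul (a := ENNReal.ofReal c')
      (ENNReal.Tendsto.mul_const (b := C ^ θ) h1
        (Or.inr (ENNReal.rpow_ne_top_of_nonneg hθ0 hC))) (Or.inr ENNReal.ofReal_ne_top))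
        (Or.inr hL)
    simpa using h2
  filter_upwards [hlim.eventually (gt_mem_nhds hε)] with j hj
  have hNm : Measurable fun x => ENNReal.ofReal (N j x ^ t) := ((hN j).pow_const t).ennreal_ofReal
  have hSm : Measurable fun x => ENNReal.ofReal (S j x ^ s) := ((hS j).pow_const s).ennreal_ofReal
  have hpt : ∀ x, ENNReal.ofReal ((1 + N j x) ^ α *
        (if N j x ≤ δ then (1 - δ)⁻¹ else S j x) ^ (θ * s)) * F x ≤
      ENNReal.ofReal c * F x + ENNReal.ofReal c' *
        (ENNReal.ofReal (N j x ^ t) ^ (1 - θ) * ENNReal.ofReal (S j x ^ s) ^ θ) * L := by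
    intro x
    have h1 := rpow_mul_rpow_le hδ0 hδ1 hα hα' (mul_nonneg hθ0 hs) (hN0 j x) (hS0 j x)
    have h2 : ENNReal.ofReal (N j x ^ t) ^ (1 - θ) * ENNReal.ofReal (S j x ^ s) ^ θ =
        ENNReal.ofReal (N j x ^ ((1 - θ) * t) * S j x ^ (θ * s)) := by
      rw [ENNReal.ofReal_rpow_of_nonneg (Real.rpow_nonneg (hN0 j x) _) (by linarith),
        ENNReal.ofReal_rpow_of_nonneg (Real.rpow_nonneg (hS0 j x) _) hθ0,
        ← ENNReal.ofReal_mul (by have := hN0 j x; positivity), ← Real.rpow_mul (hN0 j x),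
        ← Real.rpow_mul (hS0 j x), mul_comm t, mul_comm s]
    rw [h2, ← ENNReal.ofReal_mul hc']
    calc _ ≤ ENNReal.ofReal (c + c' * (N j x ^ ((1 - θ) * t) * S j x ^ (θ * s))) * F x := by
          gcongr
      _ ≤ (ENNReal.ofReal c + ENNReal.ofReal (c' * (N j x ^ ((1 - θ) * t) * S j x ^ (θ * s)))) * F x := by
          gcongr
          exact ENNReal.ofReal_add_le
      _ ≤ _ := by
          rw [add_mul]
          gcongr
          exact hFL x
  calc _ ≤ ∫⁻ x, (ENNReal.ofReal c * F x + ENNReal.ofReal c' *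
        (ENNReal.ofReal (N j x ^ t) ^ (1 - θ) * ENNReal.ofReal (S j x ^ s) ^ θ) * L) ∂μ :=
        lintegral_mono hpt
    _ = ENNReal.ofReal c * ∫⁻ x, F x ∂μ + ENNReal.ofReal c' *
        (∫⁻ x, ENNReal.ofReal (N j x ^ t) ^ (1 - θ) * ENNReal.ofReal (S j x ^ s) ^ θ ∂μ) * L := by
        rw [lintegral_add_left' (hF.const_mul _), lintegral_const_mul'' _ hF,
          lintegral_mul_const' _ _ hL, lintegral_const_mul' _ _ ENNReal.ofReal_ne_top]
    _ ≤ _ := by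
        gcongr
        refine le_trans ?_ hj.le
        gcongr
        refine (ENNReal.lintegral_mul_norm_pow_le hNm.aemeasurable hSm.aemeasurable
          (by linarith) hθ0 (by ring)).trans ?_
        gcongr
        exact hSC j

end Integrals

/-! ### Metrics in charts, and the Riemannian distance -/

section Comparison

variable {n : ℕ} {M : Type*} [TopologicalSpace M] [ChartedSpace (Coord n) M]
  [IsManifold (𝓡 n) ∞ M]

lemma ip_eq_gmat (g : Metric n M) {e : OpenPartialHomeomorph M (Coord n)}
    (he : e ∈ atlas (Coord n) M) {x : M} (hx : x ∈ e.source) (v : Coord n) :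
    ip g x v v = ∑ i, ∑ j, chartD e x v i * chartD e x v j * gmat g e x i j := by
  conv_lhs => rw [eq_sum_coordField he hx v]
  exact ip_sum_smul g x _ _ _

lemma chartD_symmD_of_mem_source {e : OpenPartialHomeomorph M (Coord n)}
    (he : e ∈ atlas (Coord n) M) {x : M} (hx : x ∈ e.source) (w : Coord n) :
    chartD e x (symmD e (e x) w) = w := by
  have := chartD_symmD he (e.map_source hx) w
  rwa [e.left_inv hx] at this

/-- On compact subsets of a chart domain, the Euclidean norm in the chart is controlled by the
Riemannian norm. -/
lemma exists_norm_chartD_le (g : Metric n M) {e : OpenPartialHomeomorph M (Coord n)}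
    (he : e ∈ atlas (Coord n) M) {K : Set M} (hK : IsCompact K) (hKe : K ⊆ e.source) :
    ∃ C : ℝ, 0 < C ∧ ∀ x ∈ K, ∀ v, ‖chartD e x v‖ ≤ C * nrm g x v := by
  let q : M × Coord n → ℝ := fun z => ∑ i, ∑ j, z.2 i * z.2 j * gmat g e z.1 i j
  have hq : ContinuousOn q (K ×ˢ Metric.sphere (0 : Coord n) 1) := by
    refine continuousOn_finsetSum _ fun i _ => continuousOn_finsetSum _ fun j _ => ?_
    have h1 : ContinuousOn (fun z : M × Coord n => gmat g e z.1 i j)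
        (K ×ˢ Metric.sphere (0 : Coord n) 1) := by
      have h2 := ((continuousOn_gmat g he).mono hKe)
      have h3 : ContinuousOn (fun x => gmat g e x i j) K :=
        continuousOn_pi.1 (continuousOn_pi.1 h2 i) j
      exact h3.comp continuousOn_fst fun z hz => hz.1
    have h4 : Continuous fun z : M × Coord n => z.2 i * z.2 j := by fun_prop
    exact h4.continuousOn.mul h1
  have hpos : ∀ z ∈ K ×ˢ Metric.sphere (0 : Coord n) 1, 0 < q z := by
    rintro ⟨x, w⟩ ⟨hx, hw⟩
    have h := ip_eq_gmat g he (hKe hx) (symmD e (e x) w)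
    rw [chartD_symmD_of_mem_source he (hKe hx)] at h
    change 0 < ∑ i, ∑ j, w i * w j * gmat g e x i j
    rw [← h]
    apply ip_pos
    intro h0
    have h5 := chartD_symmD_of_mem_source he (hKe hx) w
    rw [h0, map_zero] at h5
    subst h5
    simp at hw
  obtain ⟨c, hc, hcq⟩ : ∃ c : ℝ, 0 < c ∧ ∀ z ∈ K ×ˢ Metric.sphere (0 : Coord n) 1, c ≤ q z := by
    rcases (K ×ˢ Metric.sphere (0 : Coord n) 1).eq_empty_or_nonempty with h0 | h0
    · exact ⟨1, one_pos, by simp [h0]⟩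
    · obtain ⟨z, hz, hmin⟩ := (hK.prod (isCompact_sphere (0 : Coord n) 1)).exists_isMinOn h0 hq
      exact ⟨q z, hpos z hz, fun z' hz' => hmin hz'⟩
  refine ⟨(Real.sqrt c)⁻¹, inv_pos.2 (Real.sqrt_pos.2 hc), fun x hx v => ?_⟩
  rw [← div_eq_inv_mul, le_div_iff₀ (Real.sqrt_pos.2 hc)]
  apply Real.le_sqrt_of_sq_le
  rw [mul_pow, Real.sq_sqrt hc.le]
  rcases eq_or_ne (chartD e x v) 0 with h0 | h0
  · rw [h0]; simpa using ip_self_nonneg g x v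
  · have hn : ‖chartD e x v‖ ≠ 0 := norm_ne_zero_iff.2 h0
    have h1 := hcq (x, ‖chartD e x v‖⁻¹ • chartD e x v) ⟨hx, by simp [norm_smul, hn]⟩
    have h2 : q (x, ‖chartD e x v‖⁻¹ • chartD e x v) = (‖chartD e x v‖⁻¹) ^ 2 * ip g x v v := by
      rw [ip_eq_gmat g he (hKe hx) v, Finset.mul_sum]
      simp only [q, Finset.mul_sum, PiLp.smul_apply, smul_eq_mul]
      refine Finset.sum_congr rfl fun i _ => Finset.sum_congr rfl fun j _ => ?_
      ring
    rw [h2, inv_pow, ← div_eq_inv_mul, le_div_iff₀ (by positivity)] at h1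
    linarith

lemma exists_nrm_coordField_le (g : Metric n M) {e : OpenPartialHomeomorph M (Coord n)}
    (he : e ∈ atlas (Coord n) M) {K : Set M} (hK : IsCompact K) (hKe : K ⊆ e.source) :
    ∃ C : ℝ, 0 < C ∧ ∀ x ∈ K, ∀ i, nrm g x (coordField e i x) ≤ C := by
  have h : ∀ i, ∃ C : ℝ, ∀ x ∈ K, nrm g x (coordField e i x) ≤ C := by
    intro i
    have h1 := continuousOn_ip_coordField g he he i i
    rw [Set.inter_self] at h1
    have h2 : ContinuousOn (fun x => nrm g x (coordField e i x)) K :=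
      Real.continuous_sqrt.comp_continuousOn (h1.mono hKe)
    obtain ⟨C, hC⟩ := hK.bddAbove_image h2
    exact ⟨C, fun x hx => hC ⟨x, hx, rfl⟩⟩
  choose C hC using h
  refine ⟨1 + ∑ i, |C i|, by positivity, fun x hx i => (hC i x hx).trans ?_⟩
  have := Finset.single_le_sum (f := fun i => |C i|) (fun i _ => abs_nonneg _) (Finset.mem_univ i)
  have := le_abs_self (C i)
  linarith

/-- The norm of a vector is controlled by its components against the coordinate fields. -/
lemma exists_nrm_le_sum (g : Metric n M) {e : OpenPartialHomeomorph M (Coord n)}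
    (he : e ∈ atlas (Coord n) M) {K : Set M} (hK : IsCompact K) (hKe : K ⊆ e.source) :
    ∃ C : ℝ, 0 < C ∧ ∀ x ∈ K, ∀ v, nrm g x v ≤ C * ∑ i, |ip g x v (coordField e i x)| := by
  obtain ⟨C, hC, h⟩ := exists_norm_chartD_le g he hK hKe
  refine ⟨C, hC, fun x hx v => ?_⟩
  rcases (nrm_nonneg g x v).eq_or_lt with h0 | h0
  · rw [← h0]; positivity
  have h1 : nrm g x v ^ 2 = ∑ i, chartD e x v i * ip g x v (coordField e i x) := by
    rw [nrm_sq]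
    calc ip g x v v = ip g x v (∑ i, chartD e x v i • coordField e i x) := by
          rw [← eq_sum_coordField he (hKe hx) v]
      _ = _ := by simp only [map_sum, map_smul, smul_eq_mul]
  have h2 : nrm g x v ^ 2 ≤ (C * nrm g x v) * ∑ i, |ip g x v (coordField e i x)| := by
    rw [h1, Finset.mul_sum]
    refine Finset.sum_le_sum fun i _ => (le_abs_self _).trans ?_
    rw [abs_mul]
    gcongr
    exact (PiLp.norm_apply_le (chartD e x v) i).trans (h x hx v)
  nlinarith

end Comparison

section Distance

variable {n : ℕ} {M : Type*} [TopologicalSpace M] [ChartedSpace (Coord n) M]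
  [IsManifold (𝓡 n) ∞ M]

lemma riemDist_self (g : Metric n M) (x : M) : riemDist g x x = 0 := by
  have : IsManifold (𝓡 n) 1 M := .of_le (n := ∞) (by simp)
  let _ : RiemannianBundle (fun x : M => TangentSpace (𝓡 n) x) := ⟨g.toRiemannianMetric⟩
  exact Manifold.riemannianEDist_self

lemma riemDist_comm (g : Metric n M) (x y : M) : riemDist g x y = riemDist g y x := by
  have : IsManifold (𝓡 n) 1 M := .of_le (n := ∞) (by simp)
  let _ : RiemannianBundle (fun x : M => TangentSpace (𝓡 n) x) := ⟨g.toRiemannianMetric⟩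
  exact Manifold.riemannianEDist_comm

lemma riemDist_triangle (g : Metric n M) (x y z : M) :
    riemDist g x z ≤ riemDist g x y + riemDist g y z := by
  have : IsManifold (𝓡 n) 1 M := .of_le (n := ∞) (by simp)
  let _ : RiemannianBundle (fun x : M => TangentSpace (𝓡 n) x) := ⟨g.toRiemannianMetric⟩
  exact Manifold.riemannianEDist_triangle

lemma eventually_riemDist_lt (g : Metric n M) (x : M) {c : ℝ≥0∞} (hc : 0 < c) :
    ∀ᶠ y in 𝓝 x, riemDist g x y < c := by
  have : IsManifold (𝓡 n) 1 M := .of_le (n := ∞) (by simp)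
  let _ : RiemannianBundle (fun x : M => TangentSpace (𝓡 n) x) := ⟨g.toRiemannianMetric⟩
  exact eventually_riemannianEDist_lt (𝓡 n) x hc

lemma exists_riemDist_lt_subset [RegularSpace M] (g : Metric n M) {x : M} {s : Set M}
    (hs : s ∈ 𝓝 x) : ∃ c > 0, {y | riemDist g x y < c} ⊆ s := by
  have : IsManifold (𝓡 n) 1 M := .of_le (n := ∞) (by simp)
  let _ : RiemannianBundle (fun x : M => TangentSpace (𝓡 n) x) := ⟨g.toRiemannianMetric⟩
  exact setOfPred_riemannianEDist_lt_subset_nhds' (𝓡 n) hs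

/-- The points at finite distance from `x` form a clopen set. -/
lemma riemDist_ne_top [PreconnectedSpace M] (g : Metric n M) (x y : M) : riemDist g x y ≠ ⊤ := by
  have hclopen : IsClopen {y | riemDist g x y < ⊤} := by
    constructor
    · rw [← isOpen_compl_iff, isOpen_iff_mem_nhds]
      intro z hz
      filter_upwards [eventually_riemDist_lt g z ENNReal.zero_lt_top] with w hw
      simp only [Set.mem_compl_iff, Set.mem_ofPred_eq, not_lt, top_le_iff] at hz ⊢
      by_contra hne
      have := riemDist_triangle g x w z
      rw [hz, riemDist_comm g w z, top_le_iff] at this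
      exact ENNReal.add_ne_top.2 ⟨hne, hw.ne⟩ this
    · rw [isOpen_iff_mem_nhds]
      intro z hz
      filter_upwards [eventually_riemDist_lt g z ENNReal.zero_lt_top] with w hw
      exact (riemDist_triangle g x z w).trans_lt (ENNReal.add_lt_top.2 ⟨hz, hw⟩)
  have huniv := hclopen.eq_univ ⟨x, by simp [riemDist_self]⟩
  have : y ∈ {y | riemDist g x y < ⊤} := huniv ▸ Set.mem_univ y
  exact ne_of_lt this

/-- Points that are close to a compact set stay in a given neighbourhood of it. -/
lemma exists_uniform_riemDist_subset [RegularSpace M] (g : Metric n M) {K U : Set M}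
    (hK : IsCompact K) (hU : IsOpen U) (hKU : K ⊆ U) :
    ∃ r > 0, ∀ x ∈ K, ∀ y, riemDist g x y < r → y ∈ U := by
  have h : ∀ x ∈ K, ∃ c > 0, {y | riemDist g x y < c} ⊆ U := fun x hx =>
    exists_riemDist_lt_subset g (hU.mem_nhds (hKU hx))
  choose! c hc hcU using h
  obtain ⟨t, htK, ht⟩ := hK.elim_nhds_subcover (fun x => {y | riemDist g x y < c x / 2})
    fun x hx => eventually_riemDist_lt g x (ENNReal.half_pos (hc x hx).ne')
  rcases t.eq_empty_or_nonempty with rfl | hne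
  · refine ⟨1, one_pos, fun x hx => ?_⟩
    have := ht hx
    simp at this
  obtain ⟨x₀, hx₀, hmin⟩ := t.exists_min_image c hne
  refine ⟨c x₀ / 2, ENNReal.half_pos (hc x₀ (htK x₀ hx₀)).ne', fun x hx y hxy => ?_⟩
  obtain ⟨z, hz, hzx⟩ := Set.mem_iUnion₂.1 (ht hx)
  apply hcU z (htK z hz)
  calc riemDist g z y ≤ riemDist g z x + riemDist g x y := riemDist_triangle ..
    _ < c z / 2 + c z / 2 := by
        refine ENNReal.add_lt_add hzx (hxy.trans_le ?_)
        gcongr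
        exact hmin z hz
    _ = c z := ENNReal.add_halves _

lemma enorm_eq_nrm (g : Metric n M) (x : M) (v : Coord n) :
    let _ : RiemannianBundle (fun x : M => TangentSpace (𝓡 n) x) := ⟨g.toRiemannianMetric⟩
    ‖(show TangentSpace (𝓡 n) x from v)‖ₑ = ENNReal.ofReal (nrm g x v) := by
  intro _
  rw [← ofReal_norm, norm_eq_sqrt_real_inner]
  rfl

/-- Charts are Lipschitz on compact sets, with respect to the Riemannian distance: a short path
stays in the chart domain and its image in the chart is short. -/
lemma exists_norm_chart_sub_le [T2Space M] [CompactSpace M] (g : Metric n M)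
    {e : OpenPartialHomeomorph M (Coord n)}
    (he : e ∈ atlas (Coord n) M) {K : Set M} (hK : IsCompact K) (hKe : K ⊆ e.source) :
    ∃ r : ℝ≥0∞, 0 < r ∧ ∃ C : ℝ, 0 < C ∧ ∀ x ∈ K, ∀ y, riemDist g x y < r →
      y ∈ e.source ∧ ENNReal.ofReal ‖e x - e y‖ ≤ ENNReal.ofReal C * riemDist g x y := by
  have hI : IsManifold (𝓡 n) 1 M := .of_le (n := ∞) (by simp)
  obtain ⟨K', hK', hKK', hK'e⟩ := exists_compact_between hK e.open_source hKe
  obtain ⟨r, hr, hrK⟩ := exists_uniform_riemDist_subset g hK isOpen_interior hKK'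
  obtain ⟨C, hC, hCK⟩ := exists_norm_chartD_le g he hK' hK'e
  refine ⟨r, hr, C, hC, fun x hx y hxy => ⟨hK'e (interior_subset (hrK x hx y hxy)), ?_⟩⟩
  have hC0 : ENNReal.ofReal C ≠ 0 := (ENNReal.ofReal_pos.2 hC).ne'
  -- it is enough to bound by any length `L` slightly larger than the distance
  suffices h : ∀ L, riemDist g x y < L → L < r → ENNReal.ofReal ‖e x - e y‖ ≤ ENNReal.ofReal C * L by
    rw [mul_comm, ← ENNReal.div_le_iff_le_mul (Or.inl hC0) (Or.inl ENNReal.ofReal_ne_top)]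
    refine le_of_forall_gt_imp_ge_of_dense fun L hL => ?_
    rw [ENNReal.div_le_iff_le_mul (Or.inl hC0) (Or.inl ENNReal.ofReal_ne_top), mul_comm]
    rcases lt_or_ge L r with hLr | hLr
    · exact h L hL hLr
    · obtain ⟨L', hL', hL'r⟩ := exists_between hxy
      refine (h L' hL' hL'r).trans ?_
      gcongr
      exact hL'r.le.trans hLr
  intro L hL hLr
  let _ : RiemannianBundle (fun x : M => TangentSpace (𝓡 n) x) := ⟨g.toRiemannianMetric⟩
  obtain ⟨γ, hγx, hγy, hγs, hγL, -⟩ :=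
    Manifold.exists_lt_locally_constant_of_riemannianEDist_lt (I := 𝓡 n) (x := x) (y := y) hL zero_lt_one
  have hmem : ∀ t ∈ Set.Icc (0 : ℝ) 1, γ t ∈ K' := by
    intro t ht
    apply interior_subset
    apply hrK x hx
    have h1 : Manifold.riemannianEDist (𝓡 n) x (γ t) ≤ Manifold.pathELength (𝓡 n) γ 0 t :=
      Manifold.riemannianEDist_le_pathELength hγs.contMDiffOn hγx rfl ht.1
    exact (h1.trans (Manifold.pathELength_mono le_rfl ht.2)).trans_lt (hγL.trans hLr)
  have hesm : ContMDiffOn (𝓡 n) (𝓡 n) 1 e e.source :=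
    contMDiffOn_of_mem_maximalAtlas (IsManifold.subset_maximalAtlas he)
  have hcomp : ContMDiffOn 𝓘(ℝ, ℝ) (𝓡 n) 1 (e ∘ γ) (Set.Icc 0 1) :=
    hesm.comp hγs.contMDiffOn fun t ht => hK'e (hmem t ht)
  have h2 : ‖(e ∘ γ) 1 - (e ∘ γ) 0‖ₑ ≤
      ∫⁻ t in Set.Icc (0 : ℝ) 1, ‖derivWithin (e ∘ γ) (Set.Icc 0 1) t‖ₑ :=
    enorm_sub_le_lintegral_derivWithin_Icc_of_contDiffOn_Icc
      (contMDiffOn_iff_contDiffOn.1 hcomp) zero_le_one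
  have h3 : ∫⁻ t in Set.Icc (0 : ℝ) 1, ‖derivWithin (e ∘ γ) (Set.Icc 0 1) t‖ₑ ≤
      ∫⁻ t in Set.Icc (0 : ℝ) 1, ENNReal.ofReal C * ‖mfderivWithin 𝓘(ℝ, ℝ) (𝓡 n) γ (Set.Icc 0 1) t 1‖ₑ := by
    refine setLIntegral_mono' measurableSet_Icc fun t ht => ?_
    have hd : derivWithin (e ∘ γ) (Set.Icc 0 1) t =
        chartD e (γ t) (mfderivWithin 𝓘(ℝ, ℝ) (𝓡 n) γ (Set.Icc 0 1) t 1) := by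
      have h4 : mfderivWithin 𝓘(ℝ, ℝ) (𝓡 n) (e ∘ γ) (Set.Icc 0 1) t =
          (mfderiv (𝓡 n) (𝓡 n) e (γ t)) ∘L (mfderivWithin 𝓘(ℝ, ℝ) (𝓡 n) γ (Set.Icc 0 1) t) := by
        apply mfderiv_comp_mfderivWithin
        · exact (mdifferentiable_of_mem_atlas (I := 𝓡 n) he).mdifferentiableAt (hK'e (hmem t ht))
        · exact (hγs.mdifferentiable one_ne_zero).mdifferentiableOn _ ht
        · rw [uniqueMDiffWithinAt_iff_uniqueDiffWithinAt]
          exact uniqueDiffOn_Icc zero_lt_one _ ht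
      rw [← fderivWithin_derivWithin, ← mfderivWithin_eq_fderivWithin]
      exact congr($h4 1)
    rw [hd]
    have h5 := hCK (γ t) (hmem t ht) (mfderivWithin 𝓘(ℝ, ℝ) (𝓡 n) γ (Set.Icc 0 1) t 1)
    have h6 := enorm_eq_nrm g (γ t) (mfderivWithin 𝓘(ℝ, ℝ) (𝓡 n) γ (Set.Icc 0 1) t 1)
    rw [← ofReal_norm]
    refine (ENNReal.ofReal_le_ofReal h5).trans_eq ?_
    rw [ENNReal.ofReal_mul hC.le]
    congr 1
    exact h6.symm
  have h7 : ∫⁻ t in Set.Icc (0 : ℝ) 1, ENNReal.ofReal C *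
      ‖mfderivWithin 𝓘(ℝ, ℝ) (𝓡 n) γ (Set.Icc 0 1) t 1‖ₑ =
      ENNReal.ofReal C * Manifold.pathELength (𝓡 n) γ 0 1 := by
    rw [lintegral_const_mul' _ _ ENNReal.ofReal_ne_top,
      Manifold.pathELength_eq_lintegral_mfderivWithin_Icc]
  have h8 := (h2.trans h3).trans_eq h7
  have h9 : ENNReal.ofReal ‖e x - e y‖ = ‖(e ∘ γ) 1 - (e ∘ γ) 0‖ₑ := by
    rw [← ofReal_norm, norm_sub_rev]
    simp [hγx, hγy]
  rw [h9]
  refine h8.trans ?_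
  gcongr

end Distance

/-! ### Morrey's inequality -/

section Morrey

variable {n : ℕ}

/-- Integration over the points of the segments from `a`, at a fixed parameter `t`. -/
lemma lintegral_comp_segment {F : Coord n → ℝ≥0∞} (hF : Measurable F) (a : Coord n) {t : ℝ}
    (ht : 0 < t) :
    ∫⁻ z, F (a + t • (z - a)) = ENNReal.ofReal ((t ^ n)⁻¹) * ∫⁻ z, F z := by
  have h1 : ∀ z, F (a + t • (z - a)) = (fun y => F (y + (a - t • a))) (t • z) := by
    intro z
    beta_reduce
    congr 1
    rw [smul_sub]; abel
  simp_rw [h1]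
  rw [← lintegral_map (f := fun y => F (y + (a - t • a))) (g := fun z : Coord n => t • z)
    (by fun_prop) (by fun_prop), Measure.map_addHaar_smul _ ht.ne', lintegral_smul_measure,
    lintegral_add_right_eq_self F]
  simp [abs_of_pos ht]

lemma setLIntegral_comp_segment_le {p : ℝ} (hp : 1 ≤ p) {G : Coord n → ℝ≥0∞} (hG : Measurable G)
    (a : Coord n) {t : ℝ} (ht : 0 < t) (B : Set (Coord n)) :
    ∫⁻ z in B, G (a + t • (z - a)) ≤
      volume B ^ (1 - 1 / p) * (ENNReal.ofReal (t ^ (-(n : ℝ) / p)) * (∫⁻ z, G z ^ p) ^ (1 / p)) := by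
  have hp0 : 0 < p := by linarith
  have h1 := ENNReal.lintegral_mul_norm_pow_le (μ := volume.restrict B)
    (f := fun z => G (a + t • (z - a)) ^ p) (g := fun _ => 1) (p := 1 / p) (q := 1 - 1 / p)
    (by have : Measurable fun z : Coord n => a + t • (z - a) := by fun_prop
        exact ((hG.comp this).pow_const p).aemeasurable) aemeasurable_const (by positivity)
    (by rw [sub_nonneg, div_le_one hp0]; exact hp) (by ring)
  have h2 : ∀ z, (G (a + t • (z - a)) ^ p) ^ (1 / p) * (1 : ℝ≥0∞) ^ (1 - 1 / p) =
      G (a + t • (z - a)) := by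
    intro z
    rw [← ENNReal.rpow_mul, mul_one_div_cancel hp0.ne']
    simp
  simp_rw [h2] at h1
  refine h1.trans ?_
  rw [lintegral_one, Measure.restrict_apply_univ, mul_comm]
  gcongr
  calc (∫⁻ z in B, G (a + t • (z - a)) ^ p) ^ (1 / p)
      ≤ (∫⁻ z, G (a + t • (z - a)) ^ p) ^ (1 / p) := by
        gcongr
        exact Measure.restrict_le_self
    _ = _ := by
        rw [lintegral_comp_segment (hG.pow_const p) a ht,
          ENNReal.mul_rpow_of_nonneg _ _ (by positivity),
          ENNReal.ofReal_rpow_of_nonneg (by positivity) (by positivity)]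
        congr 2
        rw [← Real.rpow_natCast, ← Real.rpow_neg ht.le, ← Real.rpow_mul ht.le]
        congr 1
        ring

lemma lintegral_rpow_Ioo_ne_top {s : ℝ} (hs : -1 < s) :
    ∫⁻ t in Set.Ioo (0 : ℝ) 1, ENNReal.ofReal (t ^ s) ≠ ⊤ := by
  have h := (intervalIntegrable_iff_integrableOn_Ioo_of_le (zero_le_one (α := ℝ))).1
    (intervalIntegral.intervalIntegrable_rpow' (a := 0) (b := 1) hs)
  exact h.lintegral_lt_top.ne

lemma enorm_sub_le_lintegral_segment {v : Coord n → ℝ} (hv : ContDiff ℝ 1 v) (a z : Coord n) :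
    ‖v z - v a‖ₑ ≤ ∫⁻ t in Set.Ioo (0 : ℝ) 1, ‖z - a‖ₑ * ‖fderiv ℝ v (a + t • (z - a))‖ₑ := by
  have h1 : ContDiff ℝ 1 fun t : ℝ => v (a + t • (z - a)) := hv.comp (by fun_prop)
  have h2 := enorm_sub_le_lintegral_deriv_of_contDiffOn_Icc (a := 0) (b := 1) h1.contDiffOn zero_le_one
  simp only [one_smul, zero_smul, add_zero, add_sub_cancel] at h2
  refine h2.trans ?_
  rw [← Measure.restrict_congr_set (Ioo_ae_eq_Icc (μ := volume) (a := (0 : ℝ)) (b := 1))]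
  refine lintegral_mono fun t => ?_
  have h3 : HasDerivAt (fun t : ℝ => a + t • (z - a)) (z - a) t := by
    simpa using ((hasDerivAt_id t).smul_const (z - a)).const_add a
  have h4 : HasDerivAt (fun t : ℝ => v (a + t • (z - a))) (fderiv ℝ v (a + t • (z - a)) (z - a)) t :=
    ((hv.differentiable one_ne_zero _).hasFDerivAt).comp_hasDerivAt t h3
  rw [h4.deriv, mul_comm]
  exact (fderiv ℝ v (a + t • (z - a))).le_opENorm _

/-- Morrey's inequality for `C¹` functions on `ℝⁿ`. -/
lemma exists_morrey {p : ℝ} (hp : 1 ≤ p) (hpn : (n : ℝ) < p) :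
    ∃ C : ℝ≥0∞, C ≠ ⊤ ∧ ∀ v : Coord n → ℝ, ContDiff ℝ 1 v → ∀ a b : Coord n,
      ‖v a - v b‖ₑ ≤ C * ‖a - b‖ₑ ^ ((p - n) / p) * (∫⁻ z, ‖fderiv ℝ v z‖ₑ ^ p) ^ (1 / p) := by
  have hp0 : 0 < p := by linarith
  set T := ∫⁻ t in Set.Ioo (0 : ℝ) 1, ENNReal.ofReal (t ^ (-(n : ℝ) / p)) with hT
  have hTtop : T ≠ ⊤ := lintegral_rpow_Ioo_ne_top (by
    rw [lt_div_iff₀ hp0]; linarith)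
  set β := volume (Metric.ball (0 : Coord n) 1) with hβ
  have hβ0 : β ≠ 0 := (Metric.measure_ball_pos _ _ one_pos).ne'
  have hβt : β ≠ ⊤ := measure_ball_lt_top.ne
  refine ⟨4 * T * β ^ (-(1 / p)), ENNReal.mul_ne_top (ENNReal.mul_ne_top (by simp) hTtop)
    (ENNReal.rpow_ne_top_of_ne_zero hβ0 hβt), fun v hv a b => ?_⟩
  rcases eq_or_ne a b with rfl | hab
  · simp
  set G := (∫⁻ z, ‖fderiv ℝ v z‖ₑ ^ p) ^ (1 / p) with hG
  set R := ‖a - b‖ with hR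
  have hR0 : 0 < R := norm_pos_iff.2 (sub_ne_zero.2 hab)
  set B := Metric.closedBall a R with hB
  have hBvol : volume B = ENNReal.ofReal R ^ (n : ℝ) * β := by
    rw [hB, Measure.addHaar_closedBall _ _ hR0.le, ENNReal.ofReal_pow hR0.le]
    simp [hβ]
  have hB0 : volume B ≠ 0 := by
    rw [hBvol]
    exact mul_ne_zero (ENNReal.rpow_pos (ENNReal.ofReal_pos.2 hR0) ENNReal.ofReal_ne_top).ne' hβ0
  have hBt : volume B ≠ ⊤ := by
    rw [hBvol]
    exact ENNReal.mul_ne_top (ENNReal.rpow_ne_top_of_nonneg (by positivity) ENNReal.ofReal_ne_top) hβt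
  have hGm : Measurable fun z => ‖fderiv ℝ v z‖ₑ :=
    ((hv.continuous_fderiv one_ne_zero).enorm).measurable
  -- the average over `B` of the distance of `v` to its value at a point `c` of `B`
  have key : ∀ c ∈ B, ∫⁻ z in B, ‖v z - v c‖ₑ ≤
      ENNReal.ofReal (2 * R) * (volume B ^ (1 - 1 / p) * (T * G)) := by
    intro c hc
    have h1 : ∀ z ∈ B, ‖v z - v c‖ₑ ≤ ENNReal.ofReal (2 * R) *
        ∫⁻ t in Set.Ioo (0 : ℝ) 1, ‖fderiv ℝ v (c + t • (z - c))‖ₑ := by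
      intro z hz
      refine (enorm_sub_le_lintegral_segment hv c z).trans ?_
      rw [lintegral_const_mul' _ _ enorm_ne_top]
      gcongr
      rw [← ofReal_norm]
      apply ENNReal.ofReal_le_ofReal
      calc ‖z - c‖ = dist z c := (dist_eq_norm _ _).symm
        _ ≤ dist z a + dist a c := dist_triangle _ _ _
        _ ≤ R + R := add_le_add hz (by rw [dist_comm]; exact hc)
        _ = 2 * R := by ring
    have hjoint : Measurable fun q : Coord n × ℝ => ‖fderiv ℝ v (c + q.2 • (q.1 - c))‖ₑ :=
      hGm.comp (by fun_prop : Measurable fun q : Coord n × ℝ => c + q.2 • (q.1 - c))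
    calc ∫⁻ z in B, ‖v z - v c‖ₑ
        ≤ ∫⁻ z in B, ENNReal.ofReal (2 * R) *
          ∫⁻ t in Set.Ioo (0 : ℝ) 1, ‖fderiv ℝ v (c + t • (z - c))‖ₑ :=
          setLIntegral_mono' Metric.isClosed_closedBall.measurableSet h1
      _ = ENNReal.ofReal (2 * R) * ∫⁻ t in Set.Ioo (0 : ℝ) 1, ∫⁻ z in B,
          ‖fderiv ℝ v (c + t • (z - c))‖ₑ := by
          rw [lintegral_const_mul' _ _ ENNReal.ofReal_ne_top,
            lintegral_lintegral_swap hjoint.aemeasurable]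
      _ ≤ ENNReal.ofReal (2 * R) * ∫⁻ t in Set.Ioo (0 : ℝ) 1,
          volume B ^ (1 - 1 / p) * (ENNReal.ofReal (t ^ (-(n : ℝ) / p)) * G) := by
          gcongr _ * ?_
          exact setLIntegral_mono' measurableSet_Ioo fun t ht =>
            setLIntegral_comp_segment_le hp hGm c ht.1 B
      _ = _ := by
          congr 1
          have hm : Measurable fun t : ℝ => ENNReal.ofReal (t ^ (-(n : ℝ) / p)) := by fun_prop
          rw [lintegral_const_mul _ (hm.mul_const _), lintegral_mul_const _ hm]
  have ha : a ∈ B := Metric.mem_closedBall_self hR0.le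
  have hb : b ∈ B := by
    rw [hB, Metric.mem_closedBall, dist_comm, dist_eq_norm]
  have h2 : ‖v a - v b‖ₑ * volume B ≤ ENNReal.ofReal (4 * R) * (volume B ^ (1 - 1 / p) * (T * G)) := by
    calc ‖v a - v b‖ₑ * volume B = ∫⁻ z in B, ‖v a - v b‖ₑ := by rw [setLIntegral_const]
      _ ≤ ∫⁻ z in B, (‖v z - v a‖ₑ + ‖v z - v b‖ₑ) := by
          refine lintegral_mono fun z => ?_
          have : v a - v b = -(v z - v a) + (v z - v b) := by ring
          rw [this]
          exact (enorm_add_le _ _).trans (by rw [enorm_neg])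
      _ = (∫⁻ z in B, ‖v z - v a‖ₑ) + ∫⁻ z in B, ‖v z - v b‖ₑ := by
          rw [lintegral_add_left]
          exact ((hv.continuous.sub continuous_const).enorm).measurable
      _ ≤ _ := by
          refine (add_le_add (key a ha) (key b hb)).trans_eq ?_
          have h4 : ENNReal.ofReal (4 * R) = 2 * ENNReal.ofReal (2 * R) := by
            rw [show 4 * R = 2 * (2 * R) by ring,
              ENNReal.ofReal_mul (p := 2) (q := 2 * R) (by norm_num), ENNReal.ofReal_ofNat]
          rw [← two_mul, ← mul_assoc, h4]
  have h3 : ‖v a - v b‖ₑ ≤ ENNReal.ofReal (4 * R) * (volume B ^ (-(1 / p)) * (T * G)) := by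
    rw [← ENNReal.le_div_iff_mul_le (Or.inl hB0) (Or.inl hBt)] at h2
    refine h2.trans_eq ?_
    rw [sub_eq_add_neg, ENNReal.rpow_add _ _ hB0 hBt, ENNReal.rpow_one, div_eq_mul_inv]
    calc _ = ENNReal.ofReal (4 * R) * (volume B ^ (-(1 / p)) * (T * G)) * (volume B * (volume B)⁻¹) := by
          ring
      _ = _ := by rw [ENNReal.mul_inv_cancel hB0 hBt, mul_one]
  refine h3.trans_eq ?_
  have hRe : ‖a - b‖ₑ = ENNReal.ofReal R := (ofReal_norm _).symm
  have hR1 : ENNReal.ofReal R ≠ 0 := (ENNReal.ofReal_pos.2 hR0).ne'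
  rw [hBvol, hRe, ENNReal.mul_rpow_of_ne_zero (ENNReal.rpow_pos (ENNReal.ofReal_pos.2 hR0)
    ENNReal.ofReal_ne_top).ne' hβ0, ← ENNReal.rpow_mul, ENNReal.ofReal_mul (by norm_num)]
  have hexp : (p - n) / p = 1 + (n : ℝ) * -(1 / p) := by field_simp; ring
  rw [hexp, ENNReal.rpow_add _ _ hR1 ENNReal.ofReal_ne_top, ENNReal.rpow_one]
  simp only [ENNReal.ofReal_ofNat]
  ring

end Morrey

/-! ### Mollification -/

section Mollification

variable {n : ℕ}

/-- The mollification of `u` by the bump function `φ`, normalized to have integral `1`. -/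
def moll (φ : ContDiffBump (0 : Coord n)) (u : Coord n → ℝ) : Coord n → ℝ :=
  convolution (φ.normed volume) u (ContinuousLinearMap.lsmul ℝ ℝ) volume

lemma moll_apply (φ : ContDiffBump (0 : Coord n)) (u : Coord n → ℝ) (x : Coord n) :
    moll φ u x = ∫ t, φ.normed volume t * u (x - t) := rfl

lemma contDiff_moll (φ : ContDiffBump (0 : Coord n)) {u : Coord n → ℝ}
    (hu : LocallyIntegrable u) : ContDiff ℝ ∞ (moll φ u) :=
  HasCompactSupport.contDiff_convolution_left (n := ⊤) _ φ.hasCompactSupport_normed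
    φ.contDiff_normed hu

lemma support_moll_subset (φ : ContDiffBump (0 : Coord n)) (u : Coord n → ℝ) :
    Function.support (moll φ u) ⊆ Metric.thickening φ.rOut (Function.support u) := by
  refine (support_convolution_subset _).trans ?_
  rw [φ.support_normed_eq]
  rintro _ ⟨y, hy, z, hz, rfl⟩
  rw [Metric.mem_thickening_iff]
  refine ⟨z, hz, ?_⟩
  simpa [dist_eq_norm] using hy

lemma dist_moll_le (φ : ContDiffBump (0 : Coord n)) {u : Coord n → ℝ} (hu : Continuous u)
    {ε : ℝ} {x : Coord n} (h : ∀ y, dist y x < φ.rOut → dist (u y) (u x) ≤ ε) :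
    dist (moll φ u x) (u x) ≤ ε :=
  φ.dist_normed_convolution_le hu.aestronglyMeasurable fun y hy => h y hy

lemma moll_congr (φ : ContDiffBump (0 : Coord n)) {u v : Coord n → ℝ} (h : u =ᵐ[volume] v) :
    moll φ u = moll φ v := convolution_congr _ (ae_eq_refl _) h

lemma moll_sub (φ : ContDiffBump (0 : Coord n)) {u v : Coord n → ℝ} (hu : LocallyIntegrable u)
    (hv : LocallyIntegrable v) : moll φ (u - v) = moll φ u - moll φ v := by
  have h : ∀ {w : Coord n → ℝ}, LocallyIntegrable w → ∀ x,
      Integrable fun t => φ.normed volume t * w (x - t) := fun hw x =>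
    φ.hasCompactSupport_normed.convolutionExists_left (ContinuousLinearMap.lsmul ℝ ℝ)
      φ.continuous_normed hw x
  ext x
  simp only [Pi.sub_apply, moll_apply, mul_sub]
  exact integral_sub (h hu x) (h hv x)

/-- The kernel of the mollification has mass `1`. -/
lemma lintegral_enorm_normed (φ : ContDiffBump (0 : Coord n)) :
    ∫⁻ t, ‖φ.normed volume t‖ₑ = 1 := by
  have h1 : ∫⁻ t, ‖φ.normed volume t‖ₑ = ∫⁻ t, ENNReal.ofReal (φ.normed volume t) := by
    refine lintegral_congr fun t => ?_
    rw [← ofReal_norm, Real.norm_of_nonneg (φ.nonneg_normed t)]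
  rw [h1, ← ofReal_integral_eq_lintegral_ofReal φ.integrable_normed
    (Eventually.of_forall φ.nonneg_normed), φ.integral_normed, ENNReal.ofReal_one]

/-- Mollification does not increase `L^p` norms. -/
lemma lintegral_moll_rpow_le (φ : ContDiffBump (0 : Coord n)) {p : ℝ} (hp : 1 ≤ p)
    {w : Coord n → ℝ} (hw : AEStronglyMeasurable w) :
    ∫⁻ x, ‖moll φ w x‖ₑ ^ p ≤ ∫⁻ x, ‖w x‖ₑ ^ p := by
  wlog hm : Measurable w generalizing w
  · have hae := hw.ae_eq_mk
    have h := this hw.stronglyMeasurable_mk.aestronglyMeasurable hw.stronglyMeasurable_mk.measurable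
    rw [moll_congr φ hae]
    refine h.trans_eq (lintegral_congr_ae ?_)
    filter_upwards [hae] with x hx
    rw [hx]
  have hp0 : 0 < p := by linarith
  have hφm : Measurable fun t => ‖φ.normed volume t‖ₑ := φ.continuous_normed.enorm.measurable
  have h1 : ∀ x, ‖moll φ w x‖ₑ ^ p ≤ ∫⁻ t, ‖φ.normed volume t‖ₑ * ‖w (x - t)‖ₑ ^ p := by
    intro x
    have hwm : Measurable fun t => ‖w (x - t)‖ₑ := (hm.comp (by fun_prop)).enorm
    have h2 : ‖moll φ w x‖ₑ ≤ ∫⁻ t, ‖φ.normed volume t‖ₑ * ‖w (x - t)‖ₑ := by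
      refine (enorm_integral_le_lintegral_enorm _).trans_eq ?_
      simp [enorm_mul]
    have h3 := ENNReal.lintegral_mul_norm_pow_le (μ := volume)
      (f := fun t => ‖φ.normed volume t‖ₑ * ‖w (x - t)‖ₑ ^ p) (g := fun t => ‖φ.normed volume t‖ₑ)
      (p := 1 / p) (q := 1 - 1 / p) (hφm.mul (hwm.pow_const p)).aemeasurable hφm.aemeasurable
      (by positivity) (by rw [sub_nonneg, div_le_one hp0]; exact hp) (by ring)
    have h4 : ∀ t, (‖φ.normed volume t‖ₑ * ‖w (x - t)‖ₑ ^ p) ^ (1 / p) *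
        ‖φ.normed volume t‖ₑ ^ (1 - 1 / p) = ‖φ.normed volume t‖ₑ * ‖w (x - t)‖ₑ := by
      intro t
      rw [ENNReal.mul_rpow_of_nonneg _ _ (by positivity), ← ENNReal.rpow_mul,
        mul_one_div_cancel hp0.ne', ENNReal.rpow_one, mul_right_comm,
        ← ENNReal.rpow_add_of_nonneg _ _ (by positivity)
          (by rw [sub_nonneg, div_le_one hp0]; exact hp)]
      simp
    simp_rw [h4] at h3
    rw [lintegral_enorm_normed, ENNReal.one_rpow, mul_one] at h3
    calc ‖moll φ w x‖ₑ ^ p ≤ ((∫⁻ t, ‖φ.normed volume t‖ₑ * ‖w (x - t)‖ₑ ^ p) ^ (1 / p)) ^ p := by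
          gcongr
          exact h2.trans h3
      _ = _ := by rw [← ENNReal.rpow_mul, one_div_mul_cancel hp0.ne', ENNReal.rpow_one]
  have hjoint : Measurable fun q : Coord n × Coord n =>
      ‖φ.normed volume q.2‖ₑ * ‖w (q.1 - q.2)‖ₑ ^ p :=
    (hφm.comp measurable_snd).mul (((hm.comp (by fun_prop :
      Measurable fun q : Coord n × Coord n => q.1 - q.2)).enorm).pow_const p)
  calc ∫⁻ x, ‖moll φ w x‖ₑ ^ p ≤ ∫⁻ x, ∫⁻ t, ‖φ.normed volume t‖ₑ * ‖w (x - t)‖ₑ ^ p :=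
        lintegral_mono h1
    _ = ∫⁻ t, ∫⁻ x, ‖φ.normed volume t‖ₑ * ‖w (x - t)‖ₑ ^ p :=
        lintegral_lintegral_swap hjoint.aemeasurable
    _ = ∫⁻ t, ‖φ.normed volume t‖ₑ * ∫⁻ x, ‖w x‖ₑ ^ p := by
        refine lintegral_congr fun t => ?_
        rw [lintegral_const_mul' _ _ enorm_ne_top,
          lintegral_sub_right_eq_self (fun x => ‖w x‖ₑ ^ p) t]
    _ = _ := by rw [lintegral_mul_const _ hφm, lintegral_enorm_normed, one_mul]

lemma eLpNorm_moll_le (φ : ContDiffBump (0 : Coord n)) {p : ℝ} (hp : 1 ≤ p)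
    {w : Coord n → ℝ} (hw : AEStronglyMeasurable w) :
    eLpNorm (moll φ w) (ENNReal.ofReal p) volume ≤ eLpNorm w (ENNReal.ofReal p) volume := by
  have hp0 : 0 < p := by linarith
  rw [eLpNorm_eq_lintegral_rpow_enorm_toReal (by simpa using hp0) ENNReal.ofReal_ne_top,
    eLpNorm_eq_lintegral_rpow_enorm_toReal (by simpa using hp0) ENNReal.ofReal_ne_top,
    ENNReal.toReal_ofReal hp0.le]
  exact ENNReal.rpow_le_rpow (lintegral_moll_rpow_le φ hp hw) (by positivity)

lemma tendstoUniformly_moll {φ : ℕ → ContDiffBump (0 : Coord n)}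
    (hφ : Tendsto (fun k => (φ k).rOut) atTop (𝓝 0)) {u : Coord n → ℝ} (hu : Continuous u)
    (hc : HasCompactSupport u) {ε : ℝ} (hε : 0 < ε) :
    ∀ᶠ k in atTop, ∀ x, dist (moll (φ k) u x) (u x) ≤ ε := by
  obtain ⟨δ, hδ, h⟩ := Metric.uniformContinuous_iff.1
    (hc.uniformContinuous_of_continuous hu) ε hε
  filter_upwards [hφ.eventually (gt_mem_nhds hδ)] with k hk x
  exact dist_moll_le (φ k) hu fun y hy => (h (hy.trans hk)).le

/-- Mollifications converge in `L^p`. -/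
lemma tendsto_eLpNorm_moll_sub {φ : ℕ → ContDiffBump (0 : Coord n)}
    (hφ : Tendsto (fun k => (φ k).rOut) atTop (𝓝 0)) {p : ℝ} (hp : 1 ≤ p)
    {w : Coord n → ℝ} (hw : MemLp w (ENNReal.ofReal p)) :
    Tendsto (fun k => eLpNorm (moll (φ k) w - w) (ENNReal.ofReal p) volume) atTop (𝓝 0) := by
  have hp1 : 1 ≤ ENNReal.ofReal p := by simpa using hp
  rw [ENNReal.tendsto_nhds_zero]
  intro ε hε
  have hε3 : ε / 3 ≠ 0 := (ENNReal.div_pos hε.ne' (by simp)).ne'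
  obtain ⟨ψ, hψc, hψ, hψcont, hψLp⟩ :=
    hw.exists_hasCompactSupport_eLpNorm_sub_le ENNReal.ofReal_ne_top hε3
  -- all the mollifications of `ψ` are supported in one set of finite measure
  set K := Metric.cthickening 1 (tsupport ψ) with hK
  have hKc : IsCompact K := hψc.isCompact.cthickening
  have hKm : volume K ≠ ⊤ := hKc.measure_lt_top.ne
  obtain ⟨η, hη0, hη⟩ : ∃ η : ℝ, 0 < η ∧
      volume K ^ (ENNReal.ofReal p).toReal⁻¹ * ENNReal.ofReal η ≤ ε / 3 := by
    have h1 : Tendsto (fun η : ℝ => volume K ^ (ENNReal.ofReal p).toReal⁻¹ * ENNReal.ofReal η)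
        (𝓝[>] 0) (𝓝 0) := by
      have h2 : Tendsto (fun η : ℝ => ENNReal.ofReal η) (𝓝[>] 0) (𝓝 0) := by
        have := (ENNReal.continuous_ofReal.tendsto 0).mono_left
          (nhdsWithin_le_nhds (s := Set.Ioi (0 : ℝ)))
        simpa using this
      have h3 := ENNReal.Tendsto.const_mul (a := volume K ^ (ENNReal.ofReal p).toReal⁻¹) h2
        (Or.inr (ENNReal.rpow_ne_top_of_nonneg (by positivity) hKm))
      simpa using h3
    have h4 := h1.eventually (Iic_mem_nhds (pos_iff_ne_zero.2 hε3))
    obtain ⟨η, h5, h6⟩ := (h4.and self_mem_nhdsWithin).exists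
    exact ⟨η, h6, h5⟩
  filter_upwards [tendstoUniformly_moll hφ hψcont hψc hη0, hφ.eventually (gt_mem_nhds one_pos)]
    with k hk hk1
  have hwl : LocallyIntegrable w := hw.locallyIntegrable hp1
  have hψl : LocallyIntegrable ψ := hψcont.locallyIntegrable
  have hdec : moll (φ k) w - w = (moll (φ k) (w - ψ) + (moll (φ k) ψ - ψ)) + (ψ - w) := by
    rw [moll_sub _ hwl hψl]
    abel
  have hm : ∀ {u : Coord n → ℝ}, LocallyIntegrable u → AEStronglyMeasurable (moll (φ k) u) := fun hu =>
    (contDiff_moll (φ k) hu).continuous.aestronglyMeasurable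
  have e1 : eLpNorm (moll (φ k) (w - ψ)) (ENNReal.ofReal p) volume ≤ ε / 3 :=
    (eLpNorm_moll_le (φ k) hp (hw.1.sub hψcont.aestronglyMeasurable)).trans hψ
  have e2 : eLpNorm (moll (φ k) ψ - ψ) (ENNReal.ofReal p) volume ≤ ε / 3 := by
    refine le_trans ?_ hη
    have hsupp : ∀ x, x ∉ K → (moll (φ k) ψ - ψ) x = 0 := by
      intro x hx
      have h1 : x ∉ Function.support ψ := fun h => hx
        (Metric.self_subset_cthickening _ (subset_tsupport _ h))
      have h2 : x ∉ Function.support (moll (φ k) ψ) := fun h => hx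
        (Metric.thickening_subset_cthickening _ _ (Metric.thickening_mono hk1.le _
          (Metric.thickening_subset_of_subset _ (subset_tsupport _) (support_moll_subset _ _ h))))
      rw [Function.notMem_support] at h1 h2
      simp [h1, h2]
    have h3 : eLpNorm (moll (φ k) ψ - ψ) (ENNReal.ofReal p) volume =
        eLpNorm (moll (φ k) ψ - ψ) (ENNReal.ofReal p) (volume.restrict K) := by
      rw [← eLpNorm_indicator_eq_eLpNorm_restrict hKc.isClosed.measurableSet]
      congr 1
      ext x
      by_cases hx : x ∈ K
      · rw [Set.indicator_of_mem hx]
      · rw [Set.indicator_of_notMem hx, hsupp x hx]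
    rw [h3]
    have h4 := eLpNorm_le_of_ae_bound (p := ENNReal.ofReal p) (μ := volume.restrict K)
      (f := moll (φ k) ψ - ψ) (C := η) (Eventually.of_forall fun x => by
        simpa [dist_eq_norm] using hk x)
    rwa [Measure.restrict_apply_univ] at h4
  have e3 : eLpNorm (ψ - w) (ENNReal.ofReal p) volume ≤ ε / 3 := by
    rw [eLpNorm_sub_comm]; exact hψ
  rw [hdec]
  calc _ ≤ eLpNorm (moll (φ k) (w - ψ) + (moll (φ k) ψ - ψ)) (ENNReal.ofReal p) volume +
        eLpNorm (ψ - w) (ENNReal.ofReal p) volume :=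
        eLpNorm_add_le (((hm (hwl.sub hψl))).add ((hm hψl).sub hψcont.aestronglyMeasurable))
          (hψcont.aestronglyMeasurable.sub hw.1) hp1
    _ ≤ (eLpNorm (moll (φ k) (w - ψ)) (ENNReal.ofReal p) volume +
        eLpNorm (moll (φ k) ψ - ψ) (ENNReal.ofReal p) volume) +
        eLpNorm (ψ - w) (ENNReal.ofReal p) volume := by
        gcongr
        exact eLpNorm_add_le (hm (hwl.sub hψl)) ((hm hψl).sub hψcont.aestronglyMeasurable) hp1
    _ ≤ ε / 3 + ε / 3 + ε / 3 := by gcongr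
    _ = ε := ENNReal.add_thirds ε

/-- Mollification commutes with weak differentiation: `w` is the weak derivative of `u` in the
direction `v`. -/
lemma fderiv_moll (φ : ContDiffBump (0 : Coord n)) {u w : Coord n → ℝ} {v : Coord n}
    (hu : LocallyIntegrable u)
    (huw : ∀ ψ : Coord n → ℝ, ContDiff ℝ ∞ ψ → HasCompactSupport ψ →
      ∫ y, u y * fderiv ℝ ψ y v = -∫ y, w y * ψ y) (x : Coord n) :
    fderiv ℝ (moll φ u) x v = moll φ w x := by
  have hcd : ContDiff ℝ ∞ (φ.normed volume) := φ.contDiff_normed (n := ⊤)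
  have h1 := (φ.hasCompactSupport_normed (μ := volume)).hasFDerivAt_convolution_left (𝕜 := ℝ)
    (μ := volume) (ContinuousLinearMap.lsmul ℝ ℝ) (φ.contDiff_normed (n := 1)) hu x
  have hint : Integrable fun t => (ContinuousLinearMap.precompL (Coord n)
      (ContinuousLinearMap.lsmul ℝ ℝ)) (fderiv ℝ (φ.normed volume) t) (u (x - t)) :=
    (φ.hasCompactSupport_normed.fderiv ℝ).convolutionExists_left _
      (hcd.continuous_fderiv (by simp)) hu x
  rw [show fderiv ℝ (moll φ u) x = _ from h1.fderiv, convolution_def,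
    ContinuousLinearMap.integral_apply hint]
  simp only [ContinuousLinearMap.precompL_apply, ContinuousLinearMap.lsmul_apply, smul_eq_mul]
  -- test the weak derivative against a reflected and translated bump function
  have h2 := huw (fun s => φ.normed volume (x - s)) (hcd.comp (by fun_prop))
    (φ.hasCompactSupport_normed.comp_homeomorph (Homeomorph.subLeft x))
  have h3 : ∀ s, fderiv ℝ (fun s => φ.normed volume (x - s)) s v =
      -(fderiv ℝ (φ.normed volume) (x - s) v) := by
    intro s
    have h4 := ((hcd.differentiable (by simp) (x - s)).hasFDerivAt).comp s
      ((hasFDerivAt_id s).const_sub x)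
    rw [show fderiv ℝ (fun s => φ.normed volume (x - s)) s = _ from h4.fderiv]
    simp
  simp only [h3, mul_neg, integral_neg, neg_inj] at h2
  rw [moll_apply, ← integral_sub_left_eq_self (fun t => fderiv ℝ (φ.normed volume) t v * u (x - t)) volume x,
    ← integral_sub_left_eq_self (fun t => φ.normed volume t * w (x - t)) volume x]
  simp only [sub_sub_cancel]
  simp only [mul_comm _ (u _), mul_comm _ (w _)]
  exact h2

end Mollification

/-! ### Approximation of Sobolev functions on Euclidean space -/

section EuclideanApproximation

variable {n : ℕ}

/-- A sequence of bump functions shrinking to the origin. -/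
def shrinkingBump (n k : ℕ) : ContDiffBump (0 : Coord n) where
  rIn := 1 / (2 * ((k : ℝ) + 1))
  rOut := 1 / ((k : ℝ) + 1)
  rIn_pos := by positivity
  rIn_lt_rOut := by
    apply one_div_lt_one_div_of_lt (by positivity)
    have : (0 : ℝ) < (k : ℝ) + 1 := by positivity
    linarith

lemma tendsto_shrinkingBump (n : ℕ) :
    Tendsto (fun k => (shrinkingBump n k).rOut) atTop (𝓝 0) :=
  tendsto_one_div_add_atTop_nhds_zero_nat

lemma enorm_clm_le_sum (L : Coord n →L[ℝ] ℝ) :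
    ‖L‖ₑ ≤ ∑ i, ‖L (EuclideanSpace.single i (1 : ℝ))‖ₑ := by
  have h1 : ‖L‖ ≤ ∑ i, ‖L (EuclideanSpace.single i (1 : ℝ))‖ := by
    refine L.opNorm_le_bound (Finset.sum_nonneg fun _ _ => norm_nonneg _) fun x => ?_
    have hx : x = ∑ i, x i • EuclideanSpace.single i (1 : ℝ) := by
      ext j
      simp [Finset.sum_apply, Pi.single_apply]
    conv_lhs => rw [hx]
    rw [map_sum, Finset.sum_mul]
    refine (norm_sum_le _ _).trans (Finset.sum_le_sum fun i _ => ?_)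
    rw [map_smul, norm_smul, mul_comm]
    gcongr
    exact PiLp.norm_apply_le x i
  rw [← ofReal_norm]
  refine (ENNReal.ofReal_le_ofReal h1).trans_eq ?_
  rw [ENNReal.ofReal_sum_of_nonneg fun _ _ => norm_nonneg _]
  exact Finset.sum_congr rfl fun i _ => ofReal_norm _

/-- Approximation of a compactly supported Sobolev function by its mollifications: uniformly, in
`W^{1,p}`, and, by Morrey's inequality, in the Hölder seminorm of exponent `1 - n / p`. -/
lemma exists_contDiff_approx {p : ℝ} (hp : 1 ≤ p) (hpn : (n : ℝ) < p) {u : Coord n → ℝ}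
    (hu : Continuous u) (hc : HasCompactSupport u) {U : Set (Coord n)} (hU : IsOpen U)
    (hsub : tsupport u ⊆ U) {w : Fin n → Coord n → ℝ}
    (hw : ∀ i, MemLp (w i) (ENNReal.ofReal p))
    (hweak : ∀ i, ∀ ψ : Coord n → ℝ, ContDiff ℝ ∞ ψ → HasCompactSupport ψ →
      ∫ y, u y * fderiv ℝ ψ y (EuclideanSpace.single i (1 : ℝ)) = -∫ y, w i y * ψ y)
    {ε : ℝ} (hε : 0 < ε) :
    ∃ v : Coord n → ℝ, ContDiff ℝ ∞ v ∧ HasCompactSupport v ∧ tsupport v ⊆ U ∧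
      (∀ x, |v x - u x| ≤ ε) ∧
      (∀ i, eLpNorm (fun y => fderiv ℝ v y (EuclideanSpace.single i (1 : ℝ)) - w i y)
        (ENNReal.ofReal p) volume ≤ ENNReal.ofReal ε) ∧
      ∀ a b, ‖(v a - u a) - (v b - u b)‖ₑ ≤ ENNReal.ofReal ε * ‖a - b‖ₑ ^ ((p - n) / p) := by
  have hp0 : 0 < p := by linarith
  have hp1 : 1 ≤ ENNReal.ofReal p := by simpa using hp
  set φ := shrinkingBump n
  have hφ : Tendsto (fun k => (φ k).rOut) atTop (𝓝 0) := tendsto_shrinkingBump n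
  have hul : LocallyIntegrable u := hu.locallyIntegrable
  have hwl : ∀ i, LocallyIntegrable (w i) := fun i => (hw i).locallyIntegrable hp1
  have hv : ∀ k, ContDiff ℝ ∞ (moll (φ k) u) := fun k => contDiff_moll _ hul
  have hdv : ∀ k i y, fderiv ℝ (moll (φ k) u) y (EuclideanSpace.single i (1 : ℝ)) =
      moll (φ k) (w i) y := fun k i y => fderiv_moll _ hul (hweak i) y
  obtain ⟨C, hC, hM⟩ := exists_morrey (n := n) hp hpn
  obtain ⟨η, hη0, hηε, hη⟩ : ∃ η : ℝ≥0∞, 0 < η ∧ η ≤ ENNReal.ofReal ε ∧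
      C * (∑ _i : Fin n, (η + η)) ≤ ENNReal.ofReal ε := by
    have h1 : Tendsto (fun η : ℝ≥0∞ => C * (∑ _i : Fin n, (η + η))) (𝓝[>] 0) (𝓝 0) := by
      have h0 : Tendsto (fun η : ℝ≥0∞ => ∑ _i : Fin n, (η + η)) (𝓝[>] 0) (𝓝 0) := by
        have : Continuous fun η : ℝ≥0∞ => ∑ _i : Fin n, (η + η) := by fun_prop
        have h2 := (this.tendsto 0).mono_left (nhdsWithin_le_nhds (s := Set.Ioi (0 : ℝ≥0∞)))
        simpa using h2
      simpa using ENNReal.Tendsto.const_mul h0 (Or.inr hC)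
    have hε' : 0 < ENNReal.ofReal ε := ENNReal.ofReal_pos.2 hε
    have h4 := h1.eventually (Iic_mem_nhds hε')
    have h5 : ∀ᶠ η in 𝓝[>] (0 : ℝ≥0∞), η ≤ ENNReal.ofReal ε :=
      (nhdsWithin_le_nhds (s := Set.Ioi (0 : ℝ≥0∞))) (Iic_mem_nhds hε')
    obtain ⟨η, h6, h7, h8⟩ := (h4.and (h5.and self_mem_nhdsWithin)).exists
    exact ⟨η, h8, h7, h6⟩
  have hLp : ∀ᶠ k in atTop, ∀ i, eLpNorm (moll (φ k) (w i) - w i) (ENNReal.ofReal p) volume ≤ η :=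
    eventually_all.2 fun i =>
      (tendsto_eLpNorm_moll_sub hφ hp (hw i)).eventually (Iic_mem_nhds hη0)
  obtain ⟨δ, hδ0, hδ⟩ := hc.isCompact.exists_cthickening_subset_open hU hsub
  obtain ⟨k, hk1, hk2, hk3⟩ := (hLp.and ((tendstoUniformly_moll hφ hu hc hε).and
    (hφ.eventually (gt_mem_nhds hδ0)))).exists
  have hsupp : tsupport (moll (φ k) u) ⊆ Metric.cthickening δ (tsupport u) := by
    refine closure_minimal ?_ Metric.isClosed_cthickening
    refine (support_moll_subset _ _).trans ?_
    exact (Metric.thickening_mono hk3.le _).trans ((Metric.thickening_subset_of_subset _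
      (subset_tsupport _)).trans (Metric.thickening_subset_cthickening _ _))
  refine ⟨moll (φ k) u, hv k, hc.isCompact.cthickening.of_isClosed_subset (isClosed_tsupport _) hsupp,
    hsupp.trans hδ, fun x => by simpa [Real.dist_eq] using hk2 x, fun i => ?_, fun a b => ?_⟩
  · simp only [hdv]
    exact (hk1 i).trans hηε
  · -- Morrey's inequality for the difference of two mollifications
    have h1 : ∀ᶠ l in atTop, ‖(moll (φ k) u a - moll (φ l) u a) -
        (moll (φ k) u b - moll (φ l) u b)‖ₑ ≤ ENNReal.ofReal ε * ‖a - b‖ₑ ^ ((p - n) / p) := by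
      filter_upwards [hLp] with l hl
      have h2 := hM (moll (φ k) u - moll (φ l) u) (((hv k).sub (hv l)).of_le (by exact_mod_cast le_top)) a b
      simp only [Pi.sub_apply] at h2
      refine h2.trans ?_
      have h3 : (∫⁻ z, ‖fderiv ℝ (moll (φ k) u - moll (φ l) u) z‖ₑ ^ p) ^ (1 / p) ≤
          ∑ _i : Fin n, (η + η) := by
        have h4 : ∀ z, ‖fderiv ℝ (moll (φ k) u - moll (φ l) u) z‖ₑ ≤
            ‖∑ i, ‖(moll (φ k) (w i) - moll (φ l) (w i)) z‖‖ₑ := by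
          intro z
          refine (enorm_clm_le_sum _).trans_eq ?_
          rw [← ofReal_norm, Real.norm_of_nonneg (Finset.sum_nonneg fun _ _ => norm_nonneg _),
            ENNReal.ofReal_sum_of_nonneg fun _ _ => norm_nonneg _]
          refine Finset.sum_congr rfl fun i _ => ?_
          rw [fderiv_sub ((hv k).differentiable (by simp) z) ((hv l).differentiable (by simp) z),
            ofReal_norm]
          simp [hdv]
        have hm : ∀ l i, AEStronglyMeasurable (moll (φ l) (w i)) := fun l i =>
          (contDiff_moll _ (hwl i)).continuous.aestronglyMeasurable
        calc (∫⁻ z, ‖fderiv ℝ (moll (φ k) u - moll (φ l) u) z‖ₑ ^ p) ^ (1 / p)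
            = eLpNorm (fderiv ℝ (moll (φ k) u - moll (φ l) u)) (ENNReal.ofReal p) volume := by
              rw [eLpNorm_eq_lintegral_rpow_enorm_toReal (by simpa using hp0) ENNReal.ofReal_ne_top,
                ENNReal.toReal_ofReal hp0.le]
          _ ≤ eLpNorm (∑ i, fun z => ‖(moll (φ k) (w i) - moll (φ l) (w i)) z‖)
              (ENNReal.ofReal p) volume := by
              refine eLpNorm_mono_enorm fun z => ?_
              simpa using h4 z
          _ ≤ ∑ i, eLpNorm (fun z => ‖(moll (φ k) (w i) - moll (φ l) (w i)) z‖)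
              (ENNReal.ofReal p) volume :=
              eLpNorm_sum_le (fun i _ => ((hm k i).sub (hm l i)).norm) hp1
          _ ≤ ∑ _i : Fin n, (η + η) := by
              refine Finset.sum_le_sum fun i _ => ?_
              rw [eLpNorm_norm]
              have h5 : moll (φ k) (w i) - moll (φ l) (w i) =
                  (moll (φ k) (w i) - w i) - (moll (φ l) (w i) - w i) := by abel
              rw [h5]
              refine (eLpNorm_sub_le ((hm k i).sub (hw i).1) ((hm l i).sub (hw i).1) hp1).trans ?_
              exact add_le_add (hk1 i) (hl i)
      calc _ ≤ C * ‖a - b‖ₑ ^ ((p - n) / p) * ∑ _i : Fin n, (η + η) := by gcongr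
        _ = (C * ∑ _i : Fin n, (η + η)) * ‖a - b‖ₑ ^ ((p - n) / p) := by ring
        _ ≤ _ := by gcongr
    have hlim : ∀ x, Tendsto (fun l => moll (φ l) u x) atTop (𝓝 (u x)) := by
      intro x
      rw [Metric.tendsto_nhds]
      intro r hr
      filter_upwards [tendstoUniformly_moll hφ hu hc (half_pos hr)] with l hl
      exact (hl x).trans_lt (half_lt_self hr)
    refine le_of_tendsto ?_ h1
    exact (((tendsto_const_nhds.sub (hlim a)).sub (tendsto_const_nhds.sub (hlim b)))).enorm

end EuclideanApproximation

/-! ### Gradients and measurable vector fields -/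

section Fields

variable {n : ℕ} {M : Type*} [TopologicalSpace M] [ChartedSpace (Coord n) M]
  [IsManifold (𝓡 n) ∞ M]

/-- The contravariant components of a vector in terms of its covariant components. -/
lemma chartD_apply_eq (g : Metric n M) {e : OpenPartialHomeomorph M (Coord n)}
    (he : e ∈ atlas (Coord n) M) {x : M} (hx : x ∈ e.source) (u : Coord n) (k : Fin n) :
    chartD e x u k = ∑ i, ip g x u (coordField e i x) * (gmat g e x)⁻¹ i k := by
  have hdet : IsUnit (gmat g e x).det := (gmat_det_ne_zero g he hx).isUnit
  have h1 : (fun i => ip g x u (coordField e i x)) =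
      Matrix.vecMul (fun k => chartD e x u k) (gmat g e x) := by
    ext i
    conv_lhs => rw [eq_sum_coordField he hx u]
    simp [Matrix.vecMul, dotProduct, gmat]
  have h2 : (fun k => chartD e x u k) =
      Matrix.vecMul (fun i => ip g x u (coordField e i x)) (gmat g e x)⁻¹ := by
    rw [h1, Matrix.vecMul_vecMul, Matrix.mul_nonsing_inv _ hdet, Matrix.vecMul_one]
  exact congrFun h2 k

/-- The inner product of two vectors in terms of their covariant components. -/
lemma ip_eq_sum_inv (g : Metric n M) {e : OpenPartialHomeomorph M (Coord n)}
    (he : e ∈ atlas (Coord n) M) {x : M} (hx : x ∈ e.source) (v w : Coord n) :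
    ip g x v w = ∑ i, ∑ j, ip g x v (coordField e i x) * (gmat g e x)⁻¹ i j *
      ip g x w (coordField e j x) := by
  have h3 : ip g x v w = ∑ j, chartD e x v j * ip g x w (coordField e j x) := by
    conv_lhs => rw [eq_sum_coordField he hx v]
    simp only [map_sum, map_smul, ContinuousLinearMap.sum_apply, smul_apply, smul_eq_mul]
    exact Finset.sum_congr rfl fun j _ => by rw [ip_symm]
  rw [h3, Finset.sum_comm]
  refine Finset.sum_congr rfl fun j _ => ?_
  rw [← Finset.sum_mul, ← chartD_apply_eq g he hx]

/-- The differential of a function, as a linear form on the model space. -/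
def dmf (h : M → ℝ) (x : M) : Coord n →L[ℝ] ℝ := mfderiv (𝓡 n) 𝓘(ℝ, ℝ) h x

/-- The gradient of a function with respect to `g`. -/
def grad (g : Metric n M) (h : M → ℝ) (x : M) : Coord n := sharp g x (dmf h x)

lemma ip_grad (g : Metric n M) (h : M → ℝ) (x : M) (w : Coord n) :
    ip g x (grad g h x) w = dmf h x w := ip_sharp _ _ _ _

lemma ip_grad_coordField (g : Metric n M) {e : OpenPartialHomeomorph M (Coord n)}
    (he : e ∈ atlas (Coord n) M) {h : M → ℝ} {y : Coord n} (hy : y ∈ e.target)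
    (hh : MDifferentiableAt (𝓡 n) 𝓘(ℝ, ℝ) h (e.symm y)) (i : Fin n) :
    ip g (e.symm y) (grad g h (e.symm y)) (coordField e i (e.symm y)) =
      fderiv ℝ (fun z => h (e.symm z)) y (EuclideanSpace.single i (1 : ℝ)) := by
  have : IsManifold (𝓡 n) 1 M := .of_le (n := ∞) (by simp)
  have h1 := ((mdifferentiable_of_mem_atlas (I := 𝓡 n) he).mdifferentiableAt_symm hy).hasMFDerivAt
  have h2 : HasFDerivAt (fun z => h (e.symm z)) ((dmf h (e.symm y)).comp (symmD e y)) y :=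
    (hh.hasMFDerivAt.comp y h1).hasFDerivAt
  rw [h2.fderiv, ip_grad, ← coordVec_eq e i hy]
  rfl

lemma contDiffOn_comp_symm {e : OpenPartialHomeomorph M (Coord n)}
    (he : e ∈ atlas (Coord n) M) {k : WithTop ℕ∞} (hk : k ≤ ((⊤ : ℕ∞) : WithTop ℕ∞)) {h : M → ℝ}
    (hh : ContMDiff (𝓡 n) 𝓘(ℝ, ℝ) k h) : ContDiffOn ℝ k (fun z => h (e.symm z)) e.target := by
  have : IsManifold (𝓡 n) k M := .of_le (n := ∞) hk
  have h1 : ContMDiffOn (𝓡 n) (𝓡 n) k e.symm e.target :=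
    contMDiffOn_symm_of_mem_maximalAtlas (IsManifold.subset_maximalAtlas he)
  exact (hh.comp_contMDiffOn h1).contDiffOn

lemma continuousOn_ip_grad_coordField (g : Metric n M) {e : OpenPartialHomeomorph M (Coord n)}
    (he : e ∈ atlas (Coord n) M) {h : M → ℝ} (hh : ContMDiff (𝓡 n) 𝓘(ℝ, ℝ) 1 h) (i : Fin n) :
    ContinuousOn (fun x => ip g x (grad g h x) (coordField e i x)) e.source := by
  have h1 : ContinuousOn (fun y => fderiv ℝ (fun z => h (e.symm z)) y) e.target :=
    (contDiffOn_comp_symm he (by exact_mod_cast le_top) hh).continuousOn_fderiv_of_isOpen e.open_target le_rfl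
  have h2 : ContinuousOn (fun x => fderiv ℝ (fun z => h (e.symm z)) (e x)
      (EuclideanSpace.single i (1 : ℝ))) e.source :=
    (h1.comp e.continuousOn e.mapsTo).clm_apply continuousOn_const
  refine h2.congr fun x hx => ?_
  have h3 := ip_grad_coordField g he (e.map_source hx) (h := h)
    (hh.mdifferentiable one_ne_zero _) i
  rwa [e.left_inv hx] at h3

lemma grad_eq (g : Metric n M) {h : M → ℝ} {x : M} {L : Coord n →L[ℝ] ℝ}
    (hL : HasMFDerivAt (𝓡 n) 𝓘(ℝ, ℝ) h x L) {v : Coord n} (hv : ∀ w, ip g x v w = L w) :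
    grad g h x = v := by
  refine eq_of_ip_eq g x fun w => ?_
  rw [ip_grad, hv]
  exact congrArg (fun T : Coord n →L[ℝ] ℝ => T w) hL.mfderiv

lemma grad_add (g : Metric n M) {h h' : M → ℝ} {x : M}
    (hh : MDifferentiableAt (𝓡 n) 𝓘(ℝ, ℝ) h x) (hh' : MDifferentiableAt (𝓡 n) 𝓘(ℝ, ℝ) h' x) :
    grad g (fun z => h z + h' z) x = grad g h x + grad g h' x := by
  refine grad_eq g (hh.hasMFDerivAt.add hh'.hasMFDerivAt) fun w => ?_
  rw [map_add, add_apply, ip_grad, ip_grad]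
  rfl

lemma grad_const (g : Metric n M) (c : ℝ) (x : M) : grad g (fun _ : M => c) x = 0 :=
  grad_eq g (hasMFDerivAt_const c x) fun w => by
    rw [map_zero]
    rfl

lemma grad_sum (g : Metric n M) {ι : Type*} (s : Finset ι) {h : ι → M → ℝ}
    (hh : ∀ k ∈ s, ContMDiff (𝓡 n) 𝓘(ℝ, ℝ) 1 (h k)) (x : M) :
    grad g (fun z => ∑ k ∈ s, h k z) x = ∑ k ∈ s, grad g (h k) x := by
  classical
  induction s using Finset.induction_on with
  | empty => simpa using grad_const g 0 x
  | insert a s ha ih =>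
    simp only [Finset.sum_insert ha]
    have h1 : ContMDiff (𝓡 n) 𝓘(ℝ, ℝ) 1 fun z => ∑ k ∈ s, h k z :=
      contMDiff_finsetSum fun k hk => hh k (Finset.mem_insert_of_mem hk)
    rw [grad_add g ((hh a (Finset.mem_insert_self _ _)).mdifferentiable one_ne_zero x)
      (h1.mdifferentiable one_ne_zero x), ih fun k hk => hh k (Finset.mem_insert_of_mem hk)]

lemma grad_const_smul (g : Metric n M) (c : ℝ) {h : M → ℝ} {x : M}
    (hh : MDifferentiableAt (𝓡 n) 𝓘(ℝ, ℝ) h x) :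
    grad g (fun z => c * h z) x = c • grad g h x := by
  refine grad_eq g (hh.hasMFDerivAt.const_smul c) fun w => ?_
  rw [map_smul, smul_apply, ip_grad]
  rfl

end Fields

section MeasurableFields

variable {n : ℕ} {M : Type*} [TopologicalSpace M] [ChartedSpace (Coord n) M]
  [IsManifold (𝓡 n) ∞ M] [MeasurableSpace M] [BorelSpace M]

/-- Almost everywhere measurability of a vector field, expressed through its covariant components
in the charts of the atlas, which are the functions that `IsWeakGradient` speaks of. -/
def MeasField (g : Metric n M) (X : M → Coord n) : Prop :=
  ∀ e ∈ atlas (Coord n) M, ∀ i,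
    AEMeasurable (fun x => ip g x (X x) (coordField e i x)) ((vol g).restrict e.source)

lemma MeasField.add {g : Metric n M} {X Y : M → Coord n} (hX : MeasField g X)
    (hY : MeasField g Y) : MeasField g (fun x => X x + Y x) := fun e he i => by
  simp only [map_add, add_apply]
  exact (hX e he i).add (hY e he i)

lemma MeasField.sub {g : Metric n M} {X Y : M → Coord n} (hX : MeasField g X)
    (hY : MeasField g Y) : MeasField g (fun x => X x - Y x) := fun e he i => by
  simp only [map_sub, sub_apply]
  exact (hX e he i).sub (hY e he i)

lemma MeasField.smul {g : Metric n M} {X : M → Coord n} {c : M → ℝ}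
    (hc : AEMeasurable c (vol g)) (hX : MeasField g X) :
    MeasField g (fun x => c x • X x) := fun e he i => by
  simp only [map_smul, smul_apply, smul_eq_mul]
  exact hc.restrict.mul (hX e he i)

lemma measField_grad (g : Metric n M) {h : M → ℝ} (hh : ContMDiff (𝓡 n) 𝓘(ℝ, ℝ) 1 h) :
    MeasField g (grad g h) := fun _ he i =>
  (continuousOn_ip_grad_coordField g he hh i).aemeasurable (OpenPartialHomeomorph.open_source _).measurableSet

variable [CompactSpace M] [Nonempty M]

lemma MeasField.ip {g : Metric n M} {X Y : M → Coord n} (hX : MeasField g X)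
    (hY : MeasField g Y) : AEMeasurable (fun x => ip g x (X x) (Y x)) (vol g) := by
  refine aemeasurable_of_charts g fun e he => ?_
  have h1 : AEMeasurable (fun x => ∑ i, ∑ j, ModifiedDp.ip g x (X x) (coordField e i x) *
      (gmat g e x)⁻¹ i j * ModifiedDp.ip g x (Y x) (coordField e j x)) ((vol g).restrict e.source) := by
    refine Finset.aemeasurable_fun_sum _ fun i _ => Finset.aemeasurable_fun_sum _ fun j _ => ?_
    refine ((hX e he i).mul ?_).mul (hY e he j)
    have h2 := continuousOn_gmat_inv g he
    exact (continuousOn_pi.1 (continuousOn_pi.1 h2 i) j).aemeasurable e.open_source.measurableSet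
  refine h1.congr ?_
  filter_upwards [ae_restrict_mem e.open_source.measurableSet] with x hx
  rw [ip_eq_sum_inv g he hx]

lemma MeasField.nrm {g : Metric n M} {X : M → Coord n} (hX : MeasField g X) :
    AEMeasurable (fun x => nrm g x (X x)) (vol g) := (hX.ip hX).sqrt

lemma measField_of_isWeakGradient {g : Metric n M} {f : M → ℝ} {V : M → Coord n}
    (hV : IsWeakGradient g f V) : MeasField g V := by
  intro e he i
  refine aemeasurable_of_comp_symm_restrict g he ?_
  have h := ((hV e he).2 i).1.aestronglyMeasurable.aemeasurable
  refine h.congr ?_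
  filter_upwards [ae_restrict_mem e.open_target.measurableSet] with y hy
  rw [← coordVec_eq e i hy]
  rfl

/-- A `C¹` function is weakly differentiable, and its gradient is its weak gradient. -/
lemma isWeakGradient_grad (g : Metric n M) {h : M → ℝ} (hh : ContMDiff (𝓡 n) 𝓘(ℝ, ℝ) 1 h) :
    IsWeakGradient g h (grad g h) := by
  intro e he
  have hcd := contDiffOn_comp_symm he (by exact_mod_cast le_top) hh
  have hcomp : ∀ i, ∀ y ∈ e.target,
      g.inner (e.symm y) (grad g h (e.symm y)) (coordVec e i y) =
        fderiv ℝ (fun z => h (e.symm z)) y (EuclideanSpace.single i (1 : ℝ)) := by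
    intro i y hy
    rw [← ip_grad_coordField g he hy (hh.mdifferentiable one_ne_zero _) i, ← coordVec_eq e i hy]
    rfl
  have hcf : ∀ i, ContinuousOn (fun y => fderiv ℝ (fun z => h (e.symm z)) y
      (EuclideanSpace.single i (1 : ℝ))) e.target := fun i =>
    (hcd.continuousOn_fderiv_of_isOpen e.open_target le_rfl).clm_apply continuousOn_const
  refine ⟨hcd.continuousOn.locallyIntegrableOn e.open_target.measurableSet, fun i => ⟨?_, ?_⟩⟩
  · exact ((hcf i).congr (hcomp i)).locallyIntegrableOn e.open_target.measurableSet
  · intro φ hφ hφc hφs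
    have hint : ∀ {F ψ : Coord n → ℝ}, ContinuousOn F e.target → Continuous ψ →
        tsupport ψ ⊆ tsupport φ → Integrable fun y => F y * ψ y := by
      intro F ψ hF hψ hs
      have h1 : IsCompact (tsupport φ) := hφc
      have h2 : IntegrableOn (fun y => F y * ψ y) (tsupport φ) :=
        ((hF.mono hφs).mul hψ.continuousOn).integrableOn_compact h1
      refine (integrableOn_iff_integrable_of_support_subset ?_).1 h2
      exact (Function.support_mul_subset_right _ _).trans ((subset_tsupport _).trans hs)
    rw [integral_mul_fderiv_eq_neg_fderiv_mul_of_integrable]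
    · congr 1
      refine integral_congr_ae (Eventually.of_forall fun y => ?_)
      by_cases hy : y ∈ e.target
      · simp only [hcomp i y hy]
      · simp [image_eq_zero_of_notMem_tsupport (fun h => hy (hφs h))]
    · exact hint (hcf i) hφ.continuous subset_rfl
    · exact hint hcd.continuousOn ((hφ.continuous_fderiv (by simp)).clm_apply continuous_const)
        (tsupport_fderiv_apply_subset ℝ _)
    · exact hint hcd.continuousOn hφ.continuous subset_rfl
    · exact fun y hy => (hcd.differentiableOn one_ne_zero).differentiableAt
        (e.open_target.mem_nhds (hφs hy))
    · exact fun y _ => hφ.differentiable (by simp) y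

end MeasurableFields

/-! ### Transfer of functions and integrals between charts and the manifold -/

section ExtensionByZero

variable {n : ℕ}

/-- A `Cᵏ` function on `U` that vanishes outside of a closed set `K ⊆ U` can be extended
by zero. -/
lemma contDiff_indicator {F : Coord n → ℝ} {k : WithTop ℕ∞} {U K : Set (Coord n)} (hU : IsOpen U)
    (hK : IsClosed K) (hKU : K ⊆ U) (hF : ContDiffOn ℝ k F U) (h0 : ∀ y ∈ U, y ∉ K → F y = 0) :
    ContDiff ℝ k (U.indicator F) := by
  refine contDiff_iff_contDiffAt.2 fun y => ?_
  by_cases hy : y ∈ U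
  · refine (hF.contDiffAt (hU.mem_nhds hy)).congr_of_eventuallyEq ?_
    filter_upwards [hU.mem_nhds hy] with z hz
    exact Set.indicator_of_mem hz _
  · refine (contDiffAt_const (c := (0 : ℝ))).congr_of_eventuallyEq ?_
    filter_upwards [hK.isOpen_compl.mem_nhds fun h => hy (hKU h)] with z hz
    by_cases hzU : z ∈ U
    · rw [Set.indicator_of_mem hzU, h0 z hzU hz]
    · exact Set.indicator_of_notMem hzU _

lemma tsupport_indicator_subset {F : Coord n → ℝ} {U K : Set (Coord n)} (hK : IsClosed K)
    (h0 : ∀ y ∈ U, y ∉ K → F y = 0) : tsupport (U.indicator F) ⊆ K := by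
  refine closure_minimal (fun y hy => ?_) hK
  by_contra hyK
  refine hy ?_
  by_cases hyU : y ∈ U
  · rw [Set.indicator_of_mem hyU, h0 y hyU hyK]
  · exact Set.indicator_of_notMem hyU _

lemma integrable_mul_of_locallyIntegrableOn {F ψ : Coord n → ℝ} {U K : Set (Coord n)}
    (hF : LocallyIntegrableOn F U) (hK : IsCompact K) (hKU : K ⊆ U) (hψ : Continuous ψ)
    (h0 : ∀ y ∉ K, ψ y = 0) : Integrable fun y => F y * ψ y := by
  have h1 : IntegrableOn F K := hF.integrableOn_compact_subset hKU hK
  have h2 : IntegrableOn (fun y => F y * ψ y) K := h1.mul_continuousOn hψ.continuousOn hK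
  refine (integrableOn_iff_integrable_of_support_subset fun y hy => ?_).1 h2
  by_contra hyK
  exact hy (by simp [h0 y hyK])

variable {M : Type*} [TopologicalSpace M] [ChartedSpace (Coord n) M] [IsManifold (𝓡 n) ∞ M]

/-- A `C¹` function with compact support in the target of a chart gives a `C¹` function on `M`. -/
lemma contMDiff_indicator_chart [T2Space M] {e : OpenPartialHomeomorph M (Coord n)}
    (he : e ∈ atlas (Coord n) M) {v : Coord n → ℝ} (hv : ContDiff ℝ 1 v) {K : Set (Coord n)}
    (hK : IsCompact K) (hKe : K ⊆ e.target) (h0 : ∀ y ∉ K, v y = 0) :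
    ContMDiff (𝓡 n) 𝓘(ℝ, ℝ) 1 (e.source.indicator fun x => v (e x)) := by
  have : IsManifold (𝓡 n) 1 M := .of_le (n := ∞) (by simp)
  have hK' : IsClosed (e.symm '' K) :=
    (hK.image_of_continuousOn (e.continuousOn_symm.mono hKe)).isClosed
  have h1 : ContMDiffOn (𝓡 n) 𝓘(ℝ, ℝ) 1 (fun x => v (e x)) e.source :=
    hv.contMDiff.comp_contMDiffOn
      (contMDiffOn_of_mem_maximalAtlas (IsManifold.subset_maximalAtlas he))
  intro x
  by_cases hx : x ∈ e.source
  · refine (h1.contMDiffAt (e.open_source.mem_nhds hx)).congr_of_eventuallyEq ?_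
    filter_upwards [e.open_source.mem_nhds hx] with z hz
    exact Set.indicator_of_mem hz _
  · refine (contMDiffAt_const (c := (0 : ℝ))).congr_of_eventuallyEq ?_
    filter_upwards [hK'.isOpen_compl.mem_nhds (x := x) (by
      rintro ⟨y, hy, rfl⟩
      exact hx (e.map_target (hKe hy)))] with z hz
    by_cases hze : z ∈ e.source
    · rw [Set.indicator_of_mem hze, h0 _ fun h => hz ⟨_, h, e.left_inv hze⟩]
    · exact Set.indicator_of_notMem hze _

end ExtensionByZero

section ChartIntegrals

variable {n : ℕ} {M : Type*} [TopologicalSpace M] [ChartedSpace (Coord n) M]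
  [IsManifold (𝓡 n) ∞ M] [MeasurableSpace M] [BorelSpace M] [CompactSpace M] [Nonempty M]

lemma exists_setLIntegral_chart_le (g : Metric n M) {e : OpenPartialHomeomorph M (Coord n)}
    (he : e ∈ atlas (Coord n) M) {K : Set (Coord n)} (hK : IsCompact K) (hKe : K ⊆ e.target) :
    ∃ C : ℝ≥0∞, C ≠ ⊤ ∧ ∀ F : M → ℝ≥0∞, AEMeasurable F (vol g) →
      ∫⁻ y in K, F (e.symm y) ≤ C * ∫⁻ x, F x ∂(vol g) := by
  obtain ⟨c, hc0, hc⟩ : ∃ c : ℝ, 0 < c ∧ ∀ y ∈ K, c ≤ dens g e y := by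
    rcases K.eq_empty_or_nonempty with rfl | hne
    · exact ⟨1, one_pos, fun y hy => hy.elim⟩
    · obtain ⟨y, hy, hmin⟩ := hK.exists_isMinOn hne ((continuousOn_dens g he).mono hKe)
      exact ⟨_, dens_pos g he (hKe hy), fun z hz => hmin hz⟩
  refine ⟨ENNReal.ofReal c⁻¹, ENNReal.ofReal_ne_top, fun F hF => ?_⟩
  calc ∫⁻ y in K, F (e.symm y)
      ≤ ∫⁻ y in K, ENNReal.ofReal c⁻¹ * (ENNReal.ofReal (dens g e y) * F (e.symm y)) := by
        refine setLIntegral_mono' hK.isClosed.measurableSet fun y hy => ?_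
        rw [← mul_assoc, ← ENNReal.ofReal_mul (inv_pos.2 hc0).le]
        refine le_mul_of_one_le_left' ?_
        rw [ENNReal.one_le_ofReal, inv_mul_eq_div, one_le_div hc0]
        exact hc y hy
    _ = ENNReal.ofReal c⁻¹ * ∫⁻ y in K, ENNReal.ofReal (dens g e y) * F (e.symm y) :=
        lintegral_const_mul' _ _ ENNReal.ofReal_ne_top
    _ ≤ ENNReal.ofReal c⁻¹ * ∫⁻ y in e.target, ENNReal.ofReal (dens g e y) * F (e.symm y) := by
        gcongr
    _ ≤ _ := by
        rw [← setLIntegral_vol g he hF]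
        gcongr
        exact Measure.restrict_le_self

lemma exists_lintegral_vol_le (g : Metric n M) {e : OpenPartialHomeomorph M (Coord n)}
    (he : e ∈ atlas (Coord n) M) {K : Set (Coord n)} (hK : IsCompact K) (hKe : K ⊆ e.target) :
    ∃ C : ℝ≥0∞, C ≠ ⊤ ∧ ∀ F : M → ℝ≥0∞, AEMeasurable F (vol g) → (∀ x ∉ e.symm '' K, F x = 0) →
      ∫⁻ x, F x ∂(vol g) ≤ C * ∫⁻ y in K, F (e.symm y) := by
  obtain ⟨c, hc⟩ := hK.exists_bound_of_continuousOn ((continuousOn_dens g he).mono hKe)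
  refine ⟨ENNReal.ofReal c, ENNReal.ofReal_ne_top, fun F hF h0 => ?_⟩
  have h1 : ∫⁻ x, F x ∂(vol g) = ∫⁻ x in e.source, F x ∂(vol g) := by
    rw [← lintegral_indicator e.open_source.measurableSet]
    refine lintegral_congr fun x => ?_
    by_cases hx : x ∈ e.source
    · rw [Set.indicator_of_mem hx]
    · rw [Set.indicator_of_notMem hx, h0]
      rintro ⟨y, hy, rfl⟩
      exact hx (e.map_target (hKe hy))
  rw [h1, setLIntegral_vol g he hF, ← lintegral_const_mul' _ _ ENNReal.ofReal_ne_top,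
    ← lintegral_indicator e.open_target.measurableSet,
    ← lintegral_indicator hK.isClosed.measurableSet]
  refine lintegral_mono fun y => ?_
  by_cases hy : y ∈ e.target
  · rw [Set.indicator_of_mem hy]
    by_cases hyK : y ∈ K
    · rw [Set.indicator_of_mem hyK]
      gcongr
      exact (le_abs_self _).trans (hc y hyK)
    · rw [h0]
      · simp
      · rintro ⟨z, hz, hzy⟩
        exact hyK (e.symm.injOn (hKe hz) hy hzy ▸ hz)
  · rw [Set.indicator_of_notMem hy]
    exact zero_le

end ChartIntegrals

/-! ### Approximation by continuously differentiable functions, locally -/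

section LocalApproximation

variable {n : ℕ} {M : Type*} [TopologicalSpace M] [ChartedSpace (Coord n) M]
  [IsManifold (𝓡 n) ∞ M]

lemma exists_small {ε p : ℝ} (hε : 0 < ε) (hp : 0 < p) {A B : ℝ≥0∞} (hA : A ≠ ⊤) (hB : B ≠ ⊤) :
    ∃ δ : ℝ, 0 < δ ∧ δ ≤ ε ∧ ENNReal.ofReal δ * A ≤ ENNReal.ofReal ε ∧
      B * ENNReal.ofReal δ ^ p ≤ ENNReal.ofReal ε := by
  have hε' : 0 < ENNReal.ofReal ε := ENNReal.ofReal_pos.2 hε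
  have h0 : Tendsto (fun δ : ℝ => ENNReal.ofReal δ) (𝓝[>] 0) (𝓝 0) := by
    simpa using (ENNReal.continuous_ofReal.tendsto 0).mono_left
      (nhdsWithin_le_nhds (s := Set.Ioi (0 : ℝ)))
  have h1 : Tendsto (fun δ : ℝ => ENNReal.ofReal δ * A) (𝓝[>] 0) (𝓝 0) := by
    simpa using ENNReal.Tendsto.mul_const h0 (Or.inr hA)
  have h2 : Tendsto (fun δ : ℝ => B * ENNReal.ofReal δ ^ p) (𝓝[>] 0) (𝓝 0) := by
    have h3 : Tendsto (fun δ : ℝ => ENNReal.ofReal δ ^ p) (𝓝[>] 0) (𝓝 0) := by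
      have := (ENNReal.continuous_rpow_const (y := p)).tendsto 0 |>.comp h0
      simpa [ENNReal.zero_rpow_of_pos hp, Function.comp_def] using this
    simpa using ENNReal.Tendsto.const_mul h3 (Or.inr hB)
  have h4 : ∀ᶠ δ : ℝ in 𝓝[>] 0, δ ≤ ε := (nhdsWithin_le_nhds) (Iic_mem_nhds hε)
  obtain ⟨δ, h5, h6, h7, h8⟩ := ((h1.eventually (Iic_mem_nhds hε')).and
    ((h2.eventually (Iic_mem_nhds hε')).and (h4.and self_mem_nhdsWithin))).exists
  exact ⟨δ, h8, h7, h5, h6⟩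

/-- `F`, with generalized gradient `X`, is a limit of `C¹` functions: uniformly, in the Hölder
seminorm with exponent `(p - n) / p`, and in energy. -/
def Approximable [MeasurableSpace M] (p : ℝ) (g : Metric n M) (F : M → ℝ) (X : M → Coord n) :
    Prop :=
  ∀ ε : ℝ, 0 < ε → ∃ h : M → ℝ, ContMDiff (𝓡 n) 𝓘(ℝ, ℝ) 1 h ∧
    (∀ x, |h x - F x| ≤ ε) ∧
    (∀ x y, ‖(h x - F x) - (h y - F y)‖ₑ ≤ ENNReal.ofReal ε * riemDist g x y ^ ((p - n) / p)) ∧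
    ∫⁻ x, ENNReal.ofReal (nrm g x (grad g h x - X x) ^ p) ∂(vol g) ≤ ENNReal.ofReal ε

/-- A function in a chart, supported in a fixed compact set, that is small uniformly and in the Hölder
seminorm, is small in the Hölder seminorm of `M`: for close points the chart is Lipschitz, and for
distant ones the uniform bound is enough. -/
lemma exists_holder_chart [T2Space M] [CompactSpace M] (g : Metric n M) {α : ℝ} (hα : 0 < α)
    {e : OpenPartialHomeomorph M (Coord n)} (he : e ∈ atlas (Coord n) M) {K : Set (Coord n)}
    (hK : IsCompact K) (hKe : K ⊆ e.target) :
    ∃ A : ℝ≥0∞, A ≠ ⊤ ∧ ∀ (w : Coord n → ℝ) (δ : ℝ), 0 < δ → (∀ y ∉ K, w y = 0) → (∀ y, |w y| ≤ δ) →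
      (∀ a b, ‖w a - w b‖ₑ ≤ ENNReal.ofReal δ * ‖a - b‖ₑ ^ α) → ∀ x y,
      ‖e.source.indicator (fun z => w (e z)) x - e.source.indicator (fun z => w (e z)) y‖ₑ ≤
        ENNReal.ofReal δ * A * riemDist g x y ^ α := by
  have hK' : IsCompact (e.symm '' K) := hK.image_of_continuousOn (e.continuousOn_symm.mono hKe)
  have hK'e : e.symm '' K ⊆ e.source := by
    rintro _ ⟨y, hy, rfl⟩
    exact e.map_target (hKe hy)
  obtain ⟨r, hr, C, hC, h⟩ := exists_norm_chart_sub_le g he hK' hK'e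
  set r' := min r 1 with hr'
  have hr'0 : r' ≠ 0 := (lt_min hr one_pos).ne'
  have hr't : r' ≠ ⊤ := ((min_le_right _ _).trans_lt ENNReal.one_lt_top).ne
  refine ⟨ENNReal.ofReal C ^ α + 2 * r' ^ (-α), ENNReal.add_ne_top.2
    ⟨ENNReal.rpow_ne_top_of_nonneg hα.le ENNReal.ofReal_ne_top,
      ENNReal.mul_ne_top (by simp) (ENNReal.rpow_ne_top_of_ne_zero hr'0 hr't)⟩,
    fun w δ hδ h0 hb hw => ?_⟩
  set d : M → ℝ := e.source.indicator (fun z => w (e z)) with hd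
  have hdb : ∀ z, |d z| ≤ δ := by
    intro z
    by_cases hz : z ∈ e.source
    · rw [hd, Set.indicator_of_mem hz]; exact hb _
    · rw [hd, Set.indicator_of_notMem hz, abs_zero]; exact hδ.le
  have hd0 : ∀ z ∉ e.symm '' K, d z = 0 := by
    intro z hz
    by_cases hze : z ∈ e.source
    · rw [hd, Set.indicator_of_mem hze, h0 _ fun h => hz ⟨_, h, e.left_inv hze⟩]
    · rw [hd, Set.indicator_of_notMem hze]
  have key : ∀ x ∈ e.symm '' K, ∀ y, ‖d x - d y‖ₑ ≤
      ENNReal.ofReal δ * (ENNReal.ofReal C ^ α + 2 * r' ^ (-α)) * riemDist g x y ^ α := by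
    intro x hx y
    by_cases hxy : riemDist g x y < r'
    · obtain ⟨hy, hle⟩ := h x hx y (hxy.trans_le (min_le_left _ _))
      rw [hd, Set.indicator_of_mem hy, Set.indicator_of_mem (hK'e hx)]
      refine (hw _ _).trans ?_
      rw [ofReal_norm] at hle
      calc ENNReal.ofReal δ * ‖e x - e y‖ₑ ^ α
          ≤ ENNReal.ofReal δ * (ENNReal.ofReal C * riemDist g x y) ^ α := by gcongr
        _ = ENNReal.ofReal δ * ENNReal.ofReal C ^ α * riemDist g x y ^ α := by
            rw [ENNReal.mul_rpow_of_nonneg _ _ hα.le, mul_assoc]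
        _ ≤ _ := by
            gcongr
            exact le_self_add
    · rw [not_lt] at hxy
      calc ‖d x - d y‖ₑ ≤ ENNReal.ofReal (2 * δ) := by
            rw [← ofReal_norm]
            refine ENNReal.ofReal_le_ofReal ((abs_sub _ _).trans ?_)
            linarith [hdb x, hdb y]
        _ = ENNReal.ofReal δ * (2 * (r' ^ (-α) * r' ^ α)) := by
            rw [← ENNReal.rpow_add _ _ hr'0 hr't, neg_add_cancel, ENNReal.rpow_zero,
              ENNReal.ofReal_mul (by norm_num), ENNReal.ofReal_ofNat]
            ring
        _ ≤ ENNReal.ofReal δ * (2 * (r' ^ (-α) * riemDist g x y ^ α)) := by gcongr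
        _ = ENNReal.ofReal δ * (2 * r' ^ (-α)) * riemDist g x y ^ α := by ring
        _ ≤ _ := by
            gcongr
            exact le_add_self
  intro x y
  by_cases hx : x ∈ e.symm '' K
  · exact key x hx y
  · by_cases hy : y ∈ e.symm '' K
    · rw [enorm_sub_rev, riemDist_comm]
      exact key y hy x
    · simp [hd0 x hx, hd0 y hy]

variable [T2Space M] [CompactSpace M] [MeasurableSpace M] [BorelSpace M] [Nonempty M]

/-- The energy of a field supported in a compact set of a chart domain is controlled by the `L^p`
norms of its covariant components `b i` in the chart. -/
lemma exists_energy_chart (g : Metric n M) {p : ℝ} (hp : 1 ≤ p)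
    {e : OpenPartialHomeomorph M (Coord n)} (he : e ∈ atlas (Coord n) M) {K : Set (Coord n)}
    (hK : IsCompact K) (hKe : K ⊆ e.target) :
    ∃ B : ℝ≥0∞, B ≠ ⊤ ∧ ∀ (Y : M → Coord n) (b : Fin n → Coord n → ℝ) (δ : ℝ), MeasField g Y →
      (∀ x ∉ e.symm '' K, Y x = 0) →
      (∀ i, ∀ y ∈ K, ip g (e.symm y) (Y (e.symm y)) (coordField e i (e.symm y)) = b i y) →
      (∀ i, AEStronglyMeasurable (b i)) →
      (∀ i, eLpNorm (b i) (ENNReal.ofReal p) volume ≤ ENNReal.ofReal δ) →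
      ∫⁻ x, ENNReal.ofReal (nrm g x (Y x) ^ p) ∂(vol g) ≤ B * ENNReal.ofReal δ ^ p := by
  have hp0 : 0 < p := by linarith
  have hK' : IsCompact (e.symm '' K) := hK.image_of_continuousOn (e.continuousOn_symm.mono hKe)
  have hK'e : e.symm '' K ⊆ e.source := by
    rintro _ ⟨y, hy, rfl⟩
    exact e.map_target (hKe hy)
  obtain ⟨C₁, hC₁, h1⟩ := exists_nrm_le_sum g he hK' hK'e
  obtain ⟨C₂, hC₂, h2⟩ := exists_lintegral_vol_le g he hK hKe
  refine ⟨C₂ * (ENNReal.ofReal (C₁ ^ p * (n : ℝ) ^ (p - 1)) * n), ENNReal.mul_ne_top hC₂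
    (ENNReal.mul_ne_top ENNReal.ofReal_ne_top (ENNReal.natCast_ne_top n)),
    fun Y b δ hY hY0 hYb hbm hb => ?_⟩
  have hpow : ∀ i, ∫⁻ y, ‖b i y‖ₑ ^ p ≤ ENNReal.ofReal δ ^ p := by
    intro i
    have h3 := hb i
    rw [eLpNorm_eq_lintegral_rpow_enorm_toReal (by simpa using hp0) ENNReal.ofReal_ne_top,
      ENNReal.toReal_ofReal hp0.le] at h3
    have h4 := ENNReal.rpow_le_rpow h3 hp0.le
    rwa [← ENNReal.rpow_mul, one_div_mul_cancel hp0.ne', ENNReal.rpow_one] at h4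
  refine (h2 _ (hY.nrm.pow_const p).ennreal_ofReal fun x hx => ?_).trans ?_
  · rw [hY0 x hx, nrm_zero, Real.zero_rpow hp0.ne', ENNReal.ofReal_zero]
  · rw [mul_assoc]
    gcongr
    calc ∫⁻ y in K, ENNReal.ofReal (nrm g (e.symm y) (Y (e.symm y)) ^ p)
        ≤ ∫⁻ y in K, ENNReal.ofReal (C₁ ^ p * (n : ℝ) ^ (p - 1)) * ∑ i, ‖b i y‖ₑ ^ p := by
          refine setLIntegral_mono' hK.isClosed.measurableSet fun y hy => ?_
          have h5 : nrm g (e.symm y) (Y (e.symm y)) ^ p ≤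
              C₁ ^ p * (n : ℝ) ^ (p - 1) * ∑ i, |b i y| ^ p := by
            have h6 := h1 _ (Set.mem_image_of_mem _ hy) (Y (e.symm y))
            simp only [hYb _ y hy] at h6
            calc nrm g (e.symm y) (Y (e.symm y)) ^ p ≤ (C₁ * ∑ i, |b i y|) ^ p := by
                  gcongr
                  exact nrm_nonneg _ _ _
              _ = C₁ ^ p * (∑ i, |b i y|) ^ p := Real.mul_rpow hC₁.le (by positivity)
              _ ≤ C₁ ^ p * ((n : ℝ) ^ (p - 1) * ∑ i, |b i y| ^ p) := by
                  gcongr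
                  have := Real.rpow_sum_le_const_mul_sum_rpow (Finset.univ : Finset (Fin n))
                    (fun i => b i y) hp
                  simpa using this
              _ = _ := by ring
          refine (ENNReal.ofReal_le_ofReal h5).trans_eq ?_
          rw [ENNReal.ofReal_mul (by positivity),
            ENNReal.ofReal_sum_of_nonneg fun _ _ => by positivity]
          congr 1
          refine Finset.sum_congr rfl fun i _ => ?_
          rw [← ENNReal.ofReal_rpow_of_nonneg (abs_nonneg _) hp0.le, ← Real.norm_eq_abs, ofReal_norm]
      _ = ENNReal.ofReal (C₁ ^ p * (n : ℝ) ^ (p - 1)) * ∑ i, ∫⁻ y in K, ‖b i y‖ₑ ^ p := by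
          rw [lintegral_const_mul' _ _ ENNReal.ofReal_ne_top, lintegral_finsetSum']
          exact fun i _ => ((hbm i).enorm.pow_const p).restrict
      _ ≤ ENNReal.ofReal (C₁ ^ p * (n : ℝ) ^ (p - 1)) * ∑ _i : Fin n, ENNReal.ofReal δ ^ p := by
          gcongr with i _
          exact (lintegral_mono' Measure.restrict_le_self le_rfl).trans (hpow i)
      _ = _ := by
          simp [mul_assoc]

/-- The weak gradient of the product of a Sobolev function with a smooth function supported in a
chart domain, in Euclidean coordinates. -/
lemma weak_product (g : Metric n M) {e : OpenPartialHomeomorph M (Coord n)}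
    (he : e ∈ atlas (Coord n) M) {χ f : M → ℝ} (hχ : ContMDiff (𝓡 n) 𝓘(ℝ, ℝ) ∞ χ)
    (hχe : tsupport χ ⊆ e.source) {V : M → Coord n}
    (hV : IsWeakGradient g f V) (i : Fin n) {ψ : Coord n → ℝ} (hψ : ContDiff ℝ ∞ ψ)
    (hψc : HasCompactSupport ψ) :
    ∫ y, e.target.indicator (fun y => χ (e.symm y) * f (e.symm y)) y *
        fderiv ℝ ψ y (EuclideanSpace.single i (1 : ℝ)) =
      -∫ y, e.target.indicator (fun y => ip g (e.symm y)
        (χ (e.symm y) • V (e.symm y) + f (e.symm y) • grad g χ (e.symm y))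
        (coordField e i (e.symm y))) y * ψ y := by
  set v : Coord n := EuclideanSpace.single i (1 : ℝ) with hv
  have hχ1 : ContMDiff (𝓡 n) 𝓘(ℝ, ℝ) 1 χ := hχ.of_le (by exact_mod_cast le_top)
  set K := e '' tsupport χ with hK
  have hKc : IsCompact K :=
    ((isClosed_tsupport χ).isCompact).image_of_continuousOn (e.continuousOn.mono hχe)
  have hKe : K ⊆ e.target := by
    rintro _ ⟨x, hx, rfl⟩
    exact e.map_source (hχe hx)
  have hχ0 : ∀ y ∈ e.target, y ∉ K → χ (e.symm y) = 0 := fun y hy hyK =>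
    image_eq_zero_of_notMem_tsupport fun h => hyK ⟨_, h, e.right_inv hy⟩
  set a := e.target.indicator (fun y => χ (e.symm y)) with ha
  have hasm : ContDiff ℝ ∞ a :=
    contDiff_indicator e.open_target hKc.isClosed hKe (contDiffOn_comp_symm he le_rfl hχ) hχ0
  have hasupp : tsupport a ⊆ K := tsupport_indicator_subset hKc.isClosed hχ0
  have ha0 : ∀ y ∉ K, a y = 0 := fun y hy => image_eq_zero_of_notMem_tsupport fun h => hy (hasupp h)
  have hda0 : ∀ y ∉ K, fderiv ℝ a y v = 0 := fun y hy => by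
    have h := image_eq_zero_of_notMem_tsupport (f := fderiv ℝ a) (x := y)
      fun h => hy (hasupp (tsupport_fderiv_subset ℝ h))
    rw [h, zero_apply]
  have hda : ∀ y ∈ e.target, fderiv ℝ a y v =
      ip g (e.symm y) (grad g χ (e.symm y)) (coordField e i (e.symm y)) := by
    intro y hy
    rw [ip_grad_coordField g he hy (hχ1.mdifferentiable one_ne_zero _) i]
    have : a =ᶠ[𝓝 y] fun z => χ (e.symm z) := by
      filter_upwards [e.open_target.mem_nhds hy] with z hz
      exact Set.indicator_of_mem hz _
    rw [this.fderiv_eq]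
  have hdac : Continuous fun y => fderiv ℝ a y v :=
    (hasm.continuous_fderiv (by simp)).clm_apply continuous_const
  have hdψ : Continuous fun y => fderiv ℝ ψ y v :=
    (hψ.continuous_fderiv (by simp)).clm_apply continuous_const
  obtain ⟨hfl, hVl⟩ := hV e he
  obtain ⟨hVi, hVw⟩ := hVl i
  -- test the weak gradient of `f` against the product of `ψ` with the cutoff function
  have hw := hVw (fun y => a y * ψ y) (hasm.mul hψ) hψc.mul_left
    ((tsupport_mul_subset_left.trans hasupp).trans hKe)
  rw [← hv] at hw
  have hprod : ∀ y, fderiv ℝ (fun y => a y * ψ y) y v = a y * fderiv ℝ ψ y v + ψ y * fderiv ℝ a y v := by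
    intro y
    rw [fderiv_fun_mul (hasm.differentiable (by simp) y) (hψ.differentiable (by simp) y)]
    simp
  have I1 : Integrable fun y => f (e.symm y) * (a y * fderiv ℝ ψ y v) :=
    integrable_mul_of_locallyIntegrableOn hfl hKc hKe (hasm.continuous.mul hdψ)
      fun y hy => by simp [ha0 y hy]
  have I2 : Integrable fun y => f (e.symm y) * (ψ y * fderiv ℝ a y v) :=
    integrable_mul_of_locallyIntegrableOn hfl hKc hKe (hψ.continuous.mul hdac)
      fun y hy => by simp [hda0 y hy]
  have I3 : Integrable fun y => g.inner (e.symm y) (V (e.symm y)) (coordVec e i y) * (a y * ψ y) :=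
    integrable_mul_of_locallyIntegrableOn hVi hKc hKe (hasm.continuous.mul hψ.continuous)
      fun y hy => by simp [ha0 y hy]
  have hE1 : ∀ y, e.target.indicator (fun y => χ (e.symm y) * f (e.symm y)) y * fderiv ℝ ψ y v =
      f (e.symm y) * (a y * fderiv ℝ ψ y v) := by
    intro y
    by_cases hy : y ∈ e.target
    · simp only [ha, Set.indicator_of_mem hy]; ring
    · simp [ha, Set.indicator_of_notMem hy]
  have hE2 : ∀ y, e.target.indicator (fun y => ip g (e.symm y)
        (χ (e.symm y) • V (e.symm y) + f (e.symm y) • grad g χ (e.symm y))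
        (coordField e i (e.symm y))) y * ψ y =
      g.inner (e.symm y) (V (e.symm y)) (coordVec e i y) * (a y * ψ y) +
        f (e.symm y) * (ψ y * fderiv ℝ a y v) := by
    intro y
    by_cases hy : y ∈ e.target
    · rw [hda y hy]
      have h1 : g.inner (e.symm y) (V (e.symm y)) (coordVec e i y) =
          ip g (e.symm y) (V (e.symm y)) (coordField e i (e.symm y)) := by
        rw [← coordVec_eq e i hy]; rfl
      rw [h1]
      simp only [ha, Set.indicator_of_mem hy, map_add, map_smul, add_apply, smul_apply, smul_eq_mul]
      ring
    · rw [Set.indicator_of_notMem hy, ha0 y fun h => hy (hKe h), hda0 y fun h => hy (hKe h)]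
      simp
  simp only [hE1, hE2]
  rw [integral_add I3 I2, neg_add, ← hw]
  simp only [hprod, mul_add]
  rw [integral_add I1 I2]
  ring

end LocalApproximation

/-! ### Approximation by continuously differentiable functions, globally -/

section Approximation

variable {n : ℕ} {M : Type*} [TopologicalSpace M] [ChartedSpace (Coord n) M]
  [IsManifold (𝓡 n) ∞ M] [T2Space M] [CompactSpace M] [MeasurableSpace M] [BorelSpace M]
  [Nonempty M]

lemma continuousOn_weak_part (g : Metric n M) {e : OpenPartialHomeomorph M (Coord n)}
    (he : e ∈ atlas (Coord n) M) {χ f : M → ℝ} (hχ : ContMDiff (𝓡 n) 𝓘(ℝ, ℝ) 1 χ)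
    (hf : Continuous f) (i : Fin n) :
    ContinuousOn (fun y => f (e.symm y) * ip g (e.symm y) (grad g χ (e.symm y))
      (coordField e i (e.symm y))) e.target :=
  (hf.comp_continuousOn e.continuousOn_symm).mul
    ((continuousOn_ip_grad_coordField g he hχ i).comp e.continuousOn_symm fun _ hy => e.map_target hy)

lemma grad_eq_zero_of_notMem (g : Metric n M) {χ : M → ℝ} {x : M} (hx : x ∉ tsupport χ) :
    grad g χ x = 0 := by
  refine grad_eq g (L := 0) ?_ fun w => by simp
  refine HasMFDerivAt.congr_of_eventuallyEq (hasMFDerivAt_const (0 : ℝ) x) ?_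
  exact notMem_tsupport_iff_eventuallyEq.1 hx

/-- The weak partial derivatives of a localized Sobolev function belong to `L^p`. -/
lemma memLp_weak_product (g : Metric n M) {p : ℝ} (hp : 1 ≤ p)
    {e : OpenPartialHomeomorph M (Coord n)}
    (he : e ∈ atlas (Coord n) M) {χ f : M → ℝ} (hχ : ContMDiff (𝓡 n) 𝓘(ℝ, ℝ) 1 χ)
    (hχe : tsupport χ ⊆ e.source) (hf : Continuous f) {V : M → Coord n}
    (hV : IsWeakGradient g f V) (hE : ∫⁻ x, ENNReal.ofReal (nrm g x (V x) ^ p) ∂(vol g) ≠ ⊤)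
    (i : Fin n) :
    MemLp (e.target.indicator (fun y => ip g (e.symm y)
        (χ (e.symm y) • V (e.symm y) + f (e.symm y) • grad g χ (e.symm y))
        (coordField e i (e.symm y)))) (ENNReal.ofReal p) volume := by
  have hp0 : 0 < p := by linarith
  have hMf := measField_of_isWeakGradient hV
  set K := e '' tsupport χ with hK
  have hcs : IsCompact (tsupport χ) := (isClosed_tsupport χ).isCompact
  have hKc : IsCompact K := hcs.image_of_continuousOn (e.continuousOn.mono hχe)
  have hKe : K ⊆ e.target := by
    rintro _ ⟨x, hx, rfl⟩
    exact e.map_source (hχe hx)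
  have hnot : ∀ y ∈ e.target, y ∉ K → e.symm y ∉ tsupport χ := fun y hy hyK h =>
    hyK ⟨_, h, e.right_inv hy⟩
  have hsplit : (e.target.indicator (fun y => ip g (e.symm y)
        (χ (e.symm y) • V (e.symm y) + f (e.symm y) • grad g χ (e.symm y))
        (coordField e i (e.symm y)))) =
      e.target.indicator (fun y => χ (e.symm y) * ip g (e.symm y) (V (e.symm y))
        (coordField e i (e.symm y))) +
      e.target.indicator (fun y => f (e.symm y) * ip g (e.symm y) (grad g χ (e.symm y))
        (coordField e i (e.symm y))) := by
    ext y
    by_cases hy : y ∈ e.target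
    · simp [hy]
    · simp [hy]
  rw [hsplit]
  refine MemLp.add ?_ ?_
  · rw [memLp_indicator_iff_restrict e.open_target.measurableSet]
    obtain ⟨b, hb⟩ := isCompact_univ.exists_bound_of_continuousOn hχ.continuous.continuousOn
    obtain ⟨c, hc0, hc⟩ := exists_nrm_coordField_le g he hcs hχe
    obtain ⟨A, hA, hAle⟩ := exists_setLIntegral_chart_le g he hKc hKe
    have hVm : AEStronglyMeasurable (fun y => ip g (e.symm y) (V (e.symm y))
        (coordField e i (e.symm y))) (volume.restrict e.target) := by
      have h := ((hV e he).2 i).1.aestronglyMeasurable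
      refine h.congr ?_
      filter_upwards [ae_restrict_mem e.open_target.measurableSet] with y hy
      rw [← coordVec_eq e i hy]
      rfl
    refine ⟨((hχ.continuous.comp_continuousOn e.continuousOn_symm).aestronglyMeasurable
      e.open_target.measurableSet).mul hVm, ?_⟩
    rw [eLpNorm_lt_top_iff_lintegral_rpow_enorm_lt_top (by simpa using hp0) ENNReal.ofReal_ne_top,
      ENNReal.toReal_ofReal hp0.le]
    have hb0 : 0 ≤ b := (norm_nonneg _).trans (hb (Classical.arbitrary M) trivial)
    calc ∫⁻ y in e.target, ‖χ (e.symm y) * ip g (e.symm y) (V (e.symm y))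
          (coordField e i (e.symm y))‖ₑ ^ p
        ≤ ∫⁻ y in K, ENNReal.ofReal ((b * c) ^ p) *
            ENNReal.ofReal (nrm g (e.symm y) (V (e.symm y)) ^ p) := by
          rw [← lintegral_indicator e.open_target.measurableSet,
            ← lintegral_indicator hKc.isClosed.measurableSet]
          refine lintegral_mono fun y => ?_
          by_cases hy : y ∈ e.target
          · rw [Set.indicator_of_mem hy]
            by_cases hyK : y ∈ K
            · have hys : e.symm y ∈ tsupport χ := by
                obtain ⟨x, hx, rfl⟩ := hyK
                rwa [e.left_inv (hχe hx)]
              rw [Set.indicator_of_mem hyK, ← ENNReal.ofReal_mul (by positivity), ← ofReal_norm,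
                ENNReal.ofReal_rpow_of_nonneg (norm_nonneg _) hp0.le,
                ← Real.mul_rpow (by positivity) (nrm_nonneg _ _ _)]
              refine ENNReal.ofReal_le_ofReal (Real.rpow_le_rpow (norm_nonneg _) ?_ hp0.le)
              rw [norm_mul, mul_assoc]
              refine mul_le_mul (hb _ trivial) ?_ (norm_nonneg _) hb0
              refine (abs_ip_le g _ _ _).trans ?_
              rw [mul_comm]
              gcongr
              · exact nrm_nonneg _ _ _
              · exact hc _ hys i
            · rw [image_eq_zero_of_notMem_tsupport (hnot y hy hyK)]
              simp [hp0]
          · rw [Set.indicator_of_notMem hy]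
            exact zero_le
      _ = ENNReal.ofReal ((b * c) ^ p) * ∫⁻ y in K,
            ENNReal.ofReal (nrm g (e.symm y) (V (e.symm y)) ^ p) :=
          lintegral_const_mul' _ _ ENNReal.ofReal_ne_top
      _ ≤ ENNReal.ofReal ((b * c) ^ p) * (A * ∫⁻ x, ENNReal.ofReal (nrm g x (V x) ^ p) ∂(vol g)) := by
          gcongr
          exact hAle (fun x => ENNReal.ofReal (nrm g x (V x) ^ p)) (hMf.nrm.pow_const p).ennreal_ofReal
      _ < ⊤ := ENNReal.mul_lt_top ENNReal.ofReal_lt_top (ENNReal.mul_lt_top hA.lt_top hE.lt_top)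
  · have h0 : ∀ y ∈ e.target, y ∉ K → f (e.symm y) * ip g (e.symm y) (grad g χ (e.symm y))
        (coordField e i (e.symm y)) = 0 := by
      intro y hy hyK
      rw [grad_eq_zero_of_notMem g (hnot y hy hyK)]
      simp
    have h1 := contDiff_indicator (k := 0) e.open_target hKc.isClosed hKe
      (contDiffOn_zero.2 (continuousOn_weak_part g he hχ hf i)) h0
    exact h1.continuous.memLp_of_hasCompactSupport
      (hKc.of_isClosed_subset (isClosed_tsupport _) (tsupport_indicator_subset hKc.isClosed h0))

/-- Approximation of a Sobolev function localized to a chart domain. -/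
lemma approximable_mul (g : Metric n M) {p : ℝ} (hp : 1 ≤ p) (hpn : (n : ℝ) < p)
    {e : OpenPartialHomeomorph M (Coord n)}
    (he : e ∈ atlas (Coord n) M) {χ f : M → ℝ} (hχ : ContMDiff (𝓡 n) 𝓘(ℝ, ℝ) ∞ χ)
    (hχe : tsupport χ ⊆ e.source) (hf : Continuous f) {V : M → Coord n}
    (hV : IsWeakGradient g f V) (hE : ∫⁻ x, ENNReal.ofReal (nrm g x (V x) ^ p) ∂(vol g) ≠ ⊤) :
    Approximable p g (fun x => χ x * f x) (fun x => χ x • V x + f x • grad g χ x) := by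
  have hp0 : 0 < p := by linarith
  have hα : 0 < (p - n) / p := div_pos (by linarith) hp0
  have hχ1 : ContMDiff (𝓡 n) 𝓘(ℝ, ℝ) 1 χ := hχ.of_le (by exact_mod_cast le_top)
  have hMf := measField_of_isWeakGradient hV
  have hXm : MeasField g (fun x => χ x • V x + f x • grad g χ x) :=
    (MeasField.smul hχ.continuous.aemeasurable hMf).add
      (MeasField.smul hf.aemeasurable (measField_grad g hχ1))
  set K := e '' tsupport χ with hK
  have hcs : IsCompact (tsupport χ) := (isClosed_tsupport χ).isCompact
  have hKc : IsCompact K := hcs.image_of_continuousOn (e.continuousOn.mono hχe)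
  have hKe : K ⊆ e.target := by
    rintro _ ⟨x, hx, rfl⟩
    exact e.map_source (hχe hx)
  have hnot : ∀ y ∈ e.target, y ∉ K → e.symm y ∉ tsupport χ := fun y hy hyK h =>
    hyK ⟨_, h, e.right_inv hy⟩
  obtain ⟨K', hK', hKK', hK'e⟩ := exists_compact_between hKc e.open_target hKe
  set u := e.target.indicator (fun y => χ (e.symm y) * f (e.symm y)) with hu
  have hu0' : ∀ y ∈ e.target, y ∉ K → χ (e.symm y) * f (e.symm y) = 0 := fun y hy hyK => by
    rw [image_eq_zero_of_notMem_tsupport (hnot y hy hyK), zero_mul]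
  have hucont : Continuous u := (contDiff_indicator (k := 0) e.open_target hKc.isClosed hKe
    (contDiffOn_zero.2 ((hχ.continuous.mul hf).comp_continuousOn e.continuousOn_symm)) hu0').continuous
  have hus : tsupport u ⊆ K := tsupport_indicator_subset hKc.isClosed hu0'
  have huc : HasCompactSupport u := hKc.of_isClosed_subset (isClosed_tsupport _) hus
  intro ε hε
  obtain ⟨A, hA, hAle⟩ := exists_holder_chart g hα he hK' hK'e
  obtain ⟨B, hB, hBle⟩ := exists_energy_chart g hp he hK' hK'e
  obtain ⟨δ, hδ0, hδε, hδA, hδB⟩ := exists_small hε hp0 hA hB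
  obtain ⟨v, hv, hvc, hvs, hvu, hvL, hvh⟩ := exists_contDiff_approx hp hpn hucont huc isOpen_interior
    (hus.trans hKK') (fun i => memLp_weak_product g hp he hχ1 hχe hf hV hE i)
    (fun i ψ hψ hψc => weak_product g he hχ hχe hV i hψ hψc) hδ0
  have hv1 : ContDiff ℝ 1 v := hv.of_le (by exact_mod_cast le_top)
  have hv0 : ∀ y ∉ K', v y = 0 := fun y hy => image_eq_zero_of_notMem_tsupport fun h =>
    hy (interior_subset (hvs h))
  have hu0 : ∀ y ∉ K', u y = 0 := fun y hy => image_eq_zero_of_notMem_tsupport fun h =>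
    hy (interior_subset (hKK' (hus h)))
  have hh : ContMDiff (𝓡 n) 𝓘(ℝ, ℝ) 1 (e.source.indicator fun x => v (e x)) :=
    contMDiff_indicator_chart he hv1 hK' hK'e hv0
  have hsub : ∀ x, e.source.indicator (fun x => v (e x)) x - χ x * f x =
      e.source.indicator (fun x => (v - u) (e x)) x := by
    intro x
    by_cases hx : x ∈ e.source
    · simp only [Set.indicator_of_mem hx, Pi.sub_apply, hu, Set.indicator_of_mem (e.map_source hx),
        e.left_inv hx]
    · simp [Set.indicator_of_notMem hx, image_eq_zero_of_notMem_tsupport fun h => hx (hχe h)]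
  refine ⟨e.source.indicator fun x => v (e x), hh, fun x => ?_, fun x y => ?_, ?_⟩
  · rw [hsub]
    by_cases hx : x ∈ e.source
    · rw [Set.indicator_of_mem hx]
      exact (hvu _).trans hδε
    · rw [Set.indicator_of_notMem hx, abs_zero]
      exact hε.le
  · rw [hsub, hsub]
    refine (hAle (v - u) δ hδ0 (fun y hy => by simp [hv0 y hy, hu0 y hy]) hvu hvh x y).trans ?_
    gcongr
  · refine (hBle (fun x => grad g (e.source.indicator fun x => v (e x)) x -
      (χ x • V x + f x • grad g χ x)) (fun i y => fderiv ℝ v y (EuclideanSpace.single i (1 : ℝ)) -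
      e.target.indicator (fun y => ip g (e.symm y)
        (χ (e.symm y) • V (e.symm y) + f (e.symm y) • grad g χ (e.symm y))
        (coordField e i (e.symm y))) y) δ ((measField_grad g hh).sub hXm) ?_ ?_ ?_ hvL).trans hδB
    · intro x hx
      have hxχ : x ∉ tsupport χ := fun h => hx ⟨e x, interior_subset (hKK' ⟨x, h, rfl⟩),
        e.left_inv (hχe h)⟩
      have hclosed : IsClosed (e.symm '' K') :=
        (hK'.image_of_continuousOn (e.continuousOn_symm.mono hK'e)).isClosed
      have hxh : x ∉ tsupport (e.source.indicator fun x => v (e x)) := by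
        refine fun h => hx (closure_minimal (fun z hz => ?_) hclosed h)
        by_contra hzK
        refine hz ?_
        by_cases hze : z ∈ e.source
        · rw [Set.indicator_of_mem hze, hv0 _ fun h => hzK ⟨_, h, e.left_inv hze⟩]
        · exact Set.indicator_of_notMem hze _
      simp [grad_eq_zero_of_notMem g hxχ, grad_eq_zero_of_notMem g hxh,
        image_eq_zero_of_notMem_tsupport hxχ]
    · intro i y hy
      have hyt := hK'e hy
      rw [map_sub, sub_apply, ip_grad_coordField g he hyt (hh.mdifferentiable one_ne_zero _) i,
        Set.indicator_of_mem hyt]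
      congr 1
      have : (fun z => e.source.indicator (fun x => v (e x)) (e.symm z)) =ᶠ[𝓝 y] v := by
        filter_upwards [e.open_target.mem_nhds hyt] with z hz
        rw [Set.indicator_of_mem (e.map_target hz), e.right_inv hz]
      rw [this.fderiv_eq]
    · intro i
      exact ((hv1.continuous_fderiv one_ne_zero).clm_apply continuous_const).aestronglyMeasurable.sub
        (memLp_weak_product g hp he hχ1 hχe hf hV hE i).1

lemma Approximable.sum {p : ℝ} (hp : 1 ≤ p) (g : Metric n M) {ι : Type*} (s : Finset ι)
    {F : ι → M → ℝ} {X : ι → M → Coord n}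
    (hX : ∀ k ∈ s, MeasField g (X k)) (h : ∀ k ∈ s, Approximable p g (F k) (X k)) :
    Approximable p g (fun x => ∑ k ∈ s, F k x) (fun x => ∑ k ∈ s, X k x) := by
  classical
  have hp0 : 0 < p := by linarith
  intro ε hε
  -- the number of summands, and the constant in the convexity inequality for sums of powers
  set c : ℝ := 1 + s.card * (1 + (s.card : ℝ) ^ (p - 1)) with hc
  have hc1 : 1 ≤ c := by
    have : 0 ≤ (s.card : ℝ) * (1 + (s.card : ℝ) ^ (p - 1)) := by positivity
    linarith
  have hεc : 0 < ε / c := by positivity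
  choose! w hw1 hw2 hw3 hw4 using fun k hk => h k hk (ε / c) hεc
  have hs : s.card * (ε / c) ≤ ε := by
    rw [mul_div_assoc', div_le_iff₀ (by positivity), mul_comm]
    gcongr
    have : 0 ≤ (s.card : ℝ) * (s.card : ℝ) ^ (p - 1) := by positivity
    rw [hc]; nlinarith
  have hs' : (s.card : ℝ) ^ (p - 1) * (s.card * (ε / c)) ≤ ε := by
    rw [← mul_assoc, mul_div_assoc', div_le_iff₀ (by positivity), mul_comm]
    gcongr
    have : 0 ≤ (s.card : ℝ) := by positivity
    rw [hc]; nlinarith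
  have hsum : ∀ x, ∑ k ∈ s, w k x - ∑ k ∈ s, F k x = ∑ k ∈ s, (w k x - F k x) := fun x => by
    rw [Finset.sum_sub_distrib]
  refine ⟨fun x => ∑ k ∈ s, w k x, contMDiff_finsetSum fun k hk => hw1 k hk, fun x => ?_,
    fun x y => ?_, ?_⟩
  · rw [hsum]
    refine (Finset.abs_sum_le_sum_abs _ _).trans ((Finset.sum_le_sum fun k hk => hw2 k hk x).trans ?_)
    simpa using hs
  · rw [hsum, hsum, ← Finset.sum_sub_distrib]
    refine (enorm_sum_le _ _).trans ((Finset.sum_le_sum fun k hk => hw3 k hk x y).trans ?_)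
    rw [Finset.sum_const, nsmul_eq_mul, ← mul_assoc]
    gcongr
    rw [← ENNReal.ofReal_natCast, ← ENNReal.ofReal_mul (by positivity)]
    exact ENNReal.ofReal_le_ofReal hs
  · have hm : ∀ k ∈ s, AEMeasurable (fun x => ENNReal.ofReal (nrm g x (grad g (w k) x - X k x) ^ p))
        (vol g) := fun k hk =>
      (((measField_grad g (hw1 k hk)).sub (hX k hk)).nrm.pow_const p).ennreal_ofReal
    calc ∫⁻ x, ENNReal.ofReal (nrm g x (grad g (fun x => ∑ k ∈ s, w k x) x - ∑ k ∈ s, X k x) ^ p) ∂(vol g)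
        ≤ ∫⁻ x, ENNReal.ofReal ((s.card : ℝ) ^ (p - 1)) *
          ∑ k ∈ s, ENNReal.ofReal (nrm g x (grad g (w k) x - X k x) ^ p) ∂(vol g) := by
          refine lintegral_mono fun x => ?_
          rw [grad_sum g s hw1 x, ← Finset.sum_sub_distrib, ← ENNReal.ofReal_sum_of_nonneg
            (fun k _ => Real.rpow_nonneg (nrm_nonneg _ _ _) _), ← ENNReal.ofReal_mul (by positivity)]
          refine ENNReal.ofReal_le_ofReal ?_
          calc _ ≤ (∑ k ∈ s, nrm g x (grad g (w k) x - X k x)) ^ p := by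
                gcongr
                · exact nrm_nonneg _ _ _
                · exact nrm_sum_le _ _ _ _
            _ ≤ _ := by
                have := Real.rpow_sum_le_const_mul_sum_rpow s
                  (fun k => nrm g x (grad g (w k) x - X k x)) hp
                simpa [abs_of_nonneg (nrm_nonneg g _ _)] using this
      _ = ENNReal.ofReal ((s.card : ℝ) ^ (p - 1)) *
          ∑ k ∈ s, ∫⁻ x, ENNReal.ofReal (nrm g x (grad g (w k) x - X k x) ^ p) ∂(vol g) := by
          rw [lintegral_const_mul' _ _ ENNReal.ofReal_ne_top, lintegral_finsetSum' _ hm]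
      _ ≤ ENNReal.ofReal ((s.card : ℝ) ^ (p - 1)) * ∑ _k ∈ s, ENNReal.ofReal (ε / c) := by
          gcongr with k hk
          exact hw4 k hk
      _ ≤ ENNReal.ofReal ε := by
          rw [Finset.sum_const, nsmul_eq_mul, ← ENNReal.ofReal_natCast,
            ← ENNReal.ofReal_mul (by positivity), ← ENNReal.ofReal_mul (by positivity)]
          exact ENNReal.ofReal_le_ofReal hs'

/-- A continuous Sobolev function of finite energy is a limit of `C¹` functions. -/
lemma approximable_of_isWeakGradient (g : Metric n M) {p : ℝ} (hp : 1 ≤ p) (hpn : (n : ℝ) < p)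
    {f : M → ℝ} (hf : Continuous f) {V : M → Coord n} (hV : IsWeakGradient g f V)
    (hE : ∫⁻ x, ENNReal.ofReal (nrm g x (V x) ^ p) ∂(vol g) ≠ ⊤) : Approximable p g f V := by
  obtain ⟨t, ht⟩ := isCompact_univ.elim_nhds_subcover (fun x : M => (chartAt (Coord n) x).source)
    fun x _ => chart_source_mem_nhds (Coord n) x
  obtain ⟨χ, hχ⟩ := SmoothPartitionOfUnity.exists_isSubordinate (𝓡 n) isClosed_univ
    (fun c : t => (chartAt (Coord n) (c : M)).source) (fun c => (chartAt (Coord n) (c : M)).open_source)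
    (by
      intro x hx
      obtain ⟨c, hc, hxc⟩ := Set.mem_iUnion₂.1 (ht.2 hx)
      exact Set.mem_iUnion.2 ⟨⟨c, hc⟩, hxc⟩)
  have hsum : ∀ x, ∑ c, χ c x = 1 := fun x => by
    rw [← finsum_eq_sum_of_fintype]
    exact χ.sum_eq_one (Set.mem_univ x)
  have hχsm : ∀ c, ContMDiff (𝓡 n) 𝓘(ℝ, ℝ) ∞ (χ c) := fun c => (χ c).contMDiff
  have hχ1 : ∀ c, ContMDiff (𝓡 n) 𝓘(ℝ, ℝ) 1 (χ c) := fun c => (hχsm c).of_le (by exact_mod_cast le_top)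
  have h := Approximable.sum hp g Finset.univ
    (F := fun c x => χ c x * f x) (X := fun c x => χ c x • V x + f x • grad g (χ c) x)
    (fun c _ => (MeasField.smul (hχsm c).continuous.aemeasurable
      (measField_of_isWeakGradient hV)).add
      (MeasField.smul hf.aemeasurable (measField_grad g (hχ1 c))))
    (fun c _ => approximable_mul g hp hpn (chart_mem_atlas _ _) (hχsm c) (hχ c) hf hV hE)
  have h1 : (fun x => ∑ c, χ c x * f x) = f := by
    ext x
    rw [← Finset.sum_mul, hsum, one_mul]
  have h2 : (fun x => ∑ c, (χ c x • V x + f x • grad g (χ c) x)) = V := by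
    ext1 x
    rw [Finset.sum_add_distrib, ← Finset.sum_smul, hsum, one_smul, ← Finset.smul_sum,
      ← grad_sum g Finset.univ (fun c _ => hχ1 c) x]
    simp only [hsum]
    rw [grad_const, smul_zero, add_zero]
  rwa [h1, h2] at h

end Approximation

/-! ### Competitors near the limit metric: the lower bound -/

section Competitors

variable {n : ℕ} {M : Type*} [TopologicalSpace M] [ChartedSpace (Coord n) M]
  [IsManifold (𝓡 n) ∞ M]

lemma continuous_nrm_grad (g : Metric n M) {h : M → ℝ} (hh : ContMDiff (𝓡 n) 𝓘(ℝ, ℝ) 1 h) :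
    Continuous fun x => nrm g x (grad g h x) := by
  refine Real.continuous_sqrt.comp (continuous_of_charts (n := n) fun e he => ?_)
  have h1 : ContinuousOn (fun x => ∑ i, ∑ j, ip g x (grad g h x) (coordField e i x) *
      (gmat g e x)⁻¹ i j * ip g x (grad g h x) (coordField e j x)) e.source := by
    refine continuousOn_finsetSum _ fun i _ => continuousOn_finsetSum _ fun j _ => ?_
    exact ((continuousOn_ip_grad_coordField g he hh i).mul
      (continuousOn_pi.1 (continuousOn_pi.1 (continuousOn_gmat_inv g he) i) j)).mul
      (continuousOn_ip_grad_coordField g he hh j)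
  exact h1.congr fun x hx => ip_eq_sum_inv g he hx _ _

lemma holder_le_iff [PreconnectedSpace M] {p : ℝ} (hp : 0 < p) (hpn : (n : ℝ) < p)
    (g : Metric n M) {f : M → ℝ} {D : ℝ} :
    holder p g f ≤ ENNReal.ofReal D ↔
      ∀ x y, ‖f x - f y‖ₑ ≤ ENNReal.ofReal D * riemDist g x y ^ ((p - n) / p) := by
  have hα : 0 < (p - n) / p := div_pos (by linarith) hp
  unfold holder
  simp only [iSup_le_iff]
  refine forall₂_congr fun x y => ?_
  rw [ENNReal.div_le_iff_le_mul (Or.inr ENNReal.ofReal_ne_top)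
    (Or.inl (ENNReal.rpow_ne_top_of_nonneg hα.le (riemDist_ne_top g x y))),
    ← Real.norm_eq_abs, ofReal_norm]

lemma continuous_of_holder {α D : ℝ} (hα : 0 < α) (g : Metric n M) {f : M → ℝ}
    (hf : ∀ x y, ‖f x - f y‖ₑ ≤ ENNReal.ofReal D * riemDist g x y ^ α) : Continuous f := by
  refine continuous_iff_continuousAt.2 fun x => ?_
  have hd : Tendsto (fun y => riemDist g x y) (𝓝 x) (𝓝 0) := by
    rw [ENNReal.tendsto_nhds_zero]
    exact fun ε hε => (eventually_riemDist_lt g x hε).mono fun y hy => hy.le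
  have h1 : Tendsto (fun y => ENNReal.ofReal D * riemDist g x y ^ α) (𝓝 x) (𝓝 0) := by
    have h2 := ((ENNReal.continuous_rpow_const (y := α)).tendsto 0).comp hd
    rw [ENNReal.zero_rpow_of_pos hα] at h2
    simpa using ENNReal.Tendsto.const_mul h2 (Or.inr ENNReal.ofReal_ne_top)
  rw [ContinuousAt, tendsto_iff_edist_tendsto_0]
  refine tendsto_of_tendsto_of_tendsto_of_le_of_le tendsto_const_nhds h1 (fun _ => zero_le)
    fun y => ?_
  beta_reduce
  rw [edist_comm, edist_eq_enorm_sub]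
  exact hf x y

variable [MeasurableSpace M]

lemma admissible_iff {p D : ℝ} {g g₀ : Metric n M} {f : M → ℝ} :
    Admissible p D g g₀ f ↔ holder p g₀ f ≤ ENNReal.ofReal D ∧ ∃ V : M → Coord n,
      IsWeakGradient g f V ∧ ∫⁻ x, ENNReal.ofReal (nrm g x (V x) ^ p) ∂(vol g) ≤ 1 := Iff.rfl

variable [BorelSpace M] [CompactSpace M] [Nonempty M]

/-- The energy of a field with respect to `g`, computed with the volume of `g₀`. -/
lemma lintegral_energy_eq (g₀ g : Metric n M) (p : ℝ) (V : M → Coord n) :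
    ∫⁻ x, ENNReal.ofReal (nrm g x (V x) ^ p) ∂(vol g) =
      ∫⁻ x, ENNReal.ofReal (nrm g x (V x) ^ p * volRatio g₀ g x) ∂(vol g₀) := by
  rw [vol_eq_withDensity g₀ g, lintegral_withDensity_eq_lintegral_mul_non_measurable _
    (continuous_volRatio g₀ g).measurable.ennreal_ofReal
    (Eventually.of_forall fun _ => ENNReal.ofReal_lt_top)]
  refine lintegral_congr fun x => ?_
  rw [Pi.mul_apply, mul_comm, ENNReal.ofReal_mul (Real.rpow_nonneg (nrm_nonneg _ _ _) _)]

/-- Let `g j` be metrics with `|g j|` bounded in `L^(n/2)` and `|(g j)⁻¹ - g₀⁻¹| → 0` in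
`L^(n(p-1)/2)`. If a `C¹` function has energy less than `1` for `g₀`, it has energy at most `1` for
`g j`, for large `j`. -/
lemma eventually_energy_le (hn : 0 < n) {p : ℝ} (hp : 1 < p) {g₀ : Metric n M}
    {g : ℕ → Metric n M} {C : ℝ≥0∞} (hC : C ≠ ⊤)
    (hgC : ∀ j, ∫⁻ x, ENNReal.ofReal (normMetric g₀ (g j) x ^ ((n : ℝ) / 2)) ∂(vol g₀) ≤ C)
    (hg : Tendsto (fun j => ∫⁻ x, ENNReal.ofReal
      (normInvDiff g₀ (g j) x ^ ((n : ℝ) * (p - 1) / 2)) ∂(vol g₀)) atTop (𝓝 0))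
    {h : M → ℝ} (hh : ContMDiff (𝓡 n) 𝓘(ℝ, ℝ) 1 h)
    (hE : ∫⁻ x, ENNReal.ofReal (nrm g₀ x (grad g₀ h x) ^ p) ∂(vol g₀) < 1) :
    ∀ᶠ j in atTop, ∫⁻ x, ENNReal.ofReal (nrm (g j) x (grad (g j) h x) ^ p) ∂(vol (g j)) ≤ 1 := by
  have hn' : (1 : ℝ) ≤ n := by exact_mod_cast hn
  set F : M → ℝ≥0∞ := fun x => ENNReal.ofReal (nrm g₀ x (grad g₀ h x) ^ p) with hF
  have hcont : Continuous fun x => nrm g₀ x (grad g₀ h x) ^ p :=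
    (continuous_nrm_grad g₀ hh).rpow_const fun _ => Or.inr (by linarith)
  obtain ⟨L, hL⟩ := isCompact_univ.exists_bound_of_continuousOn hcont.continuousOn
  set E := ∫⁻ x, F x ∂(vol g₀) with hEdef
  obtain ⟨δ, hδE, hδ1, hδ0⟩ : ∃ δ : ℝ, ENNReal.ofReal ((1 + δ) ^ ((p - 1) / 2) *
      (1 - δ)⁻¹ ^ (((n : ℝ) - 1) / 2)) * E < 1 ∧ δ < 1 ∧ 0 < δ := by
    have h1 : Tendsto (fun δ : ℝ => ENNReal.ofReal ((1 + δ) ^ ((p - 1) / 2) *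
        (1 - δ)⁻¹ ^ (((n : ℝ) - 1) / 2)) * E) (𝓝[>] 0) (𝓝 E) := by
      have h2 : ContinuousAt (fun δ : ℝ => (1 + δ) ^ ((p - 1) / 2) *
          (1 - δ)⁻¹ ^ (((n : ℝ) - 1) / 2)) 0 := by
        refine ContinuousAt.mul ?_ ?_
        · exact (continuousAt_const.add continuousAt_id).rpow_const (Or.inl (by norm_num))
        · exact ((continuousAt_const.sub continuousAt_id).inv₀ (by norm_num)).rpow_const
            (Or.inl (by norm_num))
      have h3 := (ENNReal.continuous_ofReal.tendsto _).comp
        (h2.tendsto.mono_left (nhdsWithin_le_nhds (s := Set.Ioi (0 : ℝ))))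
      have h4 := ENNReal.Tendsto.mul_const (b := E) h3 (Or.inr (hE.trans ENNReal.one_lt_top).ne)
      simpa [Function.comp_def] using h4
    have h5 : ∀ᶠ δ : ℝ in 𝓝[>] 0, δ < 1 := nhdsWithin_le_nhds (Iio_mem_nhds one_pos)
    obtain ⟨δ, h6, h7, h8⟩ := ((h1.eventually (gt_mem_nhds hE)).and
      (h5.and self_mem_nhdsWithin)).exists
    exact ⟨δ, h6, h7, h8⟩
  have hn0 : (n : ℝ) ≠ 0 := by linarith
  have hw := eventually_lintegral_weight_le (μ := vol g₀) (s := (n : ℝ) / 2)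
    (t := (n : ℝ) * (p - 1) / 2) (θ := ((n : ℝ) - 1) / n) (α := (p - 1) / 2) hδ0 hδ1 (by linarith)
    (by positivity) (by have : 0 < p - 1 := by linarith
                        positivity)
    (div_nonneg (by linarith) (by linarith)) (by rw [div_lt_one (by linarith)]; linarith)
    (le_of_eq (by field_simp; ring))
    (N := fun j => normInvDiff g₀ (g j)) (S := fun j => normMetric g₀ (g j))
    (fun j => (continuous_normInvDiff g₀ (g j)).measurable)
    (fun j => (continuous_normMetric g₀ (g j)).measurable)
    (fun j => normInvDiff_nonneg g₀ (g j)) (fun j => normMetric_nonneg g₀ (g j)) hC hgC hg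
    (F := F) hcont.measurable.ennreal_ofReal.aemeasurable (L := ENNReal.ofReal L)
    ENNReal.ofReal_ne_top (fun x => ENNReal.ofReal_le_ofReal ((le_abs_self _).trans (hL x trivial)))
    (tsub_pos_of_lt hδE)
  filter_upwards [hw] with j hj
  have hθ : ((n : ℝ) - 1) / n * (n / 2) = ((n : ℝ) - 1) / 2 := by field_simp
  rw [hθ, add_tsub_cancel_of_le hδE.le] at hj
  rw [lintegral_energy_eq g₀]
  refine le_trans (lintegral_mono fun x => ?_) hj
  have h1 := (nrm_rpow_comparison (v := grad (g j) h x) (w := grad g₀ h x) hn hp.le hδ1 g₀ (g j) x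
    fun u => by rw [ip_grad, ip_grad]).1
  rw [hF, ← ENNReal.ofReal_mul' (Real.rpow_nonneg (nrm_nonneg _ _ _) _)]
  exact ENNReal.ofReal_le_ofReal h1

/-- A competitor for `g₀` is a limit of competitors for the metrics `g j`. -/
lemma eventually_exists_competitor [T2Space M] [PreconnectedSpace M] (hn : 0 < n) {p D : ℝ}
    (hpn : (n : ℝ) < p) (hD : 0 < D) {g₀ : Metric n M}
    {g : ℕ → Metric n M} {C : ℝ≥0∞} (hC : C ≠ ⊤)
    (hgC : ∀ j, ∫⁻ x, ENNReal.ofReal (normMetric g₀ (g j) x ^ ((n : ℝ) / 2)) ∂(vol g₀) ≤ C)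
    (hg : Tendsto (fun j => ∫⁻ x, ENNReal.ofReal
      (normInvDiff g₀ (g j) x ^ ((n : ℝ) * (p - 1) / 2)) ∂(vol g₀)) atTop (𝓝 0))
    {f : M → ℝ} (hf : Admissible p D g₀ g₀ f) (x y : M) {ε : ℝ} (hε : 0 < ε) :
    ∀ᶠ j in atTop, ∃ h, Admissible p D (g j) g₀ h ∧ |f x - f y| - ε ≤ |h x - h y| := by
  have hn' : (1 : ℝ) ≤ n := by exact_mod_cast hn
  have hp : 1 < p := by linarith
  have hp0 : 0 < p := by linarith
  obtain ⟨hfD, V, hV, hE'⟩ := admissible_iff.1 hf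
  rw [holder_le_iff hp0 hpn] at hfD
  have hfc := continuous_of_holder (div_pos (by linarith) hp0) g₀ hfD
  have happ := approximable_of_isWeakGradient g₀ hp.le hpn hfc hV (hE'.trans_lt ENNReal.one_lt_top).ne
  -- the factor `s < 1` makes room in both constraints for the error of the approximation
  obtain ⟨s, hs1, hs0, hsε⟩ : ∃ s : ℝ, s < 1 ∧ 0 < s ∧ (1 - s) * |f x - f y| < ε / 2 := by
    have h1 : Tendsto (fun s : ℝ => (1 - s) * |f x - f y|) (𝓝[<] 1) (𝓝 0) := by
      have : Continuous fun s : ℝ => (1 - s) * |f x - f y| := by fun_prop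
      have h2 := (this.tendsto 1).mono_left (nhdsWithin_le_nhds (s := Set.Iio (1 : ℝ)))
      simpa using h2
    have h3 : ∀ᶠ s : ℝ in 𝓝[<] 1, 0 < s := nhdsWithin_le_nhds (Ioi_mem_nhds one_pos)
    obtain ⟨s, h4, h5, h6⟩ := ((h1.eventually (gt_mem_nhds (half_pos hε))).and
      (h3.and self_mem_nhdsWithin)).exists
    exact ⟨s, h6, h5, h4⟩
  obtain ⟨η, hη0, hηε, hηD, hηE⟩ : ∃ η : ℝ, 0 < η ∧ η < ε / 4 ∧ s * (D + η) < D ∧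
      ENNReal.ofReal s * (1 + ENNReal.ofReal η ^ (1 / p)) < 1 := by
    have h1 : Tendsto (fun η : ℝ => s * (D + η)) (𝓝[>] 0) (𝓝 (s * D)) := by
      have : Continuous fun η : ℝ => s * (D + η) := by fun_prop
      have h2 := (this.tendsto 0).mono_left (nhdsWithin_le_nhds (s := Set.Ioi (0 : ℝ)))
      simpa using h2
    have h2 : Tendsto (fun η : ℝ => ENNReal.ofReal s * (1 + ENNReal.ofReal η ^ (1 / p))) (𝓝[>] 0)
        (𝓝 (ENNReal.ofReal s)) := by
      have h0 : Tendsto (fun δ : ℝ => ENNReal.ofReal δ) (𝓝[>] 0) (𝓝 0) := by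
        simpa using (ENNReal.continuous_ofReal.tendsto 0).mono_left
          (nhdsWithin_le_nhds (s := Set.Ioi (0 : ℝ)))
      have h3 := ((ENNReal.continuous_rpow_const (y := 1 / p)).tendsto 0).comp h0
      rw [ENNReal.zero_rpow_of_pos (by positivity)] at h3
      have h4 := ENNReal.Tendsto.const_mul (a := ENNReal.ofReal s)
        ((tendsto_const_nhds (x := (1 : ℝ≥0∞))).add h3) (Or.inr ENNReal.ofReal_ne_top)
      simpa [Function.comp_def] using h4
    have h3 : ∀ᶠ η : ℝ in 𝓝[>] 0, η < ε / 4 := nhdsWithin_le_nhds (Iio_mem_nhds (by positivity))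
    have h4 : s * D < D := by nlinarith
    have h5 : ENNReal.ofReal s < 1 := by rwa [ENNReal.ofReal_lt_one]
    obtain ⟨η, h6, h7, h8, h9⟩ := ((h1.eventually (gt_mem_nhds h4)).and
      ((h2.eventually (gt_mem_nhds h5)).and (h3.and self_mem_nhdsWithin))).exists
    exact ⟨η, h9, h8, h6, h7⟩
  obtain ⟨w, hw, hwf, hwh, hwE⟩ := happ η hη0
  have hw1 : ContMDiff (𝓡 n) 𝓘(ℝ, ℝ) 1 fun z => s * w z := contMDiff_const.mul hw
  have henergy : ∫⁻ z, ENNReal.ofReal (nrm g₀ z (grad g₀ (fun z => s * w z) z) ^ p) ∂(vol g₀) < 1 := by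
    have hVm := measField_of_isWeakGradient hV
    have hDm : MeasField g₀ fun z => grad g₀ w z - V z := (measField_grad g₀ hw).sub hVm
    have h1 := ENNReal.lintegral_Lp_add_le (μ := vol g₀) (p := p)
      (f := fun z => ENNReal.ofReal (nrm g₀ z (V z)))
      (g := fun z => ENNReal.ofReal (nrm g₀ z (grad g₀ w z - V z)))
      hVm.nrm.ennreal_ofReal hDm.nrm.ennreal_ofReal hp.le
    have h2 : (∫⁻ z, (ENNReal.ofReal (nrm g₀ z (V z))) ^ p ∂(vol g₀)) ^ (1 / p) ≤ 1 := by
      refine (ENNReal.rpow_le_rpow ?_ (by positivity)).trans_eq (ENNReal.one_rpow (1 / p))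
      refine (lintegral_congr fun z => ?_).trans_le hE'
      rw [ENNReal.ofReal_rpow_of_nonneg (nrm_nonneg _ _ _) hp0.le]
    have h3 : (∫⁻ z, (ENNReal.ofReal (nrm g₀ z (grad g₀ w z - V z))) ^ p ∂(vol g₀)) ^ (1 / p) ≤
        ENNReal.ofReal η ^ (1 / p) := by
      refine ENNReal.rpow_le_rpow ?_ (by positivity)
      refine (lintegral_congr fun z => ?_).trans_le hwE
      rw [ENNReal.ofReal_rpow_of_nonneg (nrm_nonneg _ _ _) hp0.le]
    have h4 : (∫⁻ z, ENNReal.ofReal (nrm g₀ z (grad g₀ w z) ^ p) ∂(vol g₀)) ^ (1 / p) ≤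
        1 + ENNReal.ofReal η ^ (1 / p) := by
      refine le_trans (ENNReal.rpow_le_rpow (lintegral_mono fun z => ?_) (by positivity))
        (h1.trans (add_le_add h2 h3))
      rw [← ENNReal.ofReal_rpow_of_nonneg (nrm_nonneg _ _ _) hp0.le, Pi.add_apply,
        ← ENNReal.ofReal_add (nrm_nonneg _ _ _) (nrm_nonneg _ _ _)]
      gcongr
      refine le_trans (le_of_eq ?_) (nrm_add_le _ _ _ _)
      rw [add_sub_cancel]
    have h5 : ∫⁻ z, ENNReal.ofReal (nrm g₀ z (grad g₀ (fun z => s * w z) z) ^ p) ∂(vol g₀) =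
        ENNReal.ofReal s ^ p * ∫⁻ z, ENNReal.ofReal (nrm g₀ z (grad g₀ w z) ^ p) ∂(vol g₀) := by
      rw [← lintegral_const_mul' _ _ (ENNReal.rpow_ne_top_of_nonneg hp0.le ENNReal.ofReal_ne_top)]
      refine lintegral_congr fun z => ?_
      rw [grad_const_smul g₀ s (hw.mdifferentiable one_ne_zero z), nrm_smul, abs_of_pos hs0,
        Real.mul_rpow hs0.le (nrm_nonneg _ _ _), ENNReal.ofReal_mul (by positivity),
        ENNReal.ofReal_rpow_of_nonneg hs0.le hp0.le]
    have h6 : (∫⁻ z, ENNReal.ofReal (nrm g₀ z (grad g₀ (fun z => s * w z) z) ^ p) ∂(vol g₀)) ^ (1 / p) <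
        1 := by
      rw [h5, ENNReal.mul_rpow_of_nonneg _ _ (by positivity), ← ENNReal.rpow_mul,
        mul_one_div_cancel hp0.ne', ENNReal.rpow_one]
      refine lt_of_le_of_lt ?_ hηE
      gcongr
    by_contra hcon
    rw [not_lt] at hcon
    have := ENNReal.rpow_le_rpow hcon (z := 1 / p) (by positivity)
    rw [ENNReal.one_rpow] at this
    exact absurd h6 (not_lt.2 this)
  filter_upwards [eventually_energy_le hn hp hC hgC hg hw1 henergy] with j hj
  refine ⟨fun z => s * w z, ⟨?_, grad (g j) (fun z => s * w z), isWeakGradient_grad (g j) hw1, hj⟩, ?_⟩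
  · rw [holder_le_iff hp0 hpn]
    intro a b
    have h1 : s * w a - s * w b = s * ((f a - f b) + ((w a - f a) - (w b - f b))) := by ring
    calc ‖s * w a - s * w b‖ₑ
        ≤ ENNReal.ofReal s * (‖f a - f b‖ₑ + ‖(w a - f a) - (w b - f b)‖ₑ) := by
          rw [h1, enorm_mul, Real.enorm_of_nonneg hs0.le]
          gcongr
          exact enorm_add_le _ _
      _ ≤ ENNReal.ofReal s * (ENNReal.ofReal D * riemDist g₀ a b ^ ((p - n) / p) +
          ENNReal.ofReal η * riemDist g₀ a b ^ ((p - n) / p)) := by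
          gcongr
          · exact hfD a b
          · exact hwh a b
      _ = ENNReal.ofReal (s * (D + η)) * riemDist g₀ a b ^ ((p - n) / p) := by
          rw [ENNReal.ofReal_mul hs0.le, ENNReal.ofReal_add hD.le hη0.le]
          ring
      _ ≤ _ := by gcongr
  · have h1 : |f x - f y| ≤ |w x - w y| + 2 * η := by
      have h2 : f x - f y = (w x - w y) - (w x - f x) + (w y - f y) := by ring
      calc |f x - f y| = |(w x - w y) - (w x - f x) + (w y - f y)| := by rw [← h2]
        _ ≤ |w x - w y| + |w x - f x| + |w y - f y| :=
            (abs_add_le _ _).trans (by gcongr; exact abs_sub _ _)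
        _ ≤ _ := by linarith [hwf x, hwf y]
    have h3 : |s * w x - s * w y| = s * |w x - w y| := by
      rw [← mul_sub, abs_mul, abs_of_pos hs0]
    rw [h3]
    have h4 : 0 ≤ |w x - w y| := abs_nonneg _
    nlinarith [mul_le_mul_of_nonneg_left h1 hs0.le]

end Competitors

/-! ### A bounded measurable frame -/

section Frame

variable {n : ℕ} {M : Type*} [TopologicalSpace M] [ChartedSpace (Coord n) M]
  [IsManifold (𝓡 n) ∞ M] [MeasurableSpace M] [BorelSpace M]

/-- Coordinate fields, multiplied by a measurable function and extended by zero, are measurable. -/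
lemma measField_indicator_smul_coordField (g : Metric n M) {e : OpenPartialHomeomorph M (Coord n)}
    (he : e ∈ atlas (Coord n) M) {c : M → ℝ} (hc : AEMeasurable c ((vol g).restrict e.source))
    (i : Fin n) : MeasField g (e.source.indicator fun x => c x • coordField e i x) := by
  intro e' he' j
  have h1 : AEMeasurable (fun x => c x * ip g x (coordField e i x) (coordField e' j x))
      ((vol g).restrict (e.source ∩ e'.source)) :=
    (hc.mono_measure (Measure.restrict_mono_set _ Set.inter_subset_left)).mul
      ((continuousOn_ip_coordField g he he' i j).aemeasurable
        (e.open_source.inter e'.open_source).measurableSet)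
  have h2 : (fun x => ip g x (e.source.indicator (fun x => c x • coordField e i x) x)
      (coordField e' j x)) =
      e.source.indicator fun x => c x * ip g x (coordField e i x) (coordField e' j x) := by
    ext x
    by_cases hx : x ∈ e.source
    · simp [hx]
    · simp [hx]
  rw [h2, aemeasurable_indicator_iff e.open_source.measurableSet,
    Measure.restrict_restrict e.open_source.measurableSet]
  exact h1

variable [CompactSpace M] [T2Space M] [Nonempty M]

/-- There is a measurable frame `X` of the tangent spaces, bounded for `g`, such that the
coefficients `T x v` of a vector `v` in this frame are bounded by the norm of `v`. -/
lemma exists_frame (g : Metric n M) :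
    ∃ (X : Fin n → M → Coord n) (T : M → Coord n →L[ℝ] Coord n) (C : ℝ), 0 < C ∧
      (∀ i, MeasField g (X i)) ∧ (∀ x v, v = ∑ i, T x v i • X i x) ∧
      (∀ i x, nrm g x (X i x) ≤ C) ∧ (∀ x v, ‖T x v‖ ≤ C * nrm g x v) ∧
      ∀ Y : M → Coord n, MeasField g Y → ∀ i, AEMeasurable (fun x => T x (Y x) i) (vol g) := by
  have hloc : ∀ x : M, ∃ K : Set M, IsCompact K ∧ x ∈ interior K ∧ K ⊆ (chartAt (Coord n) x).source :=
    fun x => exists_compact_subset (chartAt (Coord n) x).open_source (mem_chart_source _ x)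
  choose K hK hxK hKe using hloc
  obtain ⟨t, ht⟩ := isCompact_univ.elim_nhds_subcover (fun x : M => interior (K x))
    fun x _ => isOpen_interior.mem_nhds (hxK x)
  have htne : (t : Set M).Nonempty := by
    obtain ⟨c, hc, -⟩ := Set.mem_iUnion₂.1 (ht.2 (Set.mem_univ (Classical.arbitrary M)))
    exact ⟨c, hc⟩
  obtain ⟨c, hc⟩ := t.countable_toSet.exists_eq_range htne
  have hcov : ∀ x, ∃ k, x ∈ interior (K (c k)) := by
    intro x
    obtain ⟨z, hz, hxz⟩ := Set.mem_iUnion₂.1 (ht.2 (Set.mem_univ x))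
    have : z ∈ Set.range c := hc ▸ hz
    obtain ⟨k, rfl⟩ := this
    exact ⟨k, hxz⟩
  classical
  -- `a x` is the first chart of the sequence whose distinguished compact set contains `x`
  set a : M → ℕ := fun x => Nat.find (hcov x) with ha
  have ham : Measurable a := measurable_find hcov fun k => isOpen_interior.measurableSet
  have haK : ∀ x, x ∈ K (c (a x)) := fun x => interior_subset (Nat.find_spec (hcov x))
  set e : ℕ → OpenPartialHomeomorph M (Coord n) := fun k => chartAt (Coord n) (c k) with he
  have hea : ∀ k, e k ∈ atlas (Coord n) M := fun k => chart_mem_atlas _ _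
  have hae : ∀ x, x ∈ (e (a x)).source := fun x => hKe _ (haK x)
  have hpiece : ∀ {ν : Measure M} {F : M → ℝ} (G : ℕ → M → ℝ),
      (∀ k, AEMeasurable (G k) (ν.restrict (e k).source)) → (∀ x, F x = G (a x) x) →
      AEMeasurable F ν := by
    intro ν F G hG hF
    have hU : ⋃ k, a ⁻¹' {k} = Set.univ := by
      ext x; simp
    rw [← Measure.restrict_univ (μ := ν), ← hU]
    refine aemeasurable_iUnion_iff.2 fun k => ?_
    have hm : MeasurableSet (a ⁻¹' {k}) := ham (measurableSet_singleton k)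
    have hsub : a ⁻¹' {k} ⊆ (e k).source := by
      rintro x rfl
      exact hae x
    refine ((hG k).mono_measure (Measure.restrict_mono_set _ hsub)).congr ?_
    filter_upwards [ae_restrict_mem hm] with x hx
    rw [hF x]
    simp only [Set.mem_preimage, Set.mem_singleton_iff] at hx
    rw [hx]
  have hC1 : ∀ z, ∃ C : ℝ, 0 < C ∧ (∀ x ∈ K z, ∀ i, nrm g x (coordField (chartAt (Coord n) z) i x) ≤ C) ∧
      ∀ x ∈ K z, ∀ v, ‖chartD (chartAt (Coord n) z) x v‖ ≤ C * nrm g x v := by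
    intro z
    obtain ⟨C₁, hC₁, h1⟩ := exists_nrm_coordField_le g (chart_mem_atlas (Coord n) z) (hK z) (hKe z)
    obtain ⟨C₂, hC₂, h2⟩ := exists_norm_chartD_le g (chart_mem_atlas (Coord n) z) (hK z) (hKe z)
    refine ⟨C₁ + C₂, by positivity, fun x hx i => (h1 x hx i).trans (by linarith), fun x hx v =>
      (h2 x hx v).trans ?_⟩
    gcongr
    · exact nrm_nonneg _ _ _
    · linarith
  choose C hC0 hC1 hC2 using hC1
  have hct : ∀ k, c k ∈ t := fun k => by
    have : c k ∈ (t : Set M) := hc ▸ Set.mem_range_self k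
    exact this
  have hCle : ∀ k, C (c k) ≤ ∑ z ∈ t, C z := fun k =>
    Finset.single_le_sum (fun z _ => (hC0 z).le) (hct k)
  refine ⟨fun i x => coordField (e (a x)) i x, fun x => chartD (e (a x)) x, ∑ z ∈ t, C z,
    (hC0 _).trans_le (hCle 0), fun i e' he' j => ?_, fun x v => eq_sum_coordField (hea _) (hae x) v,
    fun i x => (hC1 _ x (haK x) i).trans (hCle _), fun x v => (hC2 _ x (haK x) v).trans ?_,
    fun Y hY i => ?_⟩
  · refine hpiece (fun k x => ip g x (coordField (e k) i x) (coordField e' j x)) (fun k => ?_)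
      fun x => rfl
    rw [Measure.restrict_restrict (e k).open_source.measurableSet]
    exact (continuousOn_ip_coordField g (hea k) he' i j).aemeasurable
      ((e k).open_source.inter e'.open_source).measurableSet
  · gcongr
    · exact nrm_nonneg _ _ _
    · exact hCle _
  · refine hpiece (fun k x => ∑ j, ip g x (Y x) (coordField (e k) j x) * (gmat g (e k) x)⁻¹ j i)
      (fun k => ?_) fun x => chartD_apply_eq g (hea _) (hae x) _ _
    refine Finset.aemeasurable_fun_sum _ fun j _ => (hY _ (hea k) j).mul ?_
    exact (continuousOn_pi.1 (continuousOn_pi.1 (continuousOn_gmat_inv g (hea k)) j) i).aemeasurable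
      (e k).open_source.measurableSet

end Frame

/-! ### Integrability of gradients with respect to the limit metric -/

section WeightedBounds

variable {n : ℕ} {M : Type*} [TopologicalSpace M] [ChartedSpace (Coord n) M]
  [IsManifold (𝓡 n) ∞ M]

lemma upperEig_nonneg {δ : ℝ} (hδ : δ < 1) (g₀ g : Metric n M) (x : M) : 0 ≤ upperEig δ g₀ g x := by
  unfold upperEig
  split_ifs
  · exact inv_nonneg.2 (by linarith)
  · exact normMetric_nonneg _ _ _

/-- Pointwise form of the Hölder estimate for the `q`-th power of the norm of a covector. -/
lemma nrm_rpow_le_mul {p q δ : ℝ} (hn : 0 < n) (hp : 1 ≤ p) (hq : 0 < q) (hqp : q < p) (hδ : δ < 1)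
    (g₀ g : Metric n M) (x : M) {v w : Coord n} (hvw : ∀ u, ip g₀ x w u = ip g x v u) :
    nrm g₀ x w ^ q ≤ (nrm g x v ^ p * volRatio g₀ g x) ^ (q / p) *
      ((1 + normInvDiff g₀ g x) ^ (q * ((n : ℝ) - 1) / (2 * (p - q))) *
        upperEig δ g₀ g x ^ (q * (p - 1) / (2 * (p - q)))) ^ ((p - q) / p) := by
  have hp0 : 0 < p := by linarith
  have hpq : 0 < p - q := by linarith
  have h1 := (nrm_rpow_comparison hn hp hδ g₀ g x hvw).2
  have hN : 0 ≤ 1 + normInvDiff g₀ g x := by have := normInvDiff_nonneg g₀ g x; linarith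
  have hU := upperEig_nonneg hδ g₀ g x
  have hE : 0 ≤ nrm g x v ^ p * volRatio g₀ g x :=
    mul_nonneg (Real.rpow_nonneg (nrm_nonneg _ _ _) _) (volRatio_pos _ _ _).le
  have hw0 := nrm_nonneg g₀ x w
  calc nrm g₀ x w ^ q = (nrm g₀ x w ^ p) ^ (q / p) := by
        rw [← Real.rpow_mul hw0, mul_div_cancel₀ _ hp0.ne']
    _ ≤ ((upperEig δ g₀ g x ^ ((p - 1) / 2) * (1 + normInvDiff g₀ g x) ^ (((n : ℝ) - 1) / 2)) *
        (nrm g x v ^ p * volRatio g₀ g x)) ^ (q / p) := by gcongr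
    _ = _ := by
        rw [Real.mul_rpow (by positivity) hE, mul_comm,
          Real.mul_rpow (Real.rpow_nonneg hU _) (Real.rpow_nonneg hN _),
          Real.mul_rpow (Real.rpow_nonneg hN _) (Real.rpow_nonneg hU _),
          ← Real.rpow_mul hN, ← Real.rpow_mul hN, ← Real.rpow_mul hU, ← Real.rpow_mul hU,
          mul_comm (upperEig δ g₀ g x ^ _)]
        congr 3 <;> field_simp

variable [MeasurableSpace M] [BorelSpace M] [CompactSpace M] [Nonempty M]

lemma vol_absolutelyContinuous (g₀ g : Metric n M) : vol g₀ ≪ vol g := by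
  rw [vol_eq_withDensity g g₀]
  exact withDensity_absolutelyContinuous _ _

/-- Let `g j` be metrics with `|g j|` bounded in `L^(n/2)` and `|(g j)⁻¹ - g₀⁻¹| → 0` in
`L^(n(p-1)/2)`. Let `W` represent for `g₀` the covectors that `V`, a field of energy at most `1`,
represents for `g j`. The integral of `|W|^q F` is then asymptotically bounded by the
`L^(p/(p-q))` norm of `F`, as it would be, by Hölder's inequality, if `g j` were `g₀`. -/
lemma eventually_lintegral_nrm_rpow_le (hn : 0 < n) {p q δ : ℝ} (hp : 1 ≤ p) (hq : 0 < q) (hqp : q < p)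
    (hθ : q * (p - 1) < n * (p - q))
    (hα : q * ((n : ℝ) - 1) / (2 * (p - q)) ≤
      (1 - q * (p - 1) / (n * (p - q))) * ((n : ℝ) * (p - 1) / 2))
    (hδ0 : 0 < δ) (hδ1 : δ < 1) {g₀ : Metric n M}
    {g : ℕ → Metric n M} {C : ℝ≥0∞} (hC : C ≠ ⊤)
    (hgC : ∀ j, ∫⁻ x, ENNReal.ofReal (normMetric g₀ (g j) x ^ ((n : ℝ) / 2)) ∂(vol g₀) ≤ C)
    (hg : Tendsto (fun j => ∫⁻ x, ENNReal.ofReal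
      (normInvDiff g₀ (g j) x ^ ((n : ℝ) * (p - 1) / 2)) ∂(vol g₀)) atTop (𝓝 0))
    {F : M → ℝ≥0∞} (hF : AEMeasurable F (vol g₀)) {L : ℝ≥0∞} (hL : L ≠ ⊤) (hFL : ∀ x, F x ≤ L)
    {ε : ℝ≥0∞} (hε : 0 < ε) :
    ∀ᶠ j in atTop, ∀ V W : M → Coord n, MeasField (g j) V →
      (∀ x u, ip g₀ x (W x) u = ip (g j) x (V x) u) →
      ∫⁻ x, ENNReal.ofReal (nrm (g j) x (V x) ^ p) ∂(vol (g j)) ≤ 1 →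
      ∫⁻ x, ENNReal.ofReal (nrm g₀ x (W x) ^ q) * F x ∂(vol g₀) ≤
        (ENNReal.ofReal ((1 + δ) ^ (q * ((n : ℝ) - 1) / (2 * (p - q))) *
          (1 - δ)⁻¹ ^ (q * (p - 1) / (2 * (p - q)))) * ∫⁻ x, F x ^ (p / (p - q)) ∂(vol g₀) + ε) ^
            ((p - q) / p) := by
  have hn' : (1 : ℝ) ≤ n := by exact_mod_cast hn
  have hp0 : 0 < p := by linarith
  have hpq : 0 < p - q := by linarith
  have hw := eventually_lintegral_weight_le (μ := vol g₀) (s := (n : ℝ) / 2)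
    (t := (n : ℝ) * (p - 1) / 2) (θ := q * (p - 1) / (n * (p - q)))
    (α := q * ((n : ℝ) - 1) / (2 * (p - q))) hδ0 hδ1
    (div_nonneg (mul_nonneg hq.le (by linarith)) (by linarith))
    (by positivity) (by have : 0 ≤ p - 1 := by linarith
                        positivity)
    (div_nonneg (mul_nonneg hq.le (by linarith)) (by positivity))
    (by rw [div_lt_one (by positivity)]; exact hθ) hα
    (N := fun j => normInvDiff g₀ (g j)) (S := fun j => normMetric g₀ (g j))
    (fun j => (continuous_normInvDiff g₀ (g j)).measurable)
    (fun j => (continuous_normMetric g₀ (g j)).measurable)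
    (fun j => normInvDiff_nonneg g₀ (g j)) (fun j => normMetric_nonneg g₀ (g j)) hC hgC hg
    (F := fun x => F x ^ (p / (p - q))) (hF.pow_const _) (L := L ^ (p / (p - q)))
    (ENNReal.rpow_ne_top_of_nonneg (by positivity) hL)
    (fun x => ENNReal.rpow_le_rpow (hFL x) (by positivity)) hε
  have hβ : q * (p - 1) / (n * (p - q)) * ((n : ℝ) / 2) = q * (p - 1) / (2 * (p - q)) := by
    field_simp
  rw [hβ] at hw
  filter_upwards [hw] with j hj V W hV hVW hE
  rw [lintegral_energy_eq g₀] at hE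
  set w : M → ℝ := fun x => (1 + normInvDiff g₀ (g j) x) ^ (q * ((n : ℝ) - 1) / (2 * (p - q))) *
    (if normInvDiff g₀ (g j) x ≤ δ then (1 - δ)⁻¹ else normMetric g₀ (g j) x) ^
      (q * (p - 1) / (2 * (p - q))) with hwdef
  have hw0 : ∀ x, 0 ≤ w x := fun x => by
    have h1 := normInvDiff_nonneg g₀ (g j) x
    exact mul_nonneg (Real.rpow_nonneg (by linarith) _)
      (Real.rpow_nonneg (upperEig_nonneg hδ1 g₀ (g j) x) _)
  have hwm : Measurable w := by
    have h1 := (continuous_normInvDiff g₀ (g j)).measurable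
    have h2 := (continuous_normMetric g₀ (g j)).measurable
    exact ((h1.const_add 1).pow_const _).mul
      ((Measurable.ite (measurableSet_le h1 measurable_const) measurable_const h2).pow_const _)
  set E : M → ℝ := fun x => nrm (g j) x (V x) ^ p * volRatio g₀ (g j) x with hEdef
  have hE0 : ∀ x, 0 ≤ E x := fun x =>
    mul_nonneg (Real.rpow_nonneg (nrm_nonneg _ _ _) _) (volRatio_pos _ _ _).le
  have hEm : AEMeasurable E (vol g₀) :=
    ((hV.nrm.mono_ac (vol_absolutelyContinuous g₀ (g j))).pow_const p).mul
      (continuous_volRatio g₀ (g j)).aemeasurable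
  calc ∫⁻ x, ENNReal.ofReal (nrm g₀ x (W x) ^ q) * F x ∂(vol g₀)
      ≤ ∫⁻ x, ENNReal.ofReal (E x) ^ (q / p) *
          (ENNReal.ofReal (w x) * F x ^ (p / (p - q))) ^ ((p - q) / p) ∂(vol g₀) := by
        refine lintegral_mono fun x => ?_
        have h1 := nrm_rpow_le_mul hn hp hq hqp hδ1 g₀ (g j) x (hVW x)
        rw [ENNReal.mul_rpow_of_nonneg _ _ (by positivity), ← ENNReal.rpow_mul,
          div_mul_div_cancel₀ hpq.ne', div_self hp0.ne', ENNReal.rpow_one, ← mul_assoc,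
          ENNReal.ofReal_rpow_of_nonneg (hE0 x) (by positivity),
          ENNReal.ofReal_rpow_of_nonneg (hw0 x) (by positivity),
          ← ENNReal.ofReal_mul (Real.rpow_nonneg (hE0 x) _)]
        exact mul_le_mul_left (ENNReal.ofReal_le_ofReal h1) _
    _ ≤ (∫⁻ x, ENNReal.ofReal (E x) ∂(vol g₀)) ^ (q / p) *
        (∫⁻ x, ENNReal.ofReal (w x) * F x ^ (p / (p - q)) ∂(vol g₀)) ^ ((p - q) / p) :=
        ENNReal.lintegral_mul_norm_pow_le hEm.ennreal_ofReal
          (hwm.ennreal_ofReal.aemeasurable.mul (hF.pow_const _)) (by positivity) (by positivity)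
          (by field_simp; ring)
    _ ≤ 1 * (∫⁻ x, ENNReal.ofReal (w x) * F x ^ (p / (p - q)) ∂(vol g₀)) ^ ((p - q) / p) := by
        gcongr
        exact (ENNReal.rpow_le_rpow hE (by positivity)).trans_eq (ENNReal.one_rpow _)
    _ ≤ _ := by
        rw [one_mul]
        exact ENNReal.rpow_le_rpow hj (by positivity)

end WeightedBounds

/-! ### Weak limits of vector fields -/

/-- A sequence in a Hilbert space, bounded along an ultrafilter, converges weakly along it. -/
lemma exists_weak_limit {H : Type*} [NormedAddCommGroup H] [InnerProductSpace ℝ H] [CompleteSpace H]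
    (𝒰 : Ultrafilter ℕ) {A : ℕ → H} {R : ℝ} (hA : ∀ᶠ j in (𝒰 : Filter ℕ), ‖A j‖ ≤ R) :
    ∃ a : H, ∀ b, Tendsto (fun j => inner ℝ (A j) b) 𝒰 (𝓝 (inner ℝ a b)) := by
  set ℓ : ℕ → WeakDual ℝ H := fun j => StrongDual.toWeakDual (InnerProductSpace.toDual ℝ H (A j)) with hℓ
  have hc := WeakDual.isCompact_closedBall (𝕜 := ℝ) (E := H) 0 R
  obtain ⟨L, -, hL⟩ := hc.ultrafilter_le_nhds (𝒰.map ℓ) (by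
    rw [Ultrafilter.coe_map, le_principal_iff, mem_map]
    filter_upwards [hA] with j hj
    simpa [hℓ] using hj)
  refine ⟨(InnerProductSpace.toDual ℝ H).symm (WeakDual.toStrongDual L), fun b => ?_⟩
  have h1 : Tendsto ℓ 𝒰 (𝓝 L) := hL
  have h2 := ((WeakDual.eval_continuous (𝕜 := ℝ) b).tendsto L).comp h1
  rw [InnerProductSpace.toDual_symm_apply]
  exact h2

section WeakLimit

variable {n : ℕ} {M : Type*} [TopologicalSpace M] [ChartedSpace (Coord n) M]
  [IsManifold (𝓡 n) ∞ M] [MeasurableSpace M] [BorelSpace M] [CompactSpace M] [T2Space M] [Nonempty M]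

/-- Weak compactness of a sequence of fields bounded in `L²`. -/
lemma exists_weak_limit_field (g : Metric n M) (𝒰 : Ultrafilter ℕ) {W : ℕ → M → Coord n}
    (hW : ∀ j, MeasField g (W j)) {B : ℝ≥0∞} (hB : B ≠ ⊤)
    (hWB : ∀ᶠ j in (𝒰 : Filter ℕ), ∫⁻ x, ENNReal.ofReal (nrm g x (W j x) ^ (2 : ℝ)) ∂(vol g) ≤ B) :
    ∃ Z : M → Coord n, MeasField g Z ∧ ∀ Φ : M → Coord n, MeasField g Φ →
      ∀ L : ℝ, (∀ x, nrm g x (Φ x) ≤ L) →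
      Tendsto (fun j => ∫ x, ip g x (W j x) (Φ x) ∂(vol g)) 𝒰 (𝓝 (∫ x, ip g x (Z x) (Φ x) ∂(vol g))) := by
  have := isFiniteMeasure_vol g
  obtain ⟨X, T, C, hC0, hXm, hXT, hXC, hTC, hTm⟩ := exists_frame g
  set a : ℕ → M → Coord n := fun j x => WithLp.toLp 2 fun i => ip g x (W j x) (X i x) with ha
  have ham : ∀ j, AEStronglyMeasurable (a j) (vol g) := by
    intro j
    refine AEMeasurable.aestronglyMeasurable ?_
    have : AEMeasurable (fun x => fun i => ip g x (W j x) (X i x)) (vol g) :=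
      aemeasurable_pi_lambda _ fun i => (hW j).ip (hXm i)
    exact (PiLp.continuous_toLp 2 (fun _ : Fin n => ℝ)).measurable.comp_aemeasurable this
  have hanorm : ∀ j x, ‖a j x‖ ^ 2 ≤ n * C ^ 2 * nrm g x (W j x) ^ 2 := by
    intro j x
    rw [EuclideanSpace.norm_sq_eq]
    calc ∑ i, ‖a j x i‖ ^ 2 ≤ ∑ _i : Fin n, C ^ 2 * nrm g x (W j x) ^ 2 := by
          refine Finset.sum_le_sum fun i _ => ?_
          have h1 : ‖a j x i‖ ≤ C * nrm g x (W j x) := by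
            refine (abs_ip_le g x _ _).trans ?_
            rw [mul_comm]
            gcongr
            · exact nrm_nonneg _ _ _
            · exact hXC i x
          calc ‖a j x i‖ ^ 2 ≤ (C * nrm g x (W j x)) ^ 2 := by gcongr
            _ = _ := by ring
      _ = _ := by simp; ring
  set R2 : ℝ≥0∞ := ENNReal.ofReal (n * C ^ 2) * B with hR2
  have hR2t : R2 ≠ ⊤ := ENNReal.mul_ne_top ENNReal.ofReal_ne_top hB
  have hbd : ∀ᶠ j in (𝒰 : Filter ℕ), eLpNorm (a j) 2 (vol g) ≤ R2 ^ (1 / 2 : ℝ) := by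
    filter_upwards [hWB] with j hj
    rw [eLpNorm_eq_lintegral_rpow_enorm_toReal (by simp) (by simp)]
    simp only [ENNReal.toReal_ofNat]
    refine ENNReal.rpow_le_rpow ?_ (by norm_num)
    calc ∫⁻ x, ‖a j x‖ₑ ^ (2 : ℝ) ∂(vol g)
        ≤ ∫⁻ x, ENNReal.ofReal (n * C ^ 2) * ENNReal.ofReal (nrm g x (W j x) ^ (2 : ℝ)) ∂(vol g) := by
          refine lintegral_mono fun x => ?_
          rw [← ENNReal.ofReal_mul (by positivity), ← ofReal_norm,
            ENNReal.ofReal_rpow_of_nonneg (norm_nonneg _) (by norm_num)]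
          refine ENNReal.ofReal_le_ofReal ?_
          simpa using hanorm j x
      _ ≤ _ := by
          rw [lintegral_const_mul' _ _ ENNReal.ofReal_ne_top]
          exact mul_le_mul' le_rfl hj
  classical
  set A : ℕ → Lp (Coord n) 2 (vol g) := fun j =>
    if h : MemLp (a j) 2 (vol g) then h.toLp (a j) else 0 with hA
  have hAn : ∀ᶠ j in (𝒰 : Filter ℕ), ‖A j‖ ≤ (R2 ^ (1 / 2 : ℝ)).toReal := by
    filter_upwards [hbd] with j hj
    have hR : R2 ^ (1 / 2 : ℝ) ≠ ⊤ := ENNReal.rpow_ne_top_of_nonneg (by norm_num) hR2t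
    have hm : MemLp (a j) 2 (vol g) := ⟨ham j, hj.trans_lt hR.lt_top⟩
    rw [hA]
    simp only [dif_pos hm]
    rw [Lp.norm_toLp]
    exact ENNReal.toReal_mono hR hj
  obtain ⟨z, hz⟩ := exists_weak_limit 𝒰 hAn
  set Z : M → Coord n := fun x => sharp g x ((innerSL ℝ (z x)).comp (T x)) with hZ
  have hZip : ∀ x v, ip g x (Z x) v = inner ℝ (z x) (T x v) := fun x v => by
    rw [hZ, ip_sharp]
    rfl
  have hzm : AEMeasurable z (vol g) := (Lp.aestronglyMeasurable z).aemeasurable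
  have hTme : ∀ Y : M → Coord n, MeasField g Y → AEMeasurable (fun x => T x (Y x)) (vol g) := by
    intro Y hY
    have : AEMeasurable (fun x => fun i => T x (Y x) i) (vol g) :=
      aemeasurable_pi_lambda _ fun i => hTm Y hY i
    exact (PiLp.continuous_toLp 2 (fun _ : Fin n => ℝ)).measurable.comp_aemeasurable this
  refine ⟨Z, fun e he i => ?_, fun Φ hΦ L hΦL => ?_⟩
  · have h1 := hTme _ (measField_indicator_smul_coordField g he (c := fun _ => 1) aemeasurable_const i)
    refine ((hzm.inner h1).restrict (s := e.source)).congr ?_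
    filter_upwards [ae_restrict_mem e.open_source.measurableSet] with x hx
    rw [hZip, Set.indicator_of_mem hx, one_smul]
  · have hbm : AEStronglyMeasurable (fun x => T x (Φ x)) (vol g) := (hTme Φ hΦ).aestronglyMeasurable
    have hb : MemLp (fun x => T x (Φ x)) 2 (vol g) := by
      refine MemLp.of_bound hbm (C * L) (Eventually.of_forall fun x => (hTC x _).trans ?_)
      gcongr
      exact hΦL x
    have h1 := hz (hb.toLp _)
    have h2 : inner ℝ z (hb.toLp _) = ∫ x, ip g x (Z x) (Φ x) ∂(vol g) := by
      rw [L2.inner_def]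
      refine integral_congr_ae ?_
      filter_upwards [hb.coeFn_toLp] with x hx
      rw [hx, hZip]
    rw [h2] at h1
    refine h1.congr' ?_
    filter_upwards [hbd] with j hj
    have hR : R2 ^ (1 / 2 : ℝ) ≠ ⊤ := ENNReal.rpow_ne_top_of_nonneg (by norm_num) hR2t
    have hm : MemLp (a j) 2 (vol g) := ⟨ham j, hj.trans_lt hR.lt_top⟩
    rw [L2.inner_def]
    refine integral_congr_ae ?_
    have h3 : A j = hm.toLp (a j) := by rw [hA]; simp only [dif_pos hm]
    rw [h3]
    filter_upwards [hb.coeFn_toLp, hm.coeFn_toLp] with x hx hx'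
    rw [hx, hx']
    conv_rhs => rw [hXT x (Φ x)]
    simp [PiLp.inner_apply, ha, map_sum]

/-- Duality: a field whose pairing with every bounded field `Φ` is bounded by the `L^{p'}` norm of
`Φ` has energy at most `1`. -/
lemma energy_le_one_of_dual (g : Metric n M) {p : ℝ} (hp : 2 < p) {Z : M → Coord n}
    (hZ : MeasField g Z)
    (h : ∀ Φ : M → Coord n, MeasField g Φ → ∀ L : ℝ, (∀ x, nrm g x (Φ x) ≤ L) →
      ‖∫ x, ip g x (Z x) (Φ x) ∂(vol g)‖ₑ ≤
        (∫⁻ x, ENNReal.ofReal (nrm g x (Φ x)) ^ (p / (p - 1)) ∂(vol g)) ^ ((p - 1) / p)) :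
    ∫⁻ x, ENNReal.ofReal (nrm g x (Z x) ^ p) ∂(vol g) ≤ 1 := by
  have := isFiniteMeasure_vol g
  have hp0 : 0 < p := by linarith
  have hp1 : 0 < p - 1 := by linarith
  -- test with `|Z| ^ (p - 2) Z`, truncated where `|Z| > R`
  set s : ℝ → M → ℝ := fun R x => if nrm g x (Z x) ≤ R then 1 else 0 with hs
  have hsm : ∀ R, AEMeasurable (s R) (vol g) := by
    intro R
    have h1 : Measurable fun r : ℝ => if r ≤ R then (1 : ℝ) else 0 :=
      Measurable.ite measurableSet_Iic measurable_const measurable_const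
    exact h1.comp_aemeasurable hZ.nrm
  have hs01 : ∀ R x, s R x = 0 ∨ s R x = 1 := fun R x => by
    simp only [hs]; split_ifs <;> simp
  have key : ∀ R : ℝ, 0 ≤ R → ∫⁻ x, ENNReal.ofReal (s R x * nrm g x (Z x) ^ p) ∂(vol g) ≤ 1 := by
    intro R hR
    set J := ∫⁻ x, ENNReal.ofReal (s R x * nrm g x (Z x) ^ p) ∂(vol g) with hJ
    have hbound : ∀ x, s R x * nrm g x (Z x) ^ p ≤ R ^ p := by
      intro x
      simp only [hs]
      split_ifs with hx
      · rw [one_mul]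
        exact Real.rpow_le_rpow (nrm_nonneg _ _ _) hx hp0.le
      · rw [zero_mul]; positivity
    have hnn : ∀ x, 0 ≤ s R x * nrm g x (Z x) ^ p := fun x => by
      have := Real.rpow_nonneg (nrm_nonneg g x (Z x)) p
      rcases hs01 R x with h | h <;> rw [h] <;> simp [this]
    have hJt : J ≠ ⊤ := by
      refine ne_top_of_le_ne_top ?_ (lintegral_mono fun x => ENNReal.ofReal_le_ofReal (hbound x))
      rw [lintegral_const]
      exact ENNReal.mul_ne_top ENNReal.ofReal_ne_top (measure_ne_top _ _)
    set Φ : M → Coord n := fun x => (s R x * nrm g x (Z x) ^ (p - 2)) • Z x with hΦ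
    have hΦm : MeasField g Φ := MeasField.smul ((hsm R).mul (hZ.nrm.pow_const _)) hZ
    have hΦn : ∀ x, nrm g x (Φ x) = s R x * nrm g x (Z x) ^ (p - 1) := by
      intro x
      have h0 := nrm_nonneg g x (Z x)
      have h1 := Real.rpow_nonneg h0 (p - 2)
      rw [hΦ, nrm_smul, abs_mul, abs_of_nonneg h1, mul_assoc]
      have h2 : |s R x| = s R x := by rcases hs01 R x with h | h <;> rw [h] <;> simp
      rw [h2]
      congr 1
      rw [← Real.rpow_add_one' h0 (by linarith)]
      congr 1
      ring
    have hΦL : ∀ x, nrm g x (Φ x) ≤ R ^ (p - 1) := by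
      intro x
      rw [hΦn]
      simp only [hs]
      split_ifs with hx
      · rw [one_mul]
        exact Real.rpow_le_rpow (nrm_nonneg _ _ _) hx hp1.le
      · rw [zero_mul]; positivity
    have h1 := h Φ hΦm _ hΦL
    have h2 : ∀ x, ip g x (Z x) (Φ x) = s R x * nrm g x (Z x) ^ p := by
      intro x
      have h0 := nrm_nonneg g x (Z x)
      rw [hΦ, map_smul, smul_eq_mul, ← nrm_sq, mul_assoc]
      congr 1
      rw [← Real.rpow_natCast, ← Real.rpow_add' h0 (by push_cast; linarith)]
      congr 1
      push_cast
      ring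
    have h3 : ∀ x, ENNReal.ofReal (nrm g x (Φ x)) ^ (p / (p - 1)) =
        ENNReal.ofReal (s R x * nrm g x (Z x) ^ p) := by
      intro x
      have h0 := nrm_nonneg g x (Z x)
      rw [hΦn]
      rcases hs01 R x with h | h
      · rw [h, zero_mul, zero_mul, ENNReal.ofReal_zero, ENNReal.zero_rpow_of_pos (by positivity)]
      · rw [h, one_mul, one_mul, ENNReal.ofReal_rpow_of_nonneg (Real.rpow_nonneg h0 _) (by positivity),
          ← Real.rpow_mul h0, mul_div_cancel₀ _ hp1.ne']
    have h4 : ‖∫ x, ip g x (Z x) (Φ x) ∂(vol g)‖ₑ = J := by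
      simp only [h2]
      rw [integral_eq_lintegral_of_nonneg_ae (Eventually.of_forall hnn)
        ((hsm R).mul (hZ.nrm.pow_const _)).aestronglyMeasurable, Real.enorm_of_nonneg ENNReal.toReal_nonneg,
        ENNReal.ofReal_toReal hJt]
    rw [h4] at h1
    simp only [h3] at h1
    by_contra hcon
    rw [not_le] at hcon
    have h5 : J ^ ((p - 1) / p) < J ^ (1 : ℝ) :=
      ENNReal.rpow_lt_rpow_of_exponent_lt hcon hJt (by rw [div_lt_one hp0]; linarith)
    rw [ENNReal.rpow_one] at h5
    exact absurd h1 (not_le.2 h5)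
  have hlim : Tendsto (fun R : ℕ => ∫⁻ x, ENNReal.ofReal (s R x * nrm g x (Z x) ^ p) ∂(vol g)) atTop
      (𝓝 (∫⁻ x, ENNReal.ofReal (nrm g x (Z x) ^ p) ∂(vol g))) := by
    refine lintegral_tendsto_of_tendsto_of_monotone
      (fun R => ((hsm R).mul (hZ.nrm.pow_const _)).ennreal_ofReal) ?_ ?_
    · refine Eventually.of_forall fun x R R' hRR' => ENNReal.ofReal_le_ofReal ?_
      have h0 := Real.rpow_nonneg (nrm_nonneg g x (Z x)) p
      refine mul_le_mul_of_nonneg_right ?_ h0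
      have h1 : (R : ℝ) ≤ R' := by exact_mod_cast hRR'
      simp only [hs]
      split_ifs with h2 h3 <;> first | exact absurd (h2.trans h1) h3 | norm_num
    · refine Eventually.of_forall fun x => tendsto_const_nhds.congr' ?_
      obtain ⟨N, hN⟩ := exists_nat_ge (nrm g x (Z x))
      filter_upwards [eventually_ge_atTop N] with R hR
      have h1 : nrm g x (Z x) ≤ R := hN.trans (by exact_mod_cast hR)
      simp only [hs, if_pos h1, one_mul]
  exact le_of_tendsto' hlim fun R => key R (Nat.cast_nonneg R)

end WeakLimit

/-! ### Weak gradients of limits -/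

section LimitGradient

variable {n : ℕ} {M : Type*} [TopologicalSpace M] [ChartedSpace (Coord n) M]
  [IsManifold (𝓡 n) ∞ M]

/-- The vector field on `M` whose pairing with a field `Z` is the integral of the `i`-th covariant
component of `Z` in the chart `e` against the test function `φ`. -/
def testField (g : Metric n M) (e : OpenPartialHomeomorph M (Coord n)) (i : Fin n)
    (φ : Coord n → ℝ) : M → Coord n :=
  e.source.indicator fun x => (φ (e x) / dens g e (e x)) • coordField e i x

lemma IsWeakGradient.sub_const {g : Metric n M} {f : M → ℝ} {V : M → Coord n}
    (h : IsWeakGradient g f V) (c : ℝ) : IsWeakGradient g (fun x => f x - c) V := by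
  intro e he
  obtain ⟨hf, hV⟩ := h e he
  refine ⟨hf.sub (locallyIntegrableOn_const c), fun i => ⟨(hV i).1, fun φ hφ hφc hφs => ?_⟩⟩
  have hdφ : Continuous fun y => fderiv ℝ φ y (EuclideanSpace.single i (1 : ℝ)) :=
    (hφ.continuous_fderiv (by simp)).clm_apply continuous_const
  have hd0 : ∀ y ∉ tsupport φ, fderiv ℝ φ y (EuclideanSpace.single i (1 : ℝ)) = 0 := fun y hy => by
    have h := image_eq_zero_of_notMem_tsupport (f := fderiv ℝ φ) (x := y)
      fun h => hy (tsupport_fderiv_subset ℝ h)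
    rw [h, zero_apply]
  have hint : Integrable fun y => fderiv ℝ φ y (EuclideanSpace.single i (1 : ℝ)) := by
    have h := integrable_mul_of_locallyIntegrableOn (F := fun _ => 1) (U := e.target)
      (locallyIntegrableOn_const 1) hφc.isCompact hφs hdφ hd0
    simpa using h
  have hzero : ∫ y, fderiv ℝ φ y (EuclideanSpace.single i (1 : ℝ)) = 0 := by
    have h := integral_mul_fderiv_eq_neg_fderiv_mul_of_integrable (μ := (volume : Measure (Coord n)))
      (f := fun _ => (1 : ℝ)) (g := φ) (v := EuclideanSpace.single i (1 : ℝ)) (by simp)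
      (by simpa using hint) (by simpa using hφ.continuous.integrable_of_hasCompactSupport hφc)
      (fun _ _ => differentiableAt_const _) (fun y _ => hφ.differentiable (by simp) y)
    simpa using h
  rw [← (hV i).2 φ hφ hφc hφs]
  simp only [sub_mul]
  rw [integral_sub (integrable_mul_of_locallyIntegrableOn hf hφc.isCompact hφs hdφ hd0)
    (hint.const_mul c), integral_const_mul, hzero, mul_zero, sub_zero]

variable [MeasurableSpace M] [BorelSpace M]

lemma measField_testField (g : Metric n M) {e : OpenPartialHomeomorph M (Coord n)}
    (he : e ∈ atlas (Coord n) M) (i : Fin n) {φ : Coord n → ℝ} (hφ : Continuous φ) :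
    MeasField g (testField g e i φ) := by
  refine measField_indicator_smul_coordField g he (ContinuousOn.aemeasurable ?_
    e.open_source.measurableSet) i
  exact (hφ.comp_continuousOn e.continuousOn).div
    ((continuousOn_dens g he).comp e.continuousOn e.mapsTo)
    fun x hx => (dens_pos g he (e.map_source hx)).ne'

lemma exists_nrm_testField_le (g : Metric n M) {e : OpenPartialHomeomorph M (Coord n)}
    (he : e ∈ atlas (Coord n) M) (i : Fin n) {φ : Coord n → ℝ} (hφ : Continuous φ)
    (hφc : HasCompactSupport φ) (hφs : tsupport φ ⊆ e.target) :
    ∃ L : ℝ, ∀ x, nrm g x (testField g e i φ x) ≤ L := by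
  have hK : IsCompact (e.symm '' tsupport φ) :=
    hφc.isCompact.image_of_continuousOn (e.continuousOn_symm.mono hφs)
  have hKe : e.symm '' tsupport φ ⊆ e.source := by
    rintro _ ⟨y, hy, rfl⟩
    exact e.map_target (hφs hy)
  obtain ⟨C, hC, hCle⟩ := exists_nrm_coordField_le g he hK hKe
  have hcont : ContinuousOn (fun x => φ (e x) / dens g e (e x)) (e.symm '' tsupport φ) :=
    ((hφ.comp_continuousOn e.continuousOn).div
      ((continuousOn_dens g he).comp e.continuousOn e.mapsTo)
      fun x hx => (dens_pos g he (e.map_source hx)).ne').mono hKe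
  obtain ⟨b, hb⟩ := hK.exists_bound_of_continuousOn hcont
  refine ⟨|b| * C, fun x => ?_⟩
  by_cases hx : x ∈ e.symm '' tsupport φ
  · rw [testField, Set.indicator_of_mem (hKe hx), nrm_smul]
    exact mul_le_mul ((hb x hx).trans (le_abs_self b)) (hCle x hx i) (nrm_nonneg _ _ _) (abs_nonneg _)
  · have h0 : testField g e i φ x = 0 := by
      by_cases hxe : x ∈ e.source
      · rw [testField, Set.indicator_of_mem hxe, image_eq_zero_of_notMem_tsupport
          fun h => hx ⟨_, h, e.left_inv hxe⟩]
        simp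
      · rw [testField, Set.indicator_of_notMem hxe]
    rw [h0, nrm_zero]
    positivity

variable [CompactSpace M] [Nonempty M]

/-- The density in the definition of `testField` cancels that of the volume. -/
lemma integral_ip_testField (g : Metric n M) {e : OpenPartialHomeomorph M (Coord n)}
    (he : e ∈ atlas (Coord n) M) (i : Fin n) {φ : Coord n → ℝ} (hφ : Continuous φ)
    (hφs : tsupport φ ⊆ e.target) {Z : M → Coord n} (hZ : MeasField g Z) :
    ∫ x, ip g x (Z x) (testField g e i φ x) ∂(vol g) =
      ∫ y, g.inner (e.symm y) (Z (e.symm y)) (coordVec e i y) * φ y := by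
  have hR : ∫ y in e.target, g.inner (e.symm y) (Z (e.symm y)) (coordVec e i y) * φ y =
      ∫ y, g.inner (e.symm y) (Z (e.symm y)) (coordVec e i y) * φ y :=
    setIntegral_eq_integral_of_forall_compl_eq_zero fun y hy => by
      rw [image_eq_zero_of_notMem_tsupport fun h => hy (hφs h), mul_zero]
  rw [← setIntegral_eq_integral_of_forall_compl_eq_zero (s := e.source) fun x hx => by
    rw [testField, Set.indicator_of_notMem hx, map_zero],
    setIntegral_vol g he (hZ.ip (measField_testField g he i hφ)).aestronglyMeasurable, ← hR]
  refine setIntegral_congr_fun e.open_target.measurableSet fun y hy => ?_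
  have h1 : g.inner (e.symm y) (Z (e.symm y)) (coordVec e i y) =
      ip g (e.symm y) (Z (e.symm y)) (coordField e i (e.symm y)) := by
    rw [← coordVec_eq e i hy]; rfl
  beta_reduce
  rw [h1, testField, Set.indicator_of_mem (e.map_target hy), e.right_inv hy, map_smul, smul_eq_mul]
  have := (dens_pos g he hy).ne'
  field_simp

variable [T2Space M]

/-- The covariant components of a field of finite energy are locally integrable. -/
lemma locallyIntegrableOn_component (g : Metric n M) {p : ℝ} (hp : 1 ≤ p) {Z : M → Coord n}
    (hZ : MeasField g Z) (hE : ∫⁻ x, ENNReal.ofReal (nrm g x (Z x) ^ p) ∂(vol g) ≠ ⊤)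
    {e : OpenPartialHomeomorph M (Coord n)} (he : e ∈ atlas (Coord n) M) (i : Fin n) :
    LocallyIntegrableOn
      (fun y => g.inner (e.symm y) (Z (e.symm y)) (coordVec e i y)) e.target := by
  have := isFiniteMeasure_vol g
  rw [locallyIntegrableOn_iff e.open_target.isLocallyClosed]
  intro K hKe hK
  have hK' : IsCompact (e.symm '' K) := hK.image_of_continuousOn (e.continuousOn_symm.mono hKe)
  have hK'e : e.symm '' K ⊆ e.source := by
    rintro _ ⟨y, hy, rfl⟩
    exact e.map_target (hKe hy)
  obtain ⟨C, hC, hCle⟩ := exists_nrm_coordField_le g he hK' hK'e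
  obtain ⟨A, hA, hAle⟩ := exists_setLIntegral_chart_le g he hK hKe
  have hcongr : ∀ y ∈ e.target, g.inner (e.symm y) (Z (e.symm y)) (coordVec e i y) =
      e.source.indicator (fun x => ip g x (Z x) (coordField e i x)) (e.symm y) := by
    intro y hy
    rw [Set.indicator_of_mem (e.map_target hy), ← coordVec_eq e i hy]
    rfl
  have hm : AEStronglyMeasurable (fun y => g.inner (e.symm y) (Z (e.symm y)) (coordVec e i y))
      (volume.restrict e.target) := by
    have h1 : AEStronglyMeasurable (e.source.indicator fun x => ip g x (Z x) (coordField e i x))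
        (vol g) := ((aemeasurable_indicator_iff e.open_source.measurableSet).2
          (hZ e he i)).aestronglyMeasurable
    refine (aestronglyMeasurable_comp_symm g he h1).congr ?_
    filter_upwards [ae_restrict_mem e.open_target.measurableSet] with y hy
    rw [hcongr y hy]
  refine ⟨hm.mono_measure (Measure.restrict_mono_set _ hKe), ?_⟩
  have hL1 : ∫⁻ x, ENNReal.ofReal (nrm g x (Z x)) ∂(vol g) < ⊤ := by
    calc ∫⁻ x, ENNReal.ofReal (nrm g x (Z x)) ∂(vol g)
        ≤ ∫⁻ x, (1 + ENNReal.ofReal (nrm g x (Z x) ^ p)) ∂(vol g) := by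
          refine lintegral_mono fun x => ?_
          have h0 := nrm_nonneg g x (Z x)
          rw [← ENNReal.ofReal_one, ← ENNReal.ofReal_add zero_le_one (Real.rpow_nonneg h0 _)]
          refine ENNReal.ofReal_le_ofReal ?_
          rcases le_total (nrm g x (Z x)) 1 with h | h
          · linarith [Real.rpow_nonneg h0 p]
          · linarith [Real.self_le_rpow_of_one_le h hp]
      _ < ⊤ := by
          rw [lintegral_add_left measurable_const, lintegral_const, one_mul]
          exact ENNReal.add_lt_top.2 ⟨measure_lt_top _ _, hE.lt_top⟩
  calc ∫⁻ y in K, ‖g.inner (e.symm y) (Z (e.symm y)) (coordVec e i y)‖ₑ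
      ≤ ∫⁻ y in K, ENNReal.ofReal C * ENNReal.ofReal (nrm g (e.symm y) (Z (e.symm y))) := by
        refine setLIntegral_mono' hK.isClosed.measurableSet fun y hy => ?_
        rw [hcongr y (hKe hy), Set.indicator_of_mem (e.map_target (hKe hy)),
          ← ENNReal.ofReal_mul hC.le, ← ofReal_norm]
        refine ENNReal.ofReal_le_ofReal ((abs_ip_le g _ _ _).trans ?_)
        rw [mul_comm]
        gcongr
        · exact nrm_nonneg _ _ _
        · exact hCle _ (Set.mem_image_of_mem _ hy) i
    _ = ENNReal.ofReal C * ∫⁻ y in K, ENNReal.ofReal (nrm g (e.symm y) (Z (e.symm y))) :=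
        lintegral_const_mul' _ _ ENNReal.ofReal_ne_top
    _ ≤ ENNReal.ofReal C * (A * ∫⁻ x, ENNReal.ofReal (nrm g x (Z x)) ∂(vol g)) := by
        gcongr
        exact hAle (fun x => ENNReal.ofReal (nrm g x (Z x))) hZ.nrm.ennreal_ofReal
    _ < ⊤ := ENNReal.mul_lt_top ENNReal.ofReal_lt_top (ENNReal.mul_lt_top hA.lt_top hL1)

/-- Weak gradients pass to the limit when the functions converge uniformly and the gradients
weakly. -/
lemma isWeakGradient_of_tendsto (g : Metric n M) {p : ℝ} (hp : 1 ≤ p) {l : Filter ℕ} [l.NeBot]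
    {f : ℕ → M → ℝ} {W : ℕ → M → Coord n} (hW : ∀ j, IsWeakGradient g (f j) (W j))
    {f' : M → ℝ} (hfc : Continuous f') (hf : TendstoUniformly f f' l) {Z : M → Coord n}
    (hZ : MeasField g Z) (hE : ∫⁻ x, ENNReal.ofReal (nrm g x (Z x) ^ p) ∂(vol g) ≠ ⊤)
    (hWZ : ∀ Φ : M → Coord n, MeasField g Φ → ∀ L : ℝ, (∀ x, nrm g x (Φ x) ≤ L) →
      Tendsto (fun j => ∫ x, ip g x (W j x) (Φ x) ∂(vol g)) l (𝓝 (∫ x, ip g x (Z x) (Φ x) ∂(vol g)))) :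
    IsWeakGradient g f' Z := by
  intro e he
  have hfl : LocallyIntegrableOn (fun y => f' (e.symm y)) e.target :=
    (hfc.comp_continuousOn e.continuousOn_symm).locallyIntegrableOn e.open_target.measurableSet
  refine ⟨hfl, fun i => ⟨locallyIntegrableOn_component g hp hZ hE he i, fun φ hφ hφc hφs => ?_⟩⟩
  set v : Coord n := EuclideanSpace.single i (1 : ℝ) with hv
  have hdφ : Continuous fun y => fderiv ℝ φ y v :=
    (hφ.continuous_fderiv (by simp)).clm_apply continuous_const
  have hd0 : ∀ y ∉ tsupport φ, fderiv ℝ φ y v = 0 := fun y hy => by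
    have h := image_eq_zero_of_notMem_tsupport (f := fderiv ℝ φ) (x := y)
      fun h => hy (tsupport_fderiv_subset ℝ h)
    rw [h, zero_apply]
  have hdint : Integrable fun y => fderiv ℝ φ y v := by
    have h := integrable_mul_of_locallyIntegrableOn (F := fun _ => 1) (U := e.target)
      (locallyIntegrableOn_const 1) hφc.isCompact hφs hdφ hd0
    simpa using h
  obtain ⟨L, hL⟩ := exists_nrm_testField_le g he i hφ.continuous hφc hφs
  have h1 := hWZ _ (measField_testField g he i hφ.continuous) L hL
  rw [integral_ip_testField g he i hφ.continuous hφs hZ] at h1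
  have h2 : ∀ j, ∫ x, ip g x (W j x) (testField g e i φ x) ∂(vol g) =
      -∫ y, f j (e.symm y) * fderiv ℝ φ y v := by
    intro j
    rw [integral_ip_testField g he i hφ.continuous hφs (measField_of_isWeakGradient (hW j)),
      ((hW j e he).2 i).2 φ hφ hφc hφs, neg_neg]
  simp only [h2] at h1
  have h3 : Tendsto (fun j => ∫ y, f j (e.symm y) * fderiv ℝ φ y v) l
      (𝓝 (∫ y, f' (e.symm y) * fderiv ℝ φ y v)) := by
    rw [Metric.tendsto_nhds]
    intro ε hε
    set I := ∫ y, ‖fderiv ℝ φ y v‖ with hI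
    have hI0 : 0 ≤ I := integral_nonneg fun _ => norm_nonneg _
    filter_upwards [Metric.tendstoUniformly_iff.1 hf (ε / (I + 1)) (by positivity)] with j hj
    have i1 := integrable_mul_of_locallyIntegrableOn (hW j e he).1 hφc.isCompact hφs hdφ hd0
    have i2 := integrable_mul_of_locallyIntegrableOn hfl hφc.isCompact hφs hdφ hd0
    rw [dist_eq_norm, ← integral_sub i1 i2]
    calc ‖∫ y, (f j (e.symm y) * fderiv ℝ φ y v - f' (e.symm y) * fderiv ℝ φ y v)‖
        ≤ ∫ y, ε / (I + 1) * ‖fderiv ℝ φ y v‖ := by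
          refine norm_integral_le_of_norm_le (hdint.norm.const_mul _) (Eventually.of_forall fun y => ?_)
          rw [← sub_mul, norm_mul]
          gcongr
          have := (hj (e.symm y)).le
          rwa [dist_comm, dist_eq_norm] at this
      _ = ε / (I + 1) * I := integral_const_mul _ _
      _ < ε := by
          rw [div_mul_eq_mul_div, div_lt_iff₀ (by positivity)]
          nlinarith
  have h4 := tendsto_nhds_unique h1 h3.neg
  rw [h4, neg_neg]

end LimitGradient

/-! ### Limits of competitors, and the modified distance -/

section Limits

variable {n : ℕ} {M : Type*} [TopologicalSpace M] [ChartedSpace (Coord n) M]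
  [IsManifold (𝓡 n) ∞ M]

/-- The modulus of continuity `D d(x,y)^α` of the competitors, as a real number. -/
def holderMod (α D : ℝ) (g : Metric n M) (x y : M) : ℝ :=
  (ENNReal.ofReal D * riemDist g x y ^ α).toReal

lemma tendsto_holderMod {α D : ℝ} (hα : 0 < α) (g : Metric n M) (x : M) :
    Tendsto (holderMod α D g x) (𝓝 x) (𝓝 0) := by
  have hd : Tendsto (fun y => riemDist g x y) (𝓝 x) (𝓝 0) := by
    rw [ENNReal.tendsto_nhds_zero]
    exact fun ε hε => (eventually_riemDist_lt g x hε).mono fun y hy => hy.le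
  have h2 := ((ENNReal.continuous_rpow_const (y := α)).tendsto 0).comp hd
  rw [ENNReal.zero_rpow_of_pos hα] at h2
  have h3 := ENNReal.Tendsto.const_mul h2 (Or.inr (ENNReal.ofReal_ne_top (r := D)))
  rw [mul_zero] at h3
  exact (ENNReal.tendsto_toReal ENNReal.zero_ne_top).comp h3

lemma holder_le_iff_holderMod [PreconnectedSpace M] {p : ℝ} (hp : 0 < p) (hpn : (n : ℝ) < p)
    (g : Metric n M) {f : M → ℝ} {D : ℝ} :
    holder p g f ≤ ENNReal.ofReal D ↔
      ∀ x y, |f x - f y| ≤ holderMod ((p - n) / p) D g x y := by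
  rw [holder_le_iff hp hpn]
  refine forall₂_congr fun x y => ?_
  have hα : 0 < (p - n) / p := div_pos (by linarith) hp
  rw [holderMod, ← ENNReal.ofReal_le_iff_le_toReal (ENNReal.mul_ne_top ENNReal.ofReal_ne_top
    (ENNReal.rpow_ne_top_of_nonneg hα.le (riemDist_ne_top g x y))), ← Real.norm_eq_abs, ofReal_norm]

lemma equicontinuous_of_holderMod {ι : Type*} {α D : ℝ} (hα : 0 < α) (g : Metric n M)
    {f : ι → M → ℝ} (hf : ∀ j x y, |f j x - f j y| ≤ holderMod α D g x y) : Equicontinuous f := by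
  intro x
  rw [Metric.equicontinuousAt_iff_right]
  intro ε hε
  filter_upwards [(tendsto_holderMod (D := D) hα g x).eventually (gt_mem_nhds hε)] with y hy j
  rw [Real.dist_eq]
  exact (hf j x y).trans_lt hy

/-- Weak differentiability does not depend on the metric: fields that represent the same covectors
for two metrics are weak gradients of the same functions. -/
lemma isWeakGradient_congr {g g' : Metric n M} {f : M → ℝ} {V W : M → Coord n}
    (hVW : ∀ x u, ip g' x (W x) u = ip g x (V x) u) (h : IsWeakGradient g f V) :
    IsWeakGradient g' f W := by
  intro e he
  refine ⟨(h e he).1, fun i => ?_⟩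
  have heq : (fun y => g'.inner (e.symm y) (W (e.symm y)) (coordVec e i y)) =
      fun y => g.inner (e.symm y) (V (e.symm y)) (coordVec e i y) := funext fun y => hVW _ _
  obtain ⟨h1, h2⟩ := (h e he).2 i
  refine ⟨heq ▸ h1, fun φ hφ hφc hφs => ?_⟩
  rw [h2 φ hφ hφc hφs]
  congr 1
  exact integral_congr_ae (Eventually.of_forall fun y => congrArg (· * φ y) (congrFun heq y).symm)

variable [MeasurableSpace M] [BorelSpace M] [CompactSpace M] [T2Space M] [ConnectedSpace M]

/-- Competitors for the metrics `g j` subconverge to a competitor for `g₀`. -/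
lemma exists_limit_competitor (hn : 3 ≤ n) {p D : ℝ} (hp : 3 * (n : ℝ) < p) {g₀ : Metric n M}
    {g : ℕ → Metric n M} {C : ℝ≥0∞} (hC : C ≠ ⊤)
    (hgC : ∀ j, ∫⁻ x, ENNReal.ofReal (normMetric g₀ (g j) x ^ ((n : ℝ) / 2)) ∂(vol g₀) ≤ C)
    (hg : Tendsto (fun j => ∫⁻ x, ENNReal.ofReal
      (normInvDiff g₀ (g j) x ^ ((n : ℝ) * (p - 1) / 2)) ∂(vol g₀)) atTop (𝓝 0))
    {𝒰 : Ultrafilter ℕ} (h𝒰 : (𝒰 : Filter ℕ) ≤ atTop) {f : ℕ → M → ℝ}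
    (hf : ∀ j, Admissible p D (g j) g₀ (f j)) :
    ∃ f' : M → ℝ, Admissible p D g₀ g₀ f' ∧
      ∀ x y, Tendsto (fun j => |f j x - f j y|) 𝒰 (𝓝 |f' x - f' y|) := by
  have hn' : (3 : ℝ) ≤ n := by exact_mod_cast hn
  have hn0 : 0 < n := by omega
  have hp0 : 0 < p := by linarith
  have hp1 : 0 < p - 1 := by linarith
  have hp2 : 0 < p - 2 := by linarith
  have hpn : (n : ℝ) < p := by linarith
  have hα : 0 < (p - n) / p := div_pos (by linarith) hp0
  have := isFiniteMeasure_vol g₀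
  -- normalize the functions, and extract a limit
  obtain ⟨x₀⟩ : Nonempty M := inferInstance
  set F : ℕ → M → ℝ := fun j x => f j x - f j x₀ with hF
  have hfh : ∀ j x y, |f j x - f j y| ≤ holderMod ((p - n) / p) D g₀ x y := fun j =>
    (holder_le_iff_holderMod hp0 hpn g₀).1 (hf j).1
  have hFh : ∀ j x y, |F j x - F j y| ≤ holderMod ((p - n) / p) D g₀ x y := fun j x y => by
    simpa [hF] using hfh j x y
  have hlim : ∀ x, ∃ r, Tendsto (fun j => F j x) 𝒰 (𝓝 r) := by
    intro x
    set b := holderMod ((p - n) / p) D g₀ x x₀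
    obtain ⟨r, -, hr⟩ := (isCompact_Icc (a := -b) (b := b)).ultrafilter_le_nhds
      (𝒰.map fun j => F j x) (by
        rw [Ultrafilter.coe_map, le_principal_iff, mem_map]
        exact Filter.Eventually.of_forall fun j => abs_le.1 (hfh j x x₀))
    exact ⟨r, hr⟩
  choose f' hf' using hlim
  have hunif : TendstoUniformly F f' 𝒰 := by
    have h1 : Tendsto F 𝒰 (𝓝 f') := tendsto_pi_nhds.2 hf'
    rw [← (equicontinuous_of_holderMod hα g₀ hFh).tendsto_uniformFun_iff_pi] at h1
    exact UniformFun.tendsto_iff_tendstoUniformly.1 h1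
  have hdiff : ∀ x y, Tendsto (fun j => |f j x - f j y|) 𝒰 (𝓝 |f' x - f' y|) := by
    intro x y
    have h1 := ((hf' x).sub (hf' y)).abs
    simpa [hF] using h1
  have hf'h : ∀ x y, |f' x - f' y| ≤ holderMod ((p - n) / p) D g₀ x y := fun x y =>
    le_of_tendsto (hdiff x y) (Eventually.of_forall fun j => hfh j x y)
  have hf'c : Continuous f' := hunif.continuous (Eventually.of_forall fun j =>
    (equicontinuous_of_holderMod hα g₀ hFh).continuous j).frequently
  -- the gradients, converted to fields that represent the same covectors for `g₀`
  have hV : ∀ j, ∃ V : M → Coord n, IsWeakGradient (g j) (f j) V ∧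
      ∫⁻ x, ENNReal.ofReal (nrm (g j) x (V x) ^ p) ∂(vol (g j)) ≤ 1 := fun j => (hf j).2
  choose V hVw hVE using hV
  set W : ℕ → M → Coord n := fun j x => sharp g₀ x (ip (g j) x (V j x)) with hW
  have hVW : ∀ j x u, ip g₀ x (W j x) u = ip (g j) x (V j x) u := fun j x u => ip_sharp _ _ _ _
  have hWw : ∀ j, IsWeakGradient g₀ (F j) (W j) := fun j =>
    (isWeakGradient_congr (hVW j) (hVw j)).sub_const _
  have hWm : ∀ j, MeasField g₀ (W j) := fun j => measField_of_isWeakGradient (hWw j)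
  have hVm : ∀ j, MeasField (g j) (V j) := fun j => measField_of_isWeakGradient (hVw j)
  -- the estimate with `q = 2` and the constant weight `1`; any `δ` in `(0, 1)` would do
  have hL2 : ∃ B : ℝ≥0∞, B ≠ ⊤ ∧ ∀ᶠ j in (𝒰 : Filter ℕ),
      ∫⁻ x, ENNReal.ofReal (nrm g₀ x (W j x) ^ (2 : ℝ)) ∂(vol g₀) ≤ B := by
    have h1 := eventually_lintegral_nrm_rpow_le (q := 2) (δ := 1 / 2) hn0 (p := p) (by linarith)
      two_pos (by linarith) (by nlinarith) (by
        have hnp : 0 < (n : ℝ) * (p - 2) := by positivity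
        have e1 : (1 - 2 * (p - 1) / (n * (p - 2))) * ((n : ℝ) * (p - 1) / 2) =
            ((p - 1) * (n * (p - 2) - 2 * (p - 1))) / (2 * (p - 2)) := by
          field_simp
        rw [e1]
        refine div_le_div_of_nonneg_right ?_ (by positivity)
        have h3 : (n : ℝ) + 2 ≤ n * (p - 2) - 2 * (p - 1) := by nlinarith
        nlinarith)
      (by norm_num) (by norm_num) hC hgC hg (F := fun _ => 1) aemeasurable_const (L := 1) (by simp)
      (fun _ => le_rfl) (ε := 1) one_pos
    refine ⟨_, ?_, (h1.filter_mono h𝒰).mono fun j hj => by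
      simpa only [mul_one] using hj (V j) (W j) (hVm j) (hVW j) (hVE j)⟩
    refine ENNReal.rpow_ne_top_of_nonneg (by positivity) (ENNReal.add_ne_top.2
      ⟨ENNReal.mul_ne_top ENNReal.ofReal_ne_top ?_, ENNReal.one_ne_top⟩)
    simp
  obtain ⟨B, hB, hWB⟩ := hL2
  obtain ⟨Z, hZm, hZ⟩ := exists_weak_limit_field g₀ 𝒰 hWm hB hWB
  have hZE : ∫⁻ x, ENNReal.ofReal (nrm g₀ x (Z x) ^ p) ∂(vol g₀) ≤ 1 := by
    refine energy_le_one_of_dual g₀ (by linarith) hZm fun Φ hΦ L hL => ?_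
    set I := ∫⁻ x, ENNReal.ofReal (nrm g₀ x (Φ x)) ^ (p / (p - 1)) ∂(vol g₀) with hI
    have hIt : I ≠ ⊤ := by
      refine ne_top_of_le_ne_top ?_ (lintegral_mono fun x => ENNReal.rpow_le_rpow
        (ENNReal.ofReal_le_ofReal (hL x)) (by positivity))
      rw [lintegral_const]
      exact ENNReal.mul_ne_top (ENNReal.rpow_ne_top_of_nonneg (by positivity) ENNReal.ofReal_ne_top)
        (measure_ne_top _ _)
    -- the estimate with `q = 1` and the weight `|Φ|`; its constant tends to `1` as `t → 0`
    have key : ∀ t : ℝ, 0 < t → t < 1 → ‖∫ x, ip g₀ x (Z x) (Φ x) ∂(vol g₀)‖ₑ ≤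
        (ENNReal.ofReal ((1 + t) ^ (1 * ((n : ℝ) - 1) / (2 * (p - 1))) *
          (1 - t)⁻¹ ^ (1 * (p - 1) / (2 * (p - 1)))) * I + ENNReal.ofReal t) ^ ((p - 1) / p) := by
      intro t ht0 ht1
      have h1 := eventually_lintegral_nrm_rpow_le (q := 1) hn0 (p := p) (by linarith)
        one_pos (by linarith) (by nlinarith) (by
          have e1 : (1 - 1 * (p - 1) / (n * (p - 1))) * ((n : ℝ) * (p - 1) / 2) =
              ((n : ℝ) - 1) * (p - 1) / 2 := by
            field_simp
          rw [e1, one_mul, div_le_div_iff₀ (by positivity) two_pos]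
          have h3 : 1 ≤ (p - 1) * (p - 1) := by nlinarith
          nlinarith)
        ht0 ht1 hC hgC hg (F := fun x => ENNReal.ofReal (nrm g₀ x (Φ x))) hΦ.nrm.ennreal_ofReal
        (L := ENNReal.ofReal L) ENNReal.ofReal_ne_top (fun x => ENNReal.ofReal_le_ofReal (hL x))
        (ε := ENNReal.ofReal t) (ENNReal.ofReal_pos.2 ht0)
      refine le_of_tendsto (hZ Φ hΦ L hL).enorm ((h1.filter_mono h𝒰).mono fun j hj => ?_)
      refine le_trans ?_ (hj (V j) (W j) (hVm j) (hVW j) (hVE j))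
      refine (enorm_integral_le_lintegral_enorm _).trans (lintegral_mono fun x => ?_)
      rw [Real.rpow_one, ← ENNReal.ofReal_mul (nrm_nonneg _ _ _), ← ofReal_norm]
      exact ENNReal.ofReal_le_ofReal (abs_ip_le _ _ _ _)
    have htend : Tendsto (fun t : ℝ => (ENNReal.ofReal ((1 + t) ^ (1 * ((n : ℝ) - 1) / (2 * (p - 1))) *
          (1 - t)⁻¹ ^ (1 * (p - 1) / (2 * (p - 1)))) * I + ENNReal.ofReal t) ^ ((p - 1) / p)) (𝓝[>] 0)
        (𝓝 (I ^ ((p - 1) / p))) := by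
      have h2 : ContinuousAt (fun t : ℝ => (1 + t) ^ (1 * ((n : ℝ) - 1) / (2 * (p - 1))) *
          (1 - t)⁻¹ ^ (1 * (p - 1) / (2 * (p - 1)))) 0 := by
        refine ContinuousAt.mul ?_ ?_
        · exact (continuousAt_const.add continuousAt_id).rpow_const (Or.inl (by norm_num))
        · exact ((continuousAt_const.sub continuousAt_id).inv₀ (by norm_num)).rpow_const
            (Or.inl (by norm_num))
      have h3 := (ENNReal.continuous_ofReal.tendsto _).comp
        (h2.tendsto.mono_left (nhdsWithin_le_nhds (s := Set.Ioi (0 : ℝ))))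
      have h4 := ENNReal.Tendsto.mul_const (b := I) h3 (Or.inr hIt)
      have h5 : Tendsto (fun δ : ℝ => ENNReal.ofReal δ) (𝓝[>] 0) (𝓝 0) := by
        simpa using (ENNReal.continuous_ofReal.tendsto 0).mono_left
          (nhdsWithin_le_nhds (s := Set.Ioi (0 : ℝ)))
      have h6 := ((ENNReal.continuous_rpow_const (y := (p - 1) / p)).tendsto _).comp (h4.add h5)
      simpa [Function.comp_def] using h6
    refine ge_of_tendsto htend ?_
    have h7 : ∀ᶠ t : ℝ in 𝓝[>] 0, t < 1 := nhdsWithin_le_nhds (Iio_mem_nhds one_pos)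
    filter_upwards [h7, self_mem_nhdsWithin] with t ht1 ht0
    exact key t ht0 ht1
  have hZw : IsWeakGradient g₀ f' Z := isWeakGradient_of_tendsto g₀ (by linarith) hWw hf'c hunif hZm
    (hZE.trans_lt ENNReal.one_lt_top).ne hZ
  exact ⟨f', ⟨(holder_le_iff_holderMod hp0 hpn g₀).2 hf'h, Z, hZw, hZE⟩, hdiff⟩

end Limits

section ModDist

variable {n : ℕ} {M : Type*} [TopologicalSpace M] [ChartedSpace (Coord n) M]
  [IsManifold (𝓡 n) ∞ M] [MeasurableSpace M] [BorelSpace M] [CompactSpace M] [T2Space M] [ConnectedSpace M]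

lemma admissible_const {p : ℝ} (hp : 0 < p) (hpn : (n : ℝ) < p) (D : ℝ) (g g₀ : Metric n M) (c : ℝ) :
    Admissible p D g g₀ fun _ => c := by
  refine admissible_iff.2 ⟨?_, grad g fun _ => c, isWeakGradient_grad g contMDiff_const, ?_⟩
  · rw [holder_le_iff hp hpn]
    intro x y
    simp
  · simp [grad_const, nrm_zero, Real.zero_rpow hp.ne']

lemma nonempty_modDist {p : ℝ} (hp : 0 < p) (hpn : (n : ℝ) < p) (D : ℝ) (g g₀ : Metric n M) (x y : M) :
    {r : ℝ | ∃ f : M → ℝ, Admissible p D g g₀ f ∧ r = |f x - f y|}.Nonempty :=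
  ⟨_, _, admissible_const hp hpn D g g₀ 0, rfl⟩

lemma bddAbove_modDist {p : ℝ} (hp : 0 < p) (hpn : (n : ℝ) < p) (D : ℝ) (g g₀ : Metric n M) (x y : M) :
    BddAbove {r : ℝ | ∃ f : M → ℝ, Admissible p D g g₀ f ∧ r = |f x - f y|} := by
  refine ⟨holderMod ((p - n) / p) D g₀ x y, ?_⟩
  rintro r ⟨f, hf, rfl⟩
  exact (holder_le_iff_holderMod hp hpn g₀).1 hf.1 x y

lemma le_modDist {p : ℝ} (hp : 0 < p) (hpn : (n : ℝ) < p) {D : ℝ} {g g₀ : Metric n M} {f : M → ℝ}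
    (hf : Admissible p D g g₀ f) (x y : M) : |f x - f y| ≤ modDist p D g g₀ x y :=
  le_csSup (bddAbove_modDist hp hpn D g g₀ x y) ⟨f, hf, rfl⟩

lemma exists_lt_of_lt_modDist {p : ℝ} (hp : 0 < p) (hpn : (n : ℝ) < p) {D : ℝ} {g g₀ : Metric n M}
    {x y : M} {r : ℝ} (hr : r < modDist p D g g₀ x y) :
    ∃ f, Admissible p D g g₀ f ∧ r < |f x - f y| := by
  obtain ⟨s, ⟨f, hf, rfl⟩, hs⟩ := exists_lt_of_lt_csSup
    (nonempty_modDist hp hpn D g g₀ x y) hr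
  exact ⟨f, hf, hs⟩

/-- The modified distance inherits the Hölder modulus of the competitors. -/
lemma modDist_le_add {p : ℝ} (hp : 0 < p) (hpn : (n : ℝ) < p) (D : ℝ) (g g₀ : Metric n M)
    (x y x' y' : M) :
    modDist p D g g₀ x y ≤ modDist p D g g₀ x' y' +
      (holderMod ((p - n) / p) D g₀ x x' + holderMod ((p - n) / p) D g₀ y y') := by
  refine csSup_le (nonempty_modDist hp hpn D g g₀ x y) ?_
  rintro r ⟨f, hf, rfl⟩
  have h := (holder_le_iff_holderMod hp hpn g₀).1 hf.1
  have h1 := le_modDist hp hpn hf x' y'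
  have h2 : f x - f y = (f x' - f y') + (f x - f x') - (f y - f y') := by ring
  have h3 : |f x - f y| ≤ |f x' - f y'| + |f x - f x'| + |f y - f y'| := by
    conv_lhs => rw [h2]
    exact (abs_sub _ _).trans (by gcongr; exact abs_add_le _ _)
  linarith [h x x', h y y']

lemma equicontinuous_modDist {ι : Type*} {p : ℝ} (hp : 0 < p) (hpn : (n : ℝ) < p) (D : ℝ)
    (g : ι → Metric n M) (g₀ : Metric n M) :
    Equicontinuous fun j (q : M × M) => modDist p D (g j) g₀ q.1 q.2 := by
  have hα : 0 < (p - n) / p := div_pos (by linarith) hp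
  have hsymm : ∀ x y, holderMod ((p - n) / p) D g₀ x y = holderMod ((p - n) / p) D g₀ y x :=
    fun x y => by rw [holderMod, holderMod, riemDist_comm]
  rintro ⟨x, y⟩
  rw [Metric.equicontinuousAt_iff_right]
  intro ε hε
  have h1 : Tendsto (fun q : M × M => holderMod ((p - n) / p) D g₀ x q.1 +
      holderMod ((p - n) / p) D g₀ y q.2) (𝓝 (x, y)) (𝓝 (0 + 0)) :=
    ((tendsto_holderMod hα g₀ x).comp (continuous_fst.tendsto (x, y))).add
      ((tendsto_holderMod hα g₀ y).comp (continuous_snd.tendsto (x, y)))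
  rw [add_zero] at h1
  filter_upwards [h1.eventually (gt_mem_nhds hε)] with q hq j
  rw [Real.dist_eq, abs_lt]
  have h2 := modDist_le_add hp hpn D (g j) g₀ x y q.1 q.2
  have h3 := modDist_le_add hp hpn D (g j) g₀ q.1 q.2 x y
  rw [hsymm q.1, hsymm q.2] at h3
  constructor <;> linarith

end ModDist

end

end ModifiedDp

theorem theorem1p1 (n : ℕ) (hn : 3 ≤ n)
    (M : Type*) [TopologicalSpace M] [T2Space M] [CompactSpace M] [ConnectedSpace M]
    [ChartedSpace (ModifiedDp.Coord n) M] [IsManifold (𝓡 n) ∞ M]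
    [MeasurableSpace M] [BorelSpace M]
    (hM : ModifiedDp.IsOrientable n M) (g₀ : ModifiedDp.Metric n M) :
    ∃ Dbar : ℝ, 0 < Dbar ∧
      ∀ p : ℝ, 3 * (n : ℝ) < p → ∀ D : ℝ, Dbar ≤ D →
      ∀ g : ℕ → ModifiedDp.Metric n M,
        (∃ C : ℝ, ∀ j, ∫⁻ x, ENNReal.ofReal (ModifiedDp.normMetric g₀ (g j) x ^ ((n : ℝ) / 2))
          ∂(ModifiedDp.vol g₀) ≤ ENNReal.ofReal C) →
        Tendsto (fun j => ∫⁻ x, ENNReal.ofReal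
            (ModifiedDp.normInvDiff g₀ (g j) x ^ ((n : ℝ) * (p - 1) / 2))
          ∂(ModifiedDp.vol g₀)) atTop (𝓝 0) →
        TendstoUniformly
          (fun j (q : M × M) => ModifiedDp.modDist p D (g j) g₀ q.1 q.2)
          (fun q : M × M => ModifiedDp.modDist p D g₀ g₀ q.1 q.2) atTop := by
  refine ⟨1, one_pos, fun p hp D hD g hgC hg => ?_⟩
  obtain ⟨C, hgC⟩ := hgC
  have hn' : (3 : ℝ) ≤ n := by exact_mod_cast hn
  have hp0 : 0 < p := by linarith
  have hpn : (n : ℝ) < p := by linarith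
  have hD0 : 0 < D := by linarith
  refine UniformFun.tendsto_iff_tendstoUniformly.1
    (((ModifiedDp.equicontinuous_modDist hp0 hpn D g g₀).tendsto_uniformFun_iff_pi _ _).2
      (tendsto_pi_nhds.2 ?_))
  rintro ⟨x, y⟩
  refine tendsto_order.2 ⟨fun r hr => ?_, fun r hr => ?_⟩
  · obtain ⟨f, hf, hrf⟩ := ModifiedDp.exists_lt_of_lt_modDist hp0 hpn hr
    filter_upwards [ModifiedDp.eventually_exists_competitor (by omega) hpn hD0 ENNReal.ofReal_ne_top
      hgC hg hf x y (half_pos (sub_pos.2 hrf))] with j ⟨h, hh, hle⟩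
    have := ModifiedDp.le_modDist hp0 hpn hh x y
    dsimp only at hrf ⊢
    linarith
  · -- otherwise some near-optimal competitors for `g j` would converge, along an ultrafilter, to a
    -- competitor for `g₀` that beats the supremum
    by_contra hcon
    rw [not_eventually] at hcon
    simp only [not_lt] at hcon
    obtain ⟨s, hs1, hs2⟩ := exists_between hr
    have hex : ∀ j, ∃ f, ModifiedDp.Admissible p D (g j) g₀ f ∧
        (r ≤ ModifiedDp.modDist p D (g j) g₀ x y → s < |f x - f y|) := by
      intro j
      by_cases hj : r ≤ ModifiedDp.modDist p D (g j) g₀ x y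
      · obtain ⟨f, hf, hfs⟩ := ModifiedDp.exists_lt_of_lt_modDist hp0 hpn (hs2.trans_le hj)
        exact ⟨f, hf, fun _ => hfs⟩
      · exact ⟨_, ModifiedDp.admissible_const hp0 hpn D (g j) g₀ 0, fun h => absurd h hj⟩
    choose f hf hfs using hex
    have hne : (atTop ⊓ 𝓟 {j | r ≤ ModifiedDp.modDist p D (g j) g₀ x y}).NeBot :=
      frequently_mem_iff_neBot.1 hcon
    set 𝒰 := Ultrafilter.of (atTop ⊓ 𝓟 {j | r ≤ ModifiedDp.modDist p D (g j) g₀ x y})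
    have h𝒰 := Ultrafilter.of_le (atTop ⊓ 𝓟 {j | r ≤ ModifiedDp.modDist p D (g j) g₀ x y})
    obtain ⟨f', hf', hlim⟩ := ModifiedDp.exists_limit_competitor hn hp ENNReal.ofReal_ne_top hgC hg
      (𝒰 := 𝒰) (h𝒰.trans inf_le_left) hf
    have h1 : s ≤ |f' x - f' y| := by
      refine ge_of_tendsto (hlim x y) ?_
      have h2 : {j | r ≤ ModifiedDp.modDist p D (g j) g₀ x y} ∈ (𝒰 : Filter ℕ) :=
        (h𝒰.trans inf_le_right) (mem_principal_self _)
      filter_upwards [h2] with j hj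
      exact (hfs j hj).le
    exact absurd (h1.trans (ModifiedDp.le_modDist hp0 hpn hf' x y)) (not_le.2 hs1)
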